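/- **Setting.** Let $(\Omega,\mathcal F,\mathbb P)$ be a probability space, let $\Theta=[a,1]$ with $0<a<1$ be the set of agent types, and let $\mu$ be a finite measure on $\Theta$ that is absolutely continuous with respect to Lebesgue measure. Type $\theta$ values a claim $X\in L^2(\Omega,\mathcal F,\mathbb P)$ at $U(\theta,X)=\mathrm E[X]-\theta\,\mathrm{Var}[X]$ and has reservation utility $0$. There are two firms $i=1,2$ (the rival of $i$ is written $-i$). Firm $i$ has an initial endowment $W_i\in L^2$, a closed, convex, bounded set of feasible claims $\mathcal X_i\subset L^2$ with $0\in\mathcal X_i$, and a risk measure $\varrho_i:L^2\to\mathbb R\cup\{+\infty\}$ that is monotone ($X\le Y\Rightarrow\varrho_i(X)\ge\varrho_i(Y)$), cash invariant ($\varrho_i(X+m)=\varrho_i(X)-m$ for $m\in\mathbb R$), convex, law invariant, and has the Fatou property ($X_n\to X$ in $L^2$ implies $\varrho_i(X)\le\liminf_n\varrho_i(X_n)$). **Catalogues.** Firm $i$ offers a catalogue $C_i=\{(X_i(\theta),p_i(\theta))\}_{\theta\in\Theta}$ with $X_i(\theta)\in\mathcal X_i$ depending measurably on $\theta$ and $p_i(\theta)\in\mathbb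 R$. Its indirect utility is $v_i(\theta)=\sup_{\tau\in\Theta}\{U(\theta,X_i(\tau))-p_i(\tau)\}$. The catalogue is admissible if it is incentive compatible, i.e. $U(\theta,X_i(\theta))-p_i(\theta)=v_i(\theta)$ for all $\theta\in\Theta$; if $v_i\ge 0$ on $\Theta$; and if $v_i'(\theta)=-\mathrm{Var}[X_i(\theta)]$ for almost every $\theta\in\Theta$. Put $\Theta_i=\{v_i>v_{-i}\}$ and $\Theta_0=\{v_1=v_2\}$. A tie-breaking rule is a measurable $f:\Theta\to[0,1]$; write $f_1=f$ and $f_2=1-f$. **Risk.** With $\bar X=X-\mathrm E[X]$, the risk assessment of firm $i$ after trading is $$A_i(C_1,C_2,f)=\varrho_i\Big(W_i-\int_{\Theta_i}\bar X_i(\theta)\,\mu(d\theta)-\int_{\Theta_0}f_i(\theta)\bar X_i(\theta)\,\mu(d\theta)\Big)-I_i(C_1,C_2,f),$$ $$I_i(C_1,C_2,f)=\int_{\Theta_i}\big(\theta v_i'(\theta)-v_i(\theta)\big)\mu(d\theta)+\int_{\Theta_0}\big(\theta v_i'(\theta)-v_i(\theta)\big)f_i(\theta)\,\mu(d\theta).$$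 **Theorem.** A socially efficient allocation exists: there are admissible catalogues $C_1^*,C_2^*$ and a tie-breaking rule $f^*$ with $A_i(C_1^*,C_2^*,f^*)\le\varrho_i(W_i)$ for $i=1,2$, such that $$A_1(C_1^*,C_2^*,f^*)+A_2(C_1^*,C_2^*,f^*)\le A_1(C_1,C_2,f)+A_2(C_1,C_2,f)$$ for all admissible catalogues $C_1,C_2$ and all tie-breaking rules $f$ with $A_i(C_1,C_2,f)\le\varrho_i(W_i)$ for $i=1,2$. -/

import Mathlib

open MeasureTheory ProbabilityTheory Filter Topology Set

noncomputable section

namespace OTC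

/-- Square-integrable contingent claims on `(Ω, ℱ, P)`, modulo almost sure equality. -/
abbrev Claim {Ω : Type*} [MeasurableSpace Ω] (P : Measure Ω) : Type _ := Lp ℝ 2 P

/-! ### Risk measures -/

/-- A convex (monetary) measure of risk on `L²` with values in `ℝ ∪ {+∞}`. -/
structure IsConvexRiskMeasure {Ω : Type*} [MeasurableSpace Ω] (P : Measure Ω) [IsProbabilityMeasure P]
    (ρ : Claim P → EReal) : Prop where
  ne_bot : ∀ X, ρ X ≠ ⊥
  monotone : ∀ X Y : Claim P, X ≤ Y → ρ Y ≤ ρ X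
  cash_invariant : ∀ (X : Claim P) (m : ℝ), ρ (X + Lp.const 2 P m) = ρ X - (m : EReal)
  convex : ∀ (X Y : Claim P) (t : ℝ), 0 ≤ t → t ≤ 1 →
    ρ (t • X + (1 - t) • Y) ≤ (t : EReal) * ρ X + ((1 - t : ℝ) : EReal) * ρ Y

/-- The risk of a claim depends only on its law. -/
def LawInvariant {Ω : Type*} [MeasurableSpace Ω] (P : Measure Ω) (ρ : Claim P → EReal) : Prop :=
  ∀ X Y : Claim P, P.map X = P.map Y → ρ X = ρ Y

/-- The Fatou property on `L²`: sequential lower semicontinuity for the norm. -/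
def FatouProperty {Ω : Type*} [MeasurableSpace Ω] (P : Measure Ω) (ρ : Claim P → EReal) : Prop :=
  ∀ (X : ℕ → Claim P) (Y : Claim P), Tendsto X atTop (𝓝 Y) →
    ρ Y ≤ liminf (fun n => ρ (X n)) atTop

/-! ### Agents, catalogues and indirect utilities -/

/-- The set of agent types (risk aversions). -/
def types (a : ℝ) : Set ℝ := Icc a 1

/-- The expectation of a claim. -/
def mean {Ω : Type*} [MeasurableSpace Ω] {P : Measure Ω} (X : Claim P) : ℝ := ∫ ω, X ω ∂P

/-- The variance of a claim. -/
def var {Ω : Type*} [MeasurableSpace Ω] {P : Measure Ω} (X : Claim P) : ℝ := variance X P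

/-- The claim `X - E[X]`. -/
def centred {Ω : Type*} [MeasurableSpace Ω] {P : Measure Ω} [IsProbabilityMeasure P]
    (X : Claim P) : Claim P := X - Lp.const 2 P (mean X)

/-- Mean-variance utility `U(θ, X) = E[X] - θ Var[X]` of type `θ`. -/
def utility {Ω : Type*} [MeasurableSpace Ω] {P : Measure Ω} (θ : ℝ) (X : Claim P) : ℝ :=
  mean X - θ * var X

/-- A catalogue `{(X(θ), p(θ))}` of claims and prices, listed by the type each contract is meant
for. Only the entries with `θ ∈ types a` are on offer. -/
structure Catalogue {Ω : Type*} [MeasurableSpace Ω] (P : Measure Ω) where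
  product : ℝ → Claim P
  price : ℝ → ℝ

/-- The indirect utility `v(θ, C)`: the supremum of `U(θ, X) - p` over the contracts of `C`. -/
def indirectUtility {Ω : Type*} [MeasurableSpace Ω] {P : Measure Ω} (a : ℝ) (C : Catalogue P)
    (θ : ℝ) : ℝ :=
  sSup ((fun τ => utility θ (C.product τ) - C.price τ) '' types a)

/-- `C` can be offered by a firm with financially feasible set `𝒳`: its products lie in `𝒳` and
depend measurably on the type, it is incentive compatible (the contract meant for `θ` is a best
response of `θ` within `C`), individually rational for the agents, and it satisfies the variance
constraint `v'(θ) = -Var[X(θ)]`, which can only be asked for almost every type since the convex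
function `v` may have kinks. -/
structure IsAdmissible {Ω : Type*} [MeasurableSpace Ω] {P : Measure Ω} (a : ℝ) (μ : Measure ℝ)
    (𝒳 : Set (Claim P)) (C : Catalogue P) : Prop where
  measurable : AEStronglyMeasurable C.product (μ.restrict (types a))
  mem : ∀ θ ∈ types a, C.product θ ∈ 𝒳
  incentive_compatible : ∀ θ ∈ types a, ∀ τ ∈ types a,
    utility θ (C.product τ) - C.price τ ≤ utility θ (C.product θ) - C.price θ
  individually_rational : ∀ θ ∈ types a, 0 ≤ indirectUtility a C θ
  variance_constraint : ∀ᵐ θ ∂(volume.restrict (types a)),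
    HasDerivAt (indirectUtility a C) (-var (C.product θ)) θ

/-! ### Market segmentation and the firms' risk. The two firms are `0` and `1` in `Fin 2`; the
rival of firm `i` is `i + 1`. -/

/-- `Θ_i`: the types that strictly prefer the catalogue of firm `i`. -/
def segment {Ω : Type*} [MeasurableSpace Ω] {P : Measure Ω} (a : ℝ) (C : Fin 2 → Catalogue P)
    (i : Fin 2) : Set ℝ :=
  {θ ∈ types a | indirectUtility a (C (i + 1)) θ < indirectUtility a (C i) θ}

/-- `Θ_0`: the indifferent types. -/
def ties {Ω : Type*} [MeasurableSpace Ω] {P : Measure Ω} (a : ℝ) (C : Fin 2 → Catalogue P) :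
    Set ℝ :=
  {θ ∈ types a | indirectUtility a (C 0) θ = indirectUtility a (C 1) θ}

/-- A tie-breaking rule: a measurable `f` with `0 ≤ f ≤ 1` on the set of types. -/
def IsTieBreakingRule (a : ℝ) (f : ℝ → ℝ) : Prop :=
  Measurable f ∧ ∀ θ ∈ types a, 0 ≤ f θ ∧ f θ ≤ 1

/-- The proportion of indifferent agents contracting with each firm: `f` for the first firm and
`1 - f` for the second. -/
def share (f : ℝ → ℝ) (i : Fin 2) (θ : ℝ) : ℝ := if i = 0 then f θ else 1 - f θ

/-- `R_i`: the risk of firm `i` after trading, the traded claims being centred. -/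
def risk {Ω : Type*} [MeasurableSpace Ω] {P : Measure Ω} [IsProbabilityMeasure P] (a : ℝ)
    (μ : Measure ℝ) (ρ : Fin 2 → Claim P → EReal) (W : Fin 2 → Claim P)
    (C : Fin 2 → Catalogue P) (f : ℝ → ℝ) (i : Fin 2) : EReal :=
  ρ i (W i - (∫ θ in segment a C i, centred ((C i).product θ) ∂μ)
    - ∫ θ in ties a C, share f i θ • centred ((C i).product θ) ∂μ)

/-- `I_i`: the income of firm `i`. Here `θ v_i'(θ) - v_i(θ)` is the price of the centred claim
meant for type `θ`. -/
def income {Ω : Type*} [MeasurableSpace Ω] {P : Measure Ω} (a : ℝ) (μ : Measure ℝ)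
    (C : Fin 2 → Catalogue P) (f : ℝ → ℝ) (i : Fin 2) : ℝ :=
  (∫ θ in segment a C i,
      (θ * deriv (indirectUtility a (C i)) θ - indirectUtility a (C i) θ) ∂μ)
    + ∫ θ in ties a C,
      (θ * deriv (indirectUtility a (C i)) θ - indirectUtility a (C i) θ) * share f i θ ∂μ

/-- `A_i = R_i - I_i`: the risk assessment of firm `i` after trading. -/
def assessment {Ω : Type*} [MeasurableSpace Ω] {P : Measure Ω} [IsProbabilityMeasure P] (a : ℝ)
    (μ : Measure ℝ) (ρ : Fin 2 → Claim P → EReal) (W : Fin 2 → Claim P)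
    (C : Fin 2 → Catalogue P) (f : ℝ → ℝ) (i : Fin 2) : EReal :=
  risk a μ ρ W C f i - (income a μ C f i : EReal)

/-- `A = A_1 + A_2`: the aggregate risk. -/
def aggregateRisk {Ω : Type*} [MeasurableSpace Ω] {P : Measure Ω} [IsProbabilityMeasure P] (a : ℝ)
    (μ : Measure ℝ) (ρ : Fin 2 → Claim P → EReal) (W : Fin 2 → Claim P)
    (C : Fin 2 → Catalogue P) (f : ℝ → ℝ) : EReal :=
  ∑ i, assessment a μ ρ W C f i

/-- The constraints of the social planner's problem: admissible catalogues, a tie-breaking rule,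
and individual rationality of the firms, `A_i ≤ ρ_i(W_i)`. -/
structure IsFeasible {Ω : Type*} [MeasurableSpace Ω] {P : Measure Ω} [IsProbabilityMeasure P]
    (a : ℝ) (μ : Measure ℝ) (𝒳 : Fin 2 → Set (Claim P)) (ρ : Fin 2 → Claim P → EReal)
    (W : Fin 2 → Claim P) (C : Fin 2 → Catalogue P) (f : ℝ → ℝ) : Prop where
  admissible : ∀ i, IsAdmissible a μ (𝒳 i) (C i)
  tie_breaking : IsTieBreakingRule a f
  firm_rational : ∀ i, assessment a μ ρ W C f i ≤ ρ i (W i)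

/-- A socially efficient allocation: a feasible catalogue profile and tie-breaking rule of least
aggregate risk among all the feasible ones. -/
def IsSociallyEfficient {Ω : Type*} [MeasurableSpace Ω] {P : Measure Ω} [IsProbabilityMeasure P]
    (a : ℝ) (μ : Measure ℝ) (𝒳 : Fin 2 → Set (Claim P)) (ρ : Fin 2 → Claim P → EReal)
    (W : Fin 2 → Claim P) (C : Fin 2 → Catalogue P) (f : ℝ → ℝ) : Prop :=
  IsFeasible a μ 𝒳 ρ W C f ∧
    ∀ (C' : Fin 2 → Catalogue P) (f' : ℝ → ℝ), IsFeasible a μ 𝒳 ρ W C' f' →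
      aggregateRisk a μ ρ W C f ≤ aggregateRisk a μ ρ W C' f'

end OTC

end

noncomputable section

namespace OTC

/-! The two firms are merged into one planner. A plan consists of an antitone schedule `g` of
variances, a split `f` of the types between the firms, and feasible claims whose variances are at
most `g` wherever they are sold. The utility profile `rent g` has slope `-g` and leaves type 1, the
hardest to please, exactly at its reservation utility; granting it to the buyers makes the firms
forgo `cost μ g`. The relaxed problem minimises `total`, the risks of the two aggregate claims plus
this cost, with no individual rationality constraint for the firms.

The relaxed problem has a solution (`exists_optimal_plan`): Helly's theorem handles the schedules,
and a nested intersection of closed convex sets in an `L²` space, in place of weak compactness,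
handles splits and claims.

The central tool is sorting (`exists_sorted_plan`). At ties, or when variances stay below the
schedule, the buyers may receive less than the cost of the schedule. Handing the claims out again in
decreasing order of variance, averaged over each variance level, keeps both aggregates and yields a
plan that costs, up to `ε`, no more than what the buyers received. Applied to the larger of the two
indirect utilities of arbitrary admissible catalogues, it shows that an optimal plan bounds their
aggregate risk from below (`IsOptimalPlan.total_le_aggregateRisk`).

Applied to an optimal plan of finite total, sorting reveals its structure. Variances equal the
schedule on the buyers (`IsOptimalPlan.norm_sq_eq`); no firm is worse off than without trade
(`IsOptimalPlan.risk_add_le`), so the omitted constraint holds automatically; and each firm owns one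
feasible claim `Z` whose variance dominates `g` on its buyers (`IsOptimalPlan.exists_norm_sq_ge`).

Such a plan is implementable (`exists_catalogue`). Each firm offers the contracts of its own buyers,
the null contract and limits of these; types outside its clientele are assigned best responses,
realised by multiples of `Z`. Its indirect utility is at most `rent g`, with equality on its buyers,
so the tie-breaking rule `f` reproduces the intended split and the lower bound is attained. If the
least total is infinite, every competitor has infinite aggregate risk and the null plan is
efficient. -/

/-! ### Tools from Hilbert space geometry and real analysis. -/

/-- A decreasing sequence of nonempty closed convex sets of a Hilbert space, the first of which is
bounded, has a common point. -/
theorem nonempty_iInter_of_antitone_convex {H : Type*} [NormedAddCommGroup H]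
    [InnerProductSpace ℝ H] [CompleteSpace H] (S : ℕ → Set H) (hanti : Antitone S)
    (hclosed : ∀ n, IsClosed (S n)) (hconvex : ∀ n, Convex ℝ (S n)) (hne : ∀ n, (S n).Nonempty)
    (hbdd : Bornology.IsBounded (S 0)) : ∃ x, ∀ n, x ∈ S n := by
  -- The points of least norm have increasing bounded norms, and the obtuse angle inequality turns
  -- this into the Cauchy property.
  have h1 : ∀ n, ∃ v ∈ S n, ‖(0 : H) - v‖ = ⨅ w : S n, ‖(0 : H) - w‖ := fun n =>
    exists_norm_eq_iInf_of_complete_convex (hne n) (hclosed n).isComplete (hconvex n) 0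
  choose u hu hmin using h1
  have hinner : ∀ n, ∀ w ∈ S n, 0 ≤ inner ℝ (u n) (w - u n) := by
    intro n w hw
    have := (norm_eq_iInf_iff_real_inner_le_zero (hconvex n) (hu n)).1 (hmin n) w hw
    rw [zero_sub, inner_neg_left] at this
    linarith
  have hpyth : ∀ n m, n ≤ m → ‖u m - u n‖ ^ 2 ≤ ‖u m‖ ^ 2 - ‖u n‖ ^ 2 := by
    intro n m hnm
    have h2 := hinner n (u m) (hanti hnm (hu m))
    have h3 : ‖u m‖ ^ 2 = ‖u n‖ ^ 2 + 2 * inner ℝ (u n) (u m - u n) + ‖u m - u n‖ ^ 2 := by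
      rw [← norm_add_sq_real]; congr 2; abel
    linarith
  obtain ⟨R, hR⟩ := hbdd.exists_norm_le
  have hmono : Monotone fun n => ‖u n‖ ^ 2 := by
    intro n m hnm
    have := hpyth n m hnm
    have h0 := sq_nonneg ‖u m - u n‖
    show ‖u n‖ ^ 2 ≤ ‖u m‖ ^ 2
    linarith
  have hbd : BddAbove (range fun n => ‖u n‖ ^ 2) := by
    refine ⟨R ^ 2, ?_⟩
    rintro _ ⟨n, rfl⟩
    have := hR (u n) (hanti (Nat.zero_le n) (hu n))
    show ‖u n‖ ^ 2 ≤ R ^ 2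
    gcongr
  have hlim := tendsto_atTop_ciSup hmono hbd
  set ℓ := ⨆ n, ‖u n‖ ^ 2
  have hcauchy : CauchySeq u := by
    rw [Metric.cauchySeq_iff']
    intro ε hε
    have h4 : ∀ᶠ n in atTop, ℓ - ε ^ 2 < ‖u n‖ ^ 2 :=
      hlim.eventually (lt_mem_nhds (by linarith [pow_pos hε 2]))
    obtain ⟨N, hN⟩ := h4.exists
    refine ⟨N, fun n hn => ?_⟩
    have h5 := hpyth N n hn
    have h6 : ‖u n‖ ^ 2 ≤ ℓ := le_ciSup hbd n
    rw [dist_eq_norm]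
    exact lt_of_pow_lt_pow_left₀ 2 hε.le (by linarith)
  obtain ⟨x, hx⟩ := cauchySeq_tendsto_of_complete hcauchy
  refine ⟨x, fun n => (hclosed n).mem_of_tendsto hx ?_⟩
  filter_upwards [eventually_ge_atTop n] with m hm
  exact hanti hm (hu m)

/-- Helly's selection theorem for uniformly bounded antitone functions. -/
theorem exists_subseq_tendsto_ae_of_antitone {K : ℝ} (g : ℕ → ℝ → ℝ) (hanti : ∀ n, Antitone (g n))
    (h0 : ∀ n x, 0 ≤ g n x) (hK : ∀ n x, g n x ≤ K) :
    ∃ (φ : ℕ → ℕ) (G : ℝ → ℝ), StrictMono φ ∧ Antitone G ∧ (∀ x, 0 ≤ G x) ∧ (∀ x, G x ≤ K) ∧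
      ∀ᵐ x, Tendsto (fun n => g (φ n) x) atTop (𝓝 (G x)) := by
  -- Compactness of `[0, K]^ℚ` gives convergence at all rationals. At a continuity point of the
  -- upper limit `G`, antitonicity squeezes the sequence between two neighbouring rationals.
  obtain ⟨A, -, φ, hφ, hA⟩ := (isCompact_univ_pi (fun _ : ℚ => isCompact_Icc (a := (0 : ℝ)) (b := K)))
    |>.tendsto_subseq (x := fun n (q : ℚ) => g n q) (fun n q _ => ⟨h0 n q, hK n q⟩)
  have hA' : ∀ q : ℚ, Tendsto (fun n => g (φ n) q) atTop (𝓝 (A q)) := fun q =>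
    (tendsto_pi_nhds.1 hA q)
  have hbu : ∀ x, IsBoundedUnder (· ≤ ·) atTop fun n => g (φ n) x := fun x =>
    isBoundedUnder_of ⟨K, fun n => hK _ _⟩
  have hbl : ∀ x, IsBoundedUnder (· ≥ ·) atTop fun n => g (φ n) x := fun x =>
    isBoundedUnder_of ⟨0, fun n => h0 _ _⟩
  set G : ℝ → ℝ := fun x => limsup (fun n => g (φ n) x) atTop
  have hG : Antitone G := by
    intro x y hxy
    exact limsup_le_limsup (Eventually.of_forall fun n => hanti _ hxy) (hbl y).isCoboundedUnder_le
      (hbu x)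
  have hGq : ∀ q : ℚ, G q = A q := fun q => (hA' q).limsup_eq
  refine ⟨φ, G, hφ, hG, fun x => ?_, fun x => ?_, ?_⟩
  · exact le_limsup_of_frequently_le (Frequently.of_forall fun n => h0 _ _) (hbu x)
  · exact limsup_le_of_le (hbl x).isCoboundedUnder_le (Eventually.of_forall fun n => hK _ _)
  · filter_upwards [hG.countable_not_continuousAt.ae_notMem volume] with x hx
    have hx : ContinuousAt G x := not_not.1 hx
    rw [Metric.tendsto_atTop]
    intro ε hε
    obtain ⟨δ, hδ, hδ'⟩ := Metric.continuousAt_iff.1 hx (ε / 2) (by linarith)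
    obtain ⟨q, hq1, hq2⟩ := exists_rat_btwn (show x - δ < x by linarith)
    obtain ⟨r, hr1, hr2⟩ := exists_rat_btwn (show x < x + δ by linarith)
    have e1 := hδ' (x := (q : ℝ)) (by rw [Real.dist_eq, abs_lt]; constructor <;> linarith)
    have e2 := hδ' (x := (r : ℝ)) (by rw [Real.dist_eq, abs_lt]; constructor <;> linarith)
    rw [Real.dist_eq, abs_lt] at e1 e2
    obtain ⟨N1, hN1⟩ := Metric.tendsto_atTop.1 (hA' q) (ε / 2) (by linarith)
    obtain ⟨N2, hN2⟩ := Metric.tendsto_atTop.1 (hA' r) (ε / 2) (by linarith)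
    refine ⟨max N1 N2, fun n hn => ?_⟩
    have i1 := hN1 n (le_trans (le_max_left _ _) hn)
    have i2 := hN2 n (le_trans (le_max_right _ _) hn)
    rw [Real.dist_eq, abs_lt] at i1 i2
    rw [hGq] at e1 e2
    have j1 := hanti (φ n) hq2.le
    have j2 := hanti (φ n) hr1.le
    rw [Real.dist_eq, abs_lt]
    constructor <;> linarith [e1.1, e1.2, e2.1, e2.2, i1.1, i1.2, i2.1, i2.2]

/-- A weighted average of points of a closed convex set belongs to it. -/
theorem weighted_average_mem {α E : Type*} [MeasurableSpace α] {μ : Measure α}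
    [NormedAddCommGroup E] [NormedSpace ℝ E] [CompleteSpace E] {s : Set E} (hs : Convex ℝ s)
    (hsc : IsClosed s) {w : α → ℝ} {X : α → E} (hw0 : ∀ x, 0 ≤ w x) (hw : Integrable w μ)
    (hX : Integrable (fun x => w x • X x) μ) (hmem : ∀ᵐ x ∂μ, w x ≠ 0 → X x ∈ s)
    (hpos : 0 < ∫ x, w x ∂μ) : (∫ x, w x ∂μ)⁻¹ • ∫ x, w x • X x ∂μ ∈ s := by
  set p := ∫ x, w x ∂μ
  set d : α → ENNReal := fun x => ENNReal.ofReal (p⁻¹ * w x)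
  have hd : AEMeasurable d μ := (hw.aemeasurable.const_mul _).ennreal_ofReal
  have hdt : ∀ᵐ x ∂μ, d x < ⊤ := Eventually.of_forall fun x => ENNReal.ofReal_lt_top
  have hdr : ∀ x, (d x).toReal = p⁻¹ * w x := fun x =>
    ENNReal.toReal_ofReal (mul_nonneg (inv_nonneg.2 hpos.le) (hw0 x))
  have hprob : IsProbabilityMeasure (μ.withDensity d) := by
    constructor
    rw [withDensity_apply _ MeasurableSet.univ, Measure.restrict_univ,
      ← ofReal_integral_eq_lintegral_ofReal (hw.const_mul _)
        (Eventually.of_forall fun x => mul_nonneg (inv_nonneg.2 hpos.le) (hw0 x)),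
      integral_const_mul, inv_mul_cancel₀ hpos.ne', ENNReal.ofReal_one]
  have hmem' : ∀ᵐ x ∂(μ.withDensity d), X x ∈ s := by
    rw [ae_withDensity_iff' hd]
    filter_upwards [hmem] with x hx hdx
    refine hx fun h => hdx ?_
    simp [d, h]
  have hint : Integrable X (μ.withDensity d) := by
    rw [integrable_withDensity_iff_integrable_smul₀' hd hdt]
    simp only [hdr, mul_smul]
    exact hX.smul p⁻¹
  have := hs.integral_mem hsc hmem' hint
  rw [integral_withDensity_eq_integral_toReal_smul₀ hd hdt] at this
  simpa only [hdr, mul_smul, integral_smul] using this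

/-- Functions of `Lᵖ` whose values lie almost everywhere in prescribed closed sets form a closed
set. -/
theorem isClosed_Lp_ae_mem {α F : Type*} [MeasurableSpace α] {μ : Measure α}
    [NormedAddCommGroup F] {Γ : α → Set F} (hΓ : ∀ x, IsClosed (Γ x)) :
    IsClosed {u : Lp F 2 μ | ∀ᵐ x ∂μ, u x ∈ Γ x} := by
  refine IsSeqClosed.isClosed fun u v hu huv => ?_
  obtain ⟨ns, -, hns⟩ := (tendstoInMeasure_of_tendsto_Lp huv).exists_seq_tendsto_ae
  filter_upwards [hns, ae_all_iff.2 hu] with x hx hux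
  exact (hΓ x).mem_of_tendsto hx (Eventually.of_forall fun n => hux _)

/-- Functions of `Lᵖ` whose values lie almost everywhere in prescribed convex sets form a convex
set. -/
theorem convex_Lp_ae_mem {α F : Type*} [MeasurableSpace α] {μ : Measure α}
    [NormedAddCommGroup F] [NormedSpace ℝ F] {Γ : α → Set F} (hΓ : ∀ x, Convex ℝ (Γ x)) :
    Convex ℝ {u : Lp F 2 μ | ∀ᵐ x ∂μ, u x ∈ Γ x} := by
  intro u hu v hv s t hs ht hst
  filter_upwards [hu, hv, Lp.coeFn_add (s • u) (t • v), Lp.coeFn_smul s u, Lp.coeFn_smul t v]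
    with x h1 h2 h3 h4 h5
  rw [h3, Pi.add_apply, h4, h5]
  exact hΓ x h1 h2 hs ht hst

/-- A function decreasing at least at the antitone rate `g` dominates the integral of `g`. -/
theorem intervalIntegral_le_sub_of_antitone {g V : ℝ → ℝ} (hg : Antitone g) {x y : ℝ} (hxy : x ≤ y)
    (hV : ∀ s ∈ Icc x y, ∀ t ∈ Icc x y, s ≤ t → (t - s) * g t ≤ V s - V t) :
    ∫ s in x..y, g s ≤ V x - V y := by
  -- On each of `N` equal cells the integral is at most the width times the left value of `g`, while
  -- `V` drops by at least the width times the right value; the errors telescope.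
  have key : ∀ N : ℕ, 0 < N → ∫ s in x..y, g s ≤ V x - V y + (y - x) / N * (g x - g y) := by
    intro N hN
    have hN' : (0 : ℝ) < N := by exact_mod_cast hN
    set δ := (y - x) / N
    have hδ : 0 ≤ δ := div_nonneg (by linarith) hN'.le
    have hNδ : N * δ = y - x := by simp only [δ]; field_simp
    have hmem : ∀ k : ℕ, k ≤ N → x + k * δ ∈ Icc x y := by
      intro k hk
      have : (k : ℝ) ≤ N := by exact_mod_cast hk
      constructor
      · nlinarith [k.cast_nonneg (α := ℝ)]
      · nlinarith
    have hstep : ∀ k : ℕ, k ≤ N → ∫ s in x..(x + k * δ), g s ≤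
        V x - V (x + k * δ) + δ * (g x - g (x + k * δ)) := by
      intro k
      induction k with
      | zero => intro _; simp
      | succ k ih =>
        intro hk
        have h1 := ih (by omega)
        have hle : x + k * δ ≤ x + (k + 1 : ℕ) * δ := by push_cast; linarith
        have h2 := hV _ (hmem k (by omega)) _ (hmem (k + 1) hk) hle
        have h3 : ∫ s in (x + k * δ)..(x + (k + 1 : ℕ) * δ), g s ≤ δ * g (x + k * δ) := by
          have := intervalIntegral.integral_mono_on hle (hg.intervalIntegrable (μ := volume))
            (intervalIntegrable_const (c := g (x + k * δ))) (fun t ht => hg ht.1)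
          rw [intervalIntegral.integral_const, smul_eq_mul] at this
          refine this.trans (le_of_eq ?_)
          push_cast; ring
        have h4 : x + (k + 1 : ℕ) * δ - (x + k * δ) = δ := by push_cast; ring
        rw [h4] at h2
        rw [← intervalIntegral.integral_add_adjacent_intervals
          (hg.intervalIntegrable (a := x) (b := x + k * δ)) hg.intervalIntegrable]
        linarith
    have := hstep N le_rfl
    rwa [hNδ, add_sub_cancel] at this
  have hlim : Tendsto (fun N : ℕ => V x - V y + (y - x) / N * (g x - g y)) atTop
      (𝓝 (V x - V y + 0 * (g x - g y))) :=
    ((tendsto_const_div_atTop_nhds_zero_nat (y - x)).mul_const _).const_add _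
  have := ge_of_tendsto hlim ((eventually_gt_atTop 0).mono key)
  linarith

/-- If `v` has the antitone function `-γ` as subgradient selection, then it is differentiable
wherever `γ` is continuous. -/
theorem hasDerivAt_of_subgradient {v γ : ℝ → ℝ} {s : Set ℝ} {x : ℝ} (hs : s ∈ 𝓝 x)
    (hv : ∀ y ∈ s, ∀ z ∈ s, v z - (y - z) * γ z ≤ v y) (hγ : ContinuousAt γ x) :
    HasDerivAt v (-γ x) x := by
  rw [hasDerivAt_iff_isLittleO]
  refine Asymptotics.isLittleO_iff.2 fun c hc => ?_
  obtain ⟨δ, hδ, hδ'⟩ := Metric.continuousAt_iff.1 hγ c hc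
  filter_upwards [hs, Metric.ball_mem_nhds x hδ] with y hy hyx
  have h1 := hv y hy x (mem_of_mem_nhds hs)
  have h2 := hv x (mem_of_mem_nhds hs) y hy
  have h3 := (hδ' hyx).le
  rw [Real.dist_eq] at h3
  -- The subgradient inequalities at `x` and at `y` confine the remainder between `0` and `-(y - x)
  -- * (γ y - γ x)`.
  have h4 : |v y - v x - (y - x) * -γ x| ≤ |(y - x) * (γ y - γ x)| := by
    rw [abs_of_nonneg (by linarith : 0 ≤ v y - v x - (y - x) * -γ x)]
    refine le_trans ?_ (neg_abs_le _ |> neg_le.1)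
    linarith
  rw [smul_eq_mul, Real.norm_eq_abs, Real.norm_eq_abs]
  refine h4.trans ?_
  rw [abs_mul, mul_comm]
  gcongr


/-! ### Plans, their cost and the aggregate claims sold. -/

/-- The indirect utility with subgradients `-g` that vanishes at the type `1`. -/
def rent (g : ℝ → ℝ) (θ : ℝ) : ℝ := ∫ s in θ..1, g s

/-- The amount `v - θ v'` that the firms forgo on type `θ` when the indirect utility is `rent g`. -/
def outlay (g : ℝ → ℝ) (θ : ℝ) : ℝ := rent g θ + θ * g θ

/-- The total amount forgone by the firms. -/
def cost (μ : Measure ℝ) (g : ℝ → ℝ) : ℝ := ∫ θ, outlay g θ ∂μ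

/-- The image under `L` of the aggregate claim sold by firm `i`. -/
def traded {E : Type*} [NormedAddCommGroup E] [NormedSpace ℝ E] (μ : Measure ℝ) (L : E →L[ℝ] E)
    (f : ℝ → ℝ) (X : Fin 2 → ℝ → E) (i : Fin 2) : E :=
  ∫ θ, share f i θ • L (X i θ) ∂μ

/-- A plan: a variance schedule `g`, a split `f` of the types between the two firms and claims whose
variances `‖L X‖²` do not exceed the schedule. -/
structure IsPlan {E : Type*} [NormedAddCommGroup E] [NormedSpace ℝ E] (μ : Measure ℝ)
    (L : E →L[ℝ] E) (𝒳 : Fin 2 → Set E) (K : ℝ) (g f : ℝ → ℝ) (X : Fin 2 → ℝ → E) : Prop where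
  anti : Antitone g
  nonneg : ∀ θ, 0 ≤ g θ
  le : ∀ θ, g θ ≤ K
  f_meas : Measurable f
  f_mem : ∀ θ, f θ ∈ Icc (0 : ℝ) 1
  meas : ∀ i, AEStronglyMeasurable (X i) μ
  mem : ∀ i, ∀ᵐ θ ∂μ, X i θ ∈ 𝒳 i
  var_le : ∀ i, ∀ᵐ θ ∂μ, share f i θ ≠ 0 → ‖L (X i θ)‖ ^ 2 ≤ g θ

/-! ### Elementary properties of the shares. -/

section share

variable {f : ℝ → ℝ}

theorem measurable_share (hf : Measurable f) (i : Fin 2) : Measurable (share f i) := by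
  unfold share
  split_ifs
  · exact hf
  · exact hf.const_sub 1

theorem share_mem (hf : ∀ θ, f θ ∈ Icc (0 : ℝ) 1) (i : Fin 2) (θ : ℝ) :
    share f i θ ∈ Icc (0 : ℝ) 1 := by
  unfold share
  have := hf θ
  split_ifs
  · exact this
  · exact ⟨by linarith [this.2], by linarith [this.1]⟩

theorem sum_share (f : ℝ → ℝ) (θ : ℝ) : ∑ i, share f i θ = 1 := by
  simp [share]

theorem integrable_share_mul {μ : Measure ℝ} (hf : Measurable f) (hf' : ∀ θ, f θ ∈ Icc (0 : ℝ) 1)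
    (i : Fin 2) {u : ℝ → ℝ} (hu : Integrable u μ) : Integrable (fun θ => share f i θ * u θ) μ :=
  hu.bdd_mul (c := 1) (measurable_share hf i).aestronglyMeasurable
    (Eventually.of_forall fun θ => by
      rw [Real.norm_eq_abs, abs_of_nonneg (share_mem hf' i θ).1]; exact (share_mem hf' i θ).2)

theorem integrable_share_smul {E : Type*} [NormedAddCommGroup E] [NormedSpace ℝ E] {μ : Measure ℝ}
    (hf : Measurable f) (hf' : ∀ θ, f θ ∈ Icc (0 : ℝ) 1)
    (i : Fin 2) {u : ℝ → E} (hu : Integrable u μ) : Integrable (fun θ => share f i θ • u θ) μ :=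
  hu.bdd_smul 1 (measurable_share hf i).aestronglyMeasurable
    (Eventually.of_forall fun θ => by
      rw [Real.norm_eq_abs, abs_of_nonneg (share_mem hf' i θ).1]; exact (share_mem hf' i θ).2)

theorem integrable_share {μ : Measure ℝ} [IsFiniteMeasure μ] (hf : Measurable f)
    (hf' : ∀ θ, f θ ∈ Icc (0 : ℝ) 1) (i : Fin 2) : Integrable (share f i) μ := by
  simpa using integrable_share_mul hf hf' i (integrable_const (1 : ℝ) (μ := μ))

theorem sum_integral_share_mul {μ : Measure ℝ} (hf : Measurable f)
    (hf' : ∀ θ, f θ ∈ Icc (0 : ℝ) 1) {u : ℝ → ℝ} (hu : Integrable u μ) :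
    ∑ i, ∫ θ, share f i θ * u θ ∂μ = ∫ θ, u θ ∂μ := by
  rw [← integral_finsetSum _ fun i _ => integrable_share_mul hf hf' i hu]
  simp only [← Finset.sum_mul, sum_share, one_mul]

end share

/-! ### Quantiles -/

/-- Absolute continuity excludes atoms, so the distribution function is continuous and attains every
mass up to the total. The least quantile is taken because sorting needs that a smaller type never
reaches the mass `n`. -/
theorem exists_quantile {a : ℝ} (ha1 : a < 1) {μ : Measure ℝ} [IsFiniteMeasure μ]
    (hμ : μ ≪ volume) (hμΘ : μ (Icc a 1)ᶜ = 0) {n : ℝ} (hn0 : 0 ≤ n) (hn : n ≤ μ.real univ) :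
    ∃ τ ∈ Icc a 1, μ.real (Iic τ) = n ∧ (∀ s ∈ Icc a 1, n ≤ μ.real (Iic s) → τ ≤ s) := by
  have hna : ∀ x, μ {x} = 0 := fun x => hμ (measure_singleton x)
  have hIic : ∀ x y, x ≤ y → μ.real (Iic y) = μ.real (Iic x) + μ.real (Ioc x y) := by
    intro x y hxy
    rw [← measureReal_union (by
      rw [Set.disjoint_left]; intro z hz hz'; exact absurd hz'.1 (not_lt.2 hz)) measurableSet_Ioc,
      Iic_union_Ioc_eq_Iic hxy]
  have : NullSingletonClass μ := ⟨hna⟩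
  have hcont : Continuous fun x => μ.real (Iic x) := by
    have h1 : ∀ x, μ.real (Iic x) = μ.real (Iic 0) + ∫ _ in (0 : ℝ)..x, (1 : ℝ) ∂μ := by
      intro x
      rcases le_total 0 x with h | h
      · rw [intervalIntegral.integral_of_le h, hIic 0 x h]; simp [Measure.real]
      · rw [intervalIntegral.integral_of_ge h, hIic x 0 h]; simp [Measure.real]
    rw [funext h1]
    exact continuous_const.add (intervalIntegral.continuous_primitive
      (fun _ _ => (integrable_const _).intervalIntegrable) 0)
  have hMa : μ.real (Iic a) = 0 := by
    have : μ (Iic a) = 0 := by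
      refine measure_mono_null (t := (Icc a 1)ᶜ ∪ {a}) ?_ (measure_union_null hμΘ (hna a))
      intro x hx
      rcases eq_or_lt_of_le (show x ≤ a from hx) with h | h
      · exact Or.inr h
      · exact Or.inl fun h' => absurd h'.1 (not_le.2 h)
    simp [Measure.real, this]
  have hM1 : μ.real (Iic 1) = μ.real univ := by
    refine measureReal_congr ?_
    rw [ae_eq_univ]
    refine measure_mono_null ?_ hμΘ
    intro x hx h
    exact hx h.2
  set S : Set ℝ := Icc a 1 ∩ {τ | n ≤ μ.real (Iic τ)}
  have hSc : IsCompact S := isCompact_Icc.inter_right (isClosed_le continuous_const hcont)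
  have hSne : S.Nonempty := ⟨1, ⟨ha1.le, le_rfl⟩, by rw [Set.mem_ofPred, hM1]; exact hn⟩
  obtain ⟨τ, hτS, hτ⟩ := hSc.exists_isLeast hSne
  refine ⟨τ, hτS.1, le_antisymm ?_ hτS.2, fun s hs hns => hτ ⟨hs, hns⟩⟩
  by_contra hlt
  push Not at hlt
  have haτ : a ≤ τ := hτS.1.1
  obtain ⟨s, hs, hsn⟩ := intermediate_value_Icc haτ hcont.continuousOn
    (show n ∈ Icc (μ.real (Iic a)) (μ.real (Iic τ)) from ⟨hMa ▸ hn0, hlt.le⟩)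
  have := hτ ⟨⟨hs.1, hs.2.trans hτS.1.2⟩, hsn.ge⟩
  have hsτ : s = τ := le_antisymm hs.2 this
  subst hsτ
  exact hlt.ne' hsn

/-! ### Step schedules -/

/-- Each level is cut at `ϑ`: `δ * τ j = δ * (τ j - ϑ) + ϑ * δ`. At a type `s` the levels with `s <
τ j` lie below `g s / δ`, so integration over `[ϑ, 1]` bounds the first parts by `rent g ϑ`; all
levels lie below `x / δ`, which bounds the second parts by `ϑ * x`. Levels start at 1 so that at
most `y / δ` of them lie below `y / δ`. -/
theorem sum_le_rent_add {a δ x ϑ : ℝ} (ha : 0 < a) (hδ : 0 < δ) {g : ℝ → ℝ} (hg : Antitone g)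
    (hg0 : ∀ θ ∈ Icc a 1, 0 ≤ g θ) {τ : ℕ → ℝ} (hτ : ∀ j, τ j ∈ Icc a 1) {S : Finset ℕ}
    (hS : ∀ j ∈ S, 1 ≤ j) (hgS : ∀ j ∈ S, ∀ s ∈ Icc a 1, s < τ j → j * δ < g s)
    (hϑ : ϑ ∈ Icc a 1) (hx0 : 0 ≤ x) (hx : ∀ j ∈ S, j * δ ≤ x) :
    ∑ j ∈ S, δ * τ j ≤ rent g ϑ + ϑ * x := by
  have hcard : ∀ (T : Finset ℕ) (y : ℝ), 0 ≤ y → (∀ j ∈ T, 1 ≤ j ∧ j * δ ≤ y) →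
      T.card * δ ≤ y := by
    intro T y hy hT
    rcases T.eq_empty_or_nonempty with h | h
    · simpa [h] using hy
    · have h1 : T ⊆ Finset.Icc 1 (T.max' h) := fun j hj =>
        Finset.mem_Icc.2 ⟨(hT j hj).1, T.le_max' j hj⟩
      have h2 : T.card ≤ T.max' h := by simpa using Finset.card_le_card h1
      have h3 : (T.card : ℝ) ≤ T.max' h := by exact_mod_cast h2
      exact (mul_le_mul_of_nonneg_right h3 hδ.le).trans (hT _ (T.max'_mem h)).2
  have h1 : ∑ j ∈ S, δ * (τ j - ϑ) ≤ rent g ϑ := by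
    have hint : ∀ j, IntervalIntegrable (fun s => if s < τ j then δ else 0) volume ϑ 1 := by
      intro j
      refine Antitone.intervalIntegrable fun s t hst => ?_
      show (if t < τ j then δ else 0) ≤ if s < τ j then δ else 0
      split_ifs with h h'
      · exact le_rfl
      · exact absurd (hst.trans_lt h) h'
      · exact hδ.le
      · exact le_rfl
    have h2 : ∫ s in ϑ..1, ∑ j ∈ S, (if s < τ j then δ else 0) ≤ rent g ϑ := by
      refine intervalIntegral.integral_mono_on hϑ.2 ?_ hg.intervalIntegrable ?_
      · simpa [Finset.sum_fn] using IntervalIntegrable.sum S fun j _ => hint j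
      · intro s hs
        have hsa : s ∈ Icc a 1 := ⟨hϑ.1.trans hs.1, hs.2⟩
        rw [← Finset.sum_filter, Finset.sum_const, nsmul_eq_mul]
        refine hcard _ _ (hg0 s hsa) fun j hj => ?_
        rw [Finset.mem_filter] at hj
        exact ⟨hS j hj.1, (hgS j hj.1 s hsa hj.2).le⟩
    rw [intervalIntegral.integral_finsetSum fun j _ => hint j] at h2
    refine le_trans (Finset.sum_le_sum fun j _ => ?_) h2
    rcases le_total (τ j) ϑ with h | h
    · refine le_trans (mul_nonpos_of_nonneg_of_nonpos hδ.le (by linarith)) ?_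
      refine intervalIntegral.integral_nonneg hϑ.2 fun s _ => ?_
      split_ifs
      · exact hδ.le
      · exact le_rfl
    · rw [← intervalIntegral.integral_add_adjacent_intervals (b := τ j)
        ((hint j).mono_set (by
          rw [uIcc_of_le h, uIcc_of_le hϑ.2]; exact Icc_subset_Icc_right (hτ j).2))
        ((hint j).mono_set (by
          rw [uIcc_of_le (hτ j).2, uIcc_of_le hϑ.2]; exact Icc_subset_Icc_left h))]
      have e1 : ∫ s in ϑ..τ j, (if s < τ j then δ else 0) = δ * (τ j - ϑ) := by
        rw [intervalIntegral.integral_congr_ae (g := fun _ => δ)]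
        · simp [mul_comm]
        · filter_upwards [Measure.ae_ne volume (τ j)] with s hs hs'
          rw [uIoc_of_le h] at hs'
          rw [if_pos (lt_of_le_of_ne hs'.2 hs)]
      have e2 : 0 ≤ ∫ s in τ j..1, (if s < τ j then δ else 0) := by
        refine intervalIntegral.integral_nonneg (hτ j).2 fun s _ => ?_
        split_ifs
        · exact hδ.le
        · exact le_rfl
      linarith
  have h2 := hcard S x hx0 fun j hj => ⟨hS j hj, hx j hj⟩
  have h3 : ∑ j ∈ S, δ * τ j = ∑ j ∈ S, δ * (τ j - ϑ) + ϑ * (S.card * δ) := by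
    simp only [mul_sub, Finset.sum_sub_distrib, Finset.sum_const, nsmul_eq_mul]
    ring
  have h4 : 0 < ϑ := ha.trans_le hϑ.1
  nlinarith

/-- The outlay of a step schedule. -/
theorem outlay_step {a δ : ℝ} {τ : ℕ → ℝ} (hτ : ∀ j, τ j ∈ Icc a 1) (B : ℕ) {θ : ℝ}
    (hθ : θ ∈ Icc a 1) :
    outlay (fun s => ∑ j ∈ Finset.range B, if s ≤ τ j then δ else 0) θ =
      ∑ j ∈ Finset.range B, if θ ≤ τ j then δ * τ j else 0 := by
  unfold outlay rent
  have hint : ∀ j u v, IntervalIntegrable (fun s => if s ≤ τ j then δ else 0) volume u v := by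
    intro j u v
    have : (fun s => if s ≤ τ j then δ else 0) = fun s => δ * (if s ≤ τ j then 1 else 0) := by
      funext s; simp
    rw [this]
    refine IntervalIntegrable.const_mul (Antitone.intervalIntegrable fun s t hst => ?_) _
    show (if t ≤ τ j then (1 : ℝ) else 0) ≤ if s ≤ τ j then 1 else 0
    split_ifs with h h'
    · exact le_rfl
    · exact absurd (hst.trans h) h'
    · exact zero_le_one
    · exact le_rfl
  rw [intervalIntegral.integral_finsetSum fun j _ => hint j _ _, Finset.mul_sum,
    ← Finset.sum_add_distrib]
  refine Finset.sum_congr rfl fun j _ => ?_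
  have hz : ∀ u, τ j ≤ u → u ≤ 1 → ∫ s in u..1, (if s ≤ τ j then δ else 0) = 0 := by
    intro u hu hu1
    rw [intervalIntegral.integral_congr_ae (g := fun _ => 0)]
    · simp
    · refine Eventually.of_forall fun s hs => ?_
      rw [uIoc_of_le hu1] at hs
      rw [if_neg (not_le.2 (hu.trans_lt hs.1))]
  -- A step of height `δ` ending at `τ j` costs `δ * (τ j - θ) + θ * δ = δ * τ j`, the same for
  -- every type it covers.
  split_ifs with h
  · rw [← intervalIntegral.integral_add_adjacent_intervals (b := τ j) (hint j _ _) (hint j _ _),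
      hz _ le_rfl (hτ j).2]
    rw [intervalIntegral.integral_congr (g := fun _ => δ)]
    · simp; ring
    · intro s hs
      rw [uIcc_of_le h] at hs
      exact if_pos hs.2
  · rw [hz θ (not_le.1 h).le hθ.2]
    ring


/-! ### Rearrangements of plans -/

/-- The standing assumptions on the sets of feasible claims. -/
structure IsClaimFamily {E : Type*} [NormedAddCommGroup E] [NormedSpace ℝ E] (L : E →L[ℝ] E)
    (𝒳 : Fin 2 → Set E) (K R : ℝ) : Prop where
  closed : ∀ i, IsClosed (𝒳 i)
  convex : ∀ i, Convex ℝ (𝒳 i)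
  zero_mem : ∀ i, 0 ∈ 𝒳 i
  norm_le : ∀ i, ∀ x ∈ 𝒳 i, ‖x‖ ≤ R
  var_le : ∀ i, ∀ x ∈ 𝒳 i, ‖L x‖ ^ 2 ≤ K

theorem integral_eq_sum_fibers {α E : Type*} [MeasurableSpace α] [NormedAddCommGroup E]
    [NormedSpace ℝ E] {μ : Measure α} {F : α → E} (hF : Integrable F μ) {h : α → ℕ}
    (hh : Measurable h) {B : ℕ} (hB : ∀ x, h x ≤ B) :
    ∫ x, F x ∂μ = ∑ c ∈ Finset.range (B + 1), ∫ x in h ⁻¹' {c}, F x ∂μ := by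
  rw [← integral_biUnion_finset _ (fun c _ => hh (measurableSet_singleton c))
    (fun c _ d _ hcd => (disjoint_singleton.2 hcd).preimage h) fun c _ => hF.integrableOn]
  rw [← setIntegral_univ]
  congr 2
  ext x
  simpa using Nat.lt_succ_of_le (hB x)

section rearrangement

variable {E : Type*} [NormedAddCommGroup E] [NormedSpace ℝ E] {μ : Measure ℝ}

/-- The function `b k` grades the claims sold by firm `k` and `β` grades the types that are to
receive them. Equal tails give each level the same mass on both sides. Hence all types of level `c`
can receive, from each firm, the average of its claims of level `c`, with the firms sharing these
types in proportion to the masses; averages stay in the closed convex sets. -/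
theorem exists_rearrangement [CompleteSpace E] [IsFiniteMeasure μ] {f : ℝ → ℝ} (hf : Measurable f)
    (hf' : ∀ θ, f θ ∈ Icc (0 : ℝ) 1) {X : Fin 2 → ℝ → E}
    (hX : ∀ k, Integrable (fun θ => share f k θ • X k θ) μ) {b : Fin 2 → ℝ → ℕ} {β : ℝ → ℕ}
    (hb : ∀ k, Measurable (b k)) (hβ : Measurable β) {B : ℕ} (hbB : ∀ k θ, b k θ ≤ B)
    (hβB : ∀ θ, β θ ≤ B)
    (htail : ∀ j, ∑ k, ∫ θ in {θ | j ≤ b k θ}, share f k θ ∂μ = μ.real {θ | j ≤ β θ})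
    {C : Fin 2 → ℕ → Set E} (hC : ∀ k c, Convex ℝ (C k c)) (hC' : ∀ k c, IsClosed (C k c))
    (hXC : ∀ k θ, X k θ ∈ C k (b k θ)) :
    ∃ (f' : ℝ → ℝ) (X' : Fin 2 → ℝ → E), Measurable f' ∧ (∀ θ, f' θ ∈ Icc (0 : ℝ) 1) ∧
      (∀ k, StronglyMeasurable (X' k)) ∧
      (∀ k θ, X' k θ = 0 ∨ X' k θ ∈ C k (β θ)) ∧
      (∀ k, ∀ᵐ θ ∂μ, share f' k θ ≠ 0 → X' k θ ∈ C k (β θ)) ∧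
      ∀ k, ∫ θ, share f' k θ • X' k θ ∂μ = ∫ θ, share f k θ • X k θ ∂μ := by
  have hsh : ∀ k, Integrable (share f k) μ := fun k => integrable_share hf hf' k
  have hsh0 : ∀ k θ, 0 ≤ share f k θ := fun k θ => (share_mem hf' k θ).1
  set p : Fin 2 → ℕ → ℝ := fun k c => ∫ θ in b k ⁻¹' {c}, share f k θ ∂μ with hp
  have hp0 : ∀ k c, 0 ≤ p k c := fun k c => integral_nonneg fun θ => hsh0 k θ
  have hsum : ∀ c, p 0 c + p 1 c = μ.real (β ⁻¹' {c}) := by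
    intro c
    have h1 : ∀ k, p k c = ∫ θ in {θ | c ≤ b k θ}, share f k θ ∂μ
        - ∫ θ in {θ | c + 1 ≤ b k θ}, share f k θ ∂μ := by
      intro k
      rw [← setIntegral_sdiff (measurableSet_le measurable_const (hb k)) (hsh k).integrableOn (show {θ | c + 1 ≤ b k θ} ⊆ {θ | c ≤ b k θ} from fun θ h => (Nat.le_succ c).trans h)]
      simp only [hp]
      congr 2
      ext θ
      simp only [mem_preimage, mem_singleton_iff, Set.mem_sdiff, Set.mem_ofPred]
      omega
    have h2 : μ.real (β ⁻¹' {c}) = μ.real {θ | c ≤ β θ} - μ.real {θ | c + 1 ≤ β θ} := by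
      rw [← measureReal_sdiff (show {θ | c + 1 ≤ β θ} ⊆ {θ | c ≤ β θ} from
        fun θ h => (Nat.le_succ c).trans h)
        (measurableSet_le measurable_const hβ)]
      congr 1
      ext θ
      simp only [mem_preimage, mem_singleton_iff, Set.mem_sdiff, Set.mem_ofPred]
      omega
    rw [h1, h1, h2, ← htail, ← htail, Fin.sum_univ_two, Fin.sum_univ_two]
    ring
  -- For a level of mass zero the inverse is `0` and so is the claim; this is the first alternative
  -- offered for `X'`.
  set Y : Fin 2 → ℕ → E := fun k c => (p k c)⁻¹ • ∫ θ in b k ⁻¹' {c}, share f k θ • X k θ ∂μ with hY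
  have hYC : ∀ k c, p k c ≠ 0 → Y k c ∈ C k c := by
    intro k c h
    refine weighted_average_mem (hC k c) (hC' k c) (hsh0 k) (hsh k).integrableOn
      (hX k).integrableOn ?_ (lt_of_le_of_ne (hp0 k c) h.symm)
    filter_upwards [ae_restrict_mem (hb k (measurableSet_singleton c))] with θ hθ _
    have := hXC k θ
    rwa [show b k θ = c from hθ] at this
  have hpY : ∀ k c, p k c • Y k c = ∫ θ in b k ⁻¹' {c}, share f k θ • X k θ ∂μ := by
    intro k c
    by_cases h : p k c = 0
    · rw [h, zero_smul, eq_comm]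
      refine integral_eq_zero_of_ae ?_
      filter_upwards [(integral_eq_zero_iff_of_nonneg (fun θ => hsh0 k θ)
        (hsh k).integrableOn).1 h] with θ hθ
      simp only [hθ, Pi.zero_apply, zero_smul]
    · rw [smul_smul, mul_inv_cancel₀ h, one_smul]
  -- On an empty level `0 / 0 = 0` is still a legitimate split, and such levels of `β` are null.
  set q : ℕ → ℝ := fun c => p 0 c / (p 0 c + p 1 c) with hq
  have hq01 : ∀ c, q c ∈ Icc (0 : ℝ) 1 := fun c =>
    ⟨div_nonneg (hp0 0 c) (add_nonneg (hp0 0 c) (hp0 1 c)),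
      div_le_one_of_le₀ (by linarith [hp0 1 c]) (add_nonneg (hp0 0 c) (hp0 1 c))⟩
  have hqm : ∀ k θ, μ.real (β ⁻¹' {β θ}) * share (fun t => q (β t)) k θ = p k (β θ) := by
    intro k θ
    rw [← hsum]
    set c := β θ
    have h0 := hp0 0 c
    have h1 := hp0 1 c
    by_cases h : p 0 c + p 1 c = 0
    · rw [h, zero_mul]
      have h0' : p 0 c = 0 := by linarith
      have h1' : p 1 c = 0 := by linarith
      fin_cases k
      · exact h0'.symm
      · exact h1'.symm
    · have : (p 0 c + p 1 c) * q c = p 0 c := mul_div_cancel₀ _ h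
      fin_cases k
      · simpa [share] using this
      · simp only [share, Fin.mk_one, one_ne_zero, if_false]
        rw [mul_sub, this]; ring
  refine ⟨fun θ => q (β θ), fun k θ => Y k (β θ), (measurable_of_countable q).comp hβ,
    fun θ => hq01 _, fun k => (StronglyMeasurable.of_discrete (f := Y k)).comp_measurable hβ,
    fun k θ => ?_, fun k => ?_, fun k => ?_⟩
  · by_cases h : p k (β θ) = 0
    · left; simp only [hY, h, inv_zero, zero_smul]
    · exact Or.inr (hYC k _ h)
  · have hpos : ∀ᵐ θ ∂μ, μ.real (β ⁻¹' {β θ}) ≠ 0 := by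
      have : ∀ᵐ θ ∂μ, ∀ c, μ.real (β ⁻¹' {c}) = 0 → β θ ≠ c := by
        rw [ae_all_iff]
        intro c
        by_cases h : μ.real (β ⁻¹' {c}) = 0
        · rw [measureReal_eq_zero_iff] at h
          filter_upwards [measure_eq_zero_iff_ae_notMem.1 h] with θ hθ _
          exact hθ
        · exact Eventually.of_forall fun θ h' => absurd h' h
      filter_upwards [this] with θ hθ h
      exact hθ _ h rfl
    filter_upwards [hpos] with θ hθ h
    refine hYC k _ ?_
    rw [← hqm k θ]
    exact mul_ne_zero hθ h
  · have hqβ : Measurable fun θ => q (β θ) := (measurable_of_countable q).comp hβ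
    rw [integral_eq_sum_fibers (hX k) (hb k) (hbB k), integral_eq_sum_fibers _ hβ hβB]
    · refine Finset.sum_congr rfl fun c _ => ?_
      rw [← hpY]
      by_cases hne : (β ⁻¹' {c}).Nonempty
      · obtain ⟨θ₀, hθ₀⟩ := hne
        have hθ₀ : β θ₀ = c := hθ₀
        rw [setIntegral_congr_fun (g := fun _ => share (fun t => q (β t)) k θ₀ • Y k c)
          (hβ (measurableSet_singleton c)), setIntegral_const, smul_smul]
        · have := hqm k θ₀
          rw [hθ₀] at this
          rw [this]
        · intro θ hθ
          have hθ : β θ = c := hθ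
          simp only [share, hθ, hθ₀]
      · rw [not_nonempty_iff_eq_empty] at hne
        have := hsum c
        rw [hne] at this ⊢
        have h3 := hp0 0 c
        have h4 := hp0 1 c
        simp only [measureReal_empty] at this
        have : p k c = 0 := by
          fin_cases k
          · show p 0 c = 0
            linarith
          · show p 1 c = 0
            linarith
        simp [this]
    · refine integrable_share_smul hqβ (fun θ => hq01 _) k ?_
      refine Integrable.of_bound (C := ∑ c ∈ Finset.range (B + 1), ‖Y k c‖)
        ((StronglyMeasurable.of_discrete (f := Y k)).comp_measurable hβ).aestronglyMeasurable ?_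
      exact Eventually.of_forall fun θ => Finset.single_le_sum
        (f := fun c => ‖Y k c‖) (fun c _ => norm_nonneg _)
        (Finset.mem_range.2 (Nat.lt_succ_of_le (hβB θ)))

theorem lt_card_filter_range_iff {P : ℕ → Prop} [DecidablePred P] (hP : ∀ i j, i ≤ j → P j → P i)
    {B j : ℕ} : j < ((Finset.range B).filter P).card ↔ j < B ∧ P j := by
  constructor
  · intro h
    by_contra hj
    have : (Finset.range B).filter P ⊆ Finset.range j := by
      intro i hi
      rw [Finset.mem_filter, Finset.mem_range] at hi
      rw [Finset.mem_range]
      by_contra hij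
      exact hj ⟨lt_of_le_of_lt (not_lt.1 hij) hi.1, hP _ _ (not_lt.1 hij) hi.2⟩
    have := Finset.card_le_card this
    rw [Finset.card_range] at this
    omega
  · rintro ⟨h1, h2⟩
    have : Finset.range (j + 1) ⊆ (Finset.range B).filter P := by
      intro i hi
      rw [Finset.mem_range] at hi
      rw [Finset.mem_filter, Finset.mem_range]
      exact ⟨by omega, hP i j (by omega) h2⟩
    have := Finset.card_le_card this
    rw [Finset.card_range] at this
    omega

theorem convex_norm_sq_le (L : E →L[ℝ] E) (t : ℝ) : Convex ℝ {x : E | ‖L x‖ ^ 2 ≤ t} := by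
  have : ConvexOn ℝ univ fun x : E => ‖L x‖ ^ 2 :=
    ((convexOn_norm convex_univ).comp_linearMap L.toLinearMap).pow (fun x _ => norm_nonneg _) 2
  simpa using this.convex_le t

theorem traded_eq [CompleteSpace E] {L : E →L[ℝ] E} {f : ℝ → ℝ} {X : Fin 2 → ℝ → E} {i : Fin 2}
    (h : Integrable (fun θ => share f i θ • X i θ) μ) :
    traded μ L f X i = L (∫ θ, share f i θ • X i θ ∂μ) := by
  rw [← L.integral_comp_comm h]
  simp only [traded, map_smul]

end rearrangement


/-! ### Sorting: cheaper schedules for the same aggregates. -/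

section sorting

variable {E : Type*} [NormedAddCommGroup E] [NormedSpace ℝ E] [CompleteSpace E] {μ : Measure ℝ}
  [IsFiniteMeasure μ] {a K R : ℝ} {L : E →L[ℝ] E} {𝒳 : Fin 2 → Set E}

omit [IsFiniteMeasure μ] in
theorem ae_mem_types (hμΘ : μ (Icc a 1)ᶜ = 0) : ∀ᵐ θ ∂μ, θ ∈ Icc a 1 :=
  mem_ae_iff.2 hμΘ

omit [CompleteSpace E] in
theorem IsClaimFamily.integrable (h𝒳 : IsClaimFamily L 𝒳 K R) {i : Fin 2} {X : ℝ → E}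
    (hX : AEStronglyMeasurable X μ) (hX𝒳 : ∀ᵐ θ ∂μ, X θ ∈ 𝒳 i) : Integrable X μ :=
  Integrable.of_bound hX R (hX𝒳.mono fun _ h => h𝒳.norm_le i _ h)

theorem sum_setIntegral_share_le {f : ℝ → ℝ} (hf : Measurable f) (hf' : ∀ θ, f θ ∈ Icc (0 : ℝ) 1)
    {A : Fin 2 → Set ℝ} {G : Set ℝ} (hA : ∀ k, MeasurableSet (A k)) (hG : MeasurableSet G)
    (h : ∀ k, ∀ᵐ θ ∂μ, share f k θ ≠ 0 → θ ∈ A k → θ ∈ G) :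
    ∑ k, ∫ θ in A k, share f k θ ∂μ ≤ μ.real G := by
  have hsh : ∀ k, Integrable (share f k) μ := fun k => integrable_share hf hf' k
  calc ∑ k, ∫ θ in A k, share f k θ ∂μ ≤ ∑ k, ∫ θ in G, share f k θ ∂μ := by
        refine Finset.sum_le_sum fun k _ => ?_
        rw [← integral_indicator (hA k), ← integral_indicator hG]
        refine integral_mono_ae ((hsh k).indicator (hA k)) ((hsh k).indicator hG) ?_
        filter_upwards [h k] with θ hθ
        have h0 := (share_mem hf' k θ).1
        by_cases h1 : θ ∈ A k
        · by_cases h2 : θ ∈ G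
          · simp [h1, h2]
          · have : share f k θ = 0 := by
              by_contra h3
              exact h2 (hθ h3 h1)
            simp [Set.indicator, this]
        · rw [indicator_of_notMem h1]
          exact indicator_nonneg (fun _ _ => (share_mem hf' k _).1) _
    _ = μ.real G := by
        rw [← integral_finsetSum _ fun k _ => (hsh k).integrableOn]
        simp only [sum_share]
        simp

/-- The quantile schedule that sorts the claims sold according to their variances. -/
theorem exists_sorting_thresholds (ha : 0 < a) (ha1 : a < 1) (hμ : μ ≪ volume)
    (hμΘ : μ (Icc a 1)ᶜ = 0) {g f : ℝ → ℝ} {ℓ : Fin 2 → ℝ → ℝ} (hf : Measurable f)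
    (hf' : ∀ θ, f θ ∈ Icc (0 : ℝ) 1) (hℓ : ∀ k, Measurable (ℓ k)) (hℓ0 : ∀ k θ, 0 ≤ ℓ k θ)
    (hg : Antitone g) (hg0 : ∀ θ ∈ Icc a 1, 0 ≤ g θ)
    (hℓg : ∀ k, ∀ᵐ θ ∂μ, share f k θ ≠ 0 → ℓ k θ ≤ g θ) {e : Fin 2 → ℝ → ℝ}
    (he : ∀ k, Integrable (fun θ => share f k θ * e k θ) μ)
    (hle : ∀ k, ∀ᵐ θ ∂μ, share f k θ ≠ 0 → ∃ ϑ ∈ Icc a 1, rent g ϑ + ϑ * ℓ k θ ≤ e k θ)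
    {δ : ℝ} (hδ : 0 < δ) {B : ℕ} (hB : 0 < B) :
    ∃ τ : ℕ → ℝ, (∀ j, τ j ∈ Icc a 1) ∧ Antitone τ ∧
      (∀ j, μ.real (Iic (τ j)) = ∑ k, ∫ θ in {θ | j * δ < ℓ k θ}, share f k θ ∂μ) ∧
      ∑ j ∈ Finset.range B, δ * τ j * μ.real (Iic (τ j)) ≤
        δ * μ.real univ + ∑ k, ∫ θ, share f k θ * e k θ ∂μ := by
  have hsh : ∀ k, Integrable (share f k) μ := fun k => integrable_share hf hf' k
  have hA : ∀ (j : ℕ) k, MeasurableSet {θ | j * δ < ℓ k θ} := fun j k =>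
    measurableSet_lt measurable_const (hℓ k)
  -- `n j` is the mass of sales whose variance exceeds `j * δ`; the threshold `τ j` will be its
  -- quantile.
  set n : ℕ → ℝ := fun j => ∑ k, ∫ θ in {θ | j * δ < ℓ k θ}, share f k θ ∂μ with hn
  have hn0 : ∀ j, 0 ≤ n j := fun j => Finset.sum_nonneg fun k _ =>
    integral_nonneg fun θ => (share_mem hf' k θ).1
  have hn1 : ∀ j, n j ≤ μ.real univ := fun j =>
    sum_setIntegral_share_le hf hf' (hA j) MeasurableSet.univ
      fun k => Eventually.of_forall fun _ _ _ => mem_univ _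
  have hng : ∀ j, n j ≤ μ.real {θ | j * δ < g θ} := fun j => by
    refine sum_setIntegral_share_le hf hf' (hA j)
      (measurableSet_lt measurable_const hg.measurable) fun k => ?_
    filter_upwards [hℓg k] with θ h h1 h2
    exact lt_of_lt_of_le h2 (h h1)
  have hnanti : Antitone n := by
    intro i j hij
    refine Finset.sum_le_sum fun k _ => setIntegral_mono_set (hsh k).integrableOn
      (Eventually.of_forall fun θ => (share_mem hf' k θ).1) (Eventually.of_forall fun θ h => ?_)
    have h : j * δ < ℓ k θ := h
    have : (i : ℝ) ≤ j := by exact_mod_cast hij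
    exact lt_of_le_of_lt (mul_le_mul_of_nonneg_right this hδ.le) h
  choose τ hτ hτn hτmin using fun j => exists_quantile ha1 hμ hμΘ (hn0 j) (hn1 j)
  -- The set `{g > j * δ}` is an initial segment of mass at least `n j`, so it contains every type
  -- below the least quantile.
  have hgτ : ∀ j, ∀ s ∈ Icc a 1, s < τ j → j * δ < g s := by
    intro j s hs hsτ
    by_contra h
    push Not at h
    refine absurd (hτmin j s hs ((hng j).trans (measureReal_mono fun θ hθ => ?_))) (not_le.2 hsτ)
    have hθ : j * δ < g θ := hθ
    by_contra h'
    exact absurd (hθ.trans_le (hg (not_le.1 h').le)) (not_lt.2 h)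
  refine ⟨τ, hτ, fun i j hij => hτmin j _ (hτ i) ((hnanti hij).trans (hτn i).ge), hτn, ?_⟩
  obtain ⟨B, rfl⟩ : ∃ B', B = B' + 1 := ⟨B - 1, by omega⟩
  -- Level `0` escapes the counting bound of `sum_le_rent_add`; it is split off and paid for by the
  -- error `δ * μ.real univ`.
  rw [Finset.sum_range_succ', add_comm]
  refine add_le_add ?_ ?_
  · calc δ * τ 0 * μ.real (Iic (τ 0)) ≤ δ * 1 * μ.real univ := by
          gcongr
          · exact (hτ 0).2
          · exact measure_ne_top _ _
          · exact subset_univ _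
      _ = _ := by ring
  · have h1 : ∀ j k, ∫ θ in {θ | j * δ < ℓ k θ}, share f k θ ∂μ =
        ∫ θ, share f k θ * (if j * δ < ℓ k θ then 1 else 0) ∂μ := by
      intro j k
      have : MeasurableSet {θ | j * δ < ℓ k θ} := measurableSet_lt measurable_const (hℓ k)
      rw [← integral_indicator this]
      congr 1
      ext θ
      simp [Set.indicator]
    have hint : ∀ (j : ℝ) k,
        Integrable (fun θ => share f k θ * (if j * δ < ℓ k θ then 1 else 0)) μ := by
      intro j k
      refine integrable_share_mul hf hf' k ?_
      refine Integrable.of_bound (C := 1) (Measurable.ite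
        (measurableSet_lt measurable_const (hℓ k)) measurable_const
        measurable_const).aestronglyMeasurable (Eventually.of_forall fun θ => ?_)
      split_ifs <;> simp
    calc ∑ j ∈ Finset.range B, δ * τ (j + 1) * μ.real (Iic (τ (j + 1)))
        = ∑ k, ∫ θ, ∑ j ∈ Finset.range B, δ * τ (j + 1) *
            (share f k θ * (if ((j + 1 : ℕ) : ℝ) * δ < ℓ k θ then 1 else 0)) ∂μ := by
          simp_rw [integral_finsetSum _ fun j _ => (hint _ _).const_mul _]
          rw [Finset.sum_comm]
          refine Finset.sum_congr rfl fun j _ => ?_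
          simp only [hτn, hn, h1, integral_const_mul, Finset.mul_sum]
      _ ≤ ∑ k, ∫ θ, share f k θ * e k θ ∂μ := by
          refine Finset.sum_le_sum fun k _ => integral_mono_ae
            (integrable_finsetSum _ fun j _ => (hint _ _).const_mul _) (he k) ?_
          filter_upwards [hle k] with θ hθ
          by_cases h0 : share f k θ = 0
          · simp [h0]
          obtain ⟨ϑ, hϑ, hle'⟩ := hθ h0
          have h2 := sum_le_rent_add (x := ℓ k θ) ha hδ hg hg0 hτ
            (S := ((Finset.range B).filter
              fun j : ℕ => ((j + 1 : ℕ) : ℝ) * δ < ℓ k θ).map ⟨Nat.succ, Nat.succ_injective⟩)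
            (by
              intro j hj
              obtain ⟨i, -, rfl⟩ := Finset.mem_map.1 hj
              exact Nat.succ_pos i) (fun j _ => hgτ j) hϑ (hℓ0 k θ) (by
              intro j hj
              obtain ⟨i, hi, rfl⟩ := Finset.mem_map.1 hj
              exact (Finset.mem_filter.1 hi).2.le)
          rw [Finset.sum_map, Finset.sum_filter] at h2
          have h3 := mul_le_mul_of_nonneg_left (h2.trans hle') (share_mem hf' k θ).1
          refine le_trans (le_of_eq ?_) h3
          rw [Finset.mul_sum]
          refine Finset.sum_congr rfl fun j _ => ?_
          simp only [Function.Embedding.coeFn_mk, Nat.succ_eq_add_one]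
          split_ifs <;> ring

/-- Variances are rounded up to multiples of `δ = K / B`, which gives the grades `b`. The new
schedule is the step function with thresholds `τ j`, so low types, which tolerate risk best, receive
the claims of large variance. The choice of the thresholds makes the grades of types and of claims
equally distributed, as `exists_rearrangement` requires. -/
theorem exists_sorted_plan_of_stronglyMeasurable (ha : 0 < a) (ha1 : a < 1) (hμ : μ ≪ volume)
    (hμΘ : μ (Icc a 1)ᶜ = 0) (hK : 0 < K) (h𝒳 : IsClaimFamily L 𝒳 K R) {g f : ℝ → ℝ}
    {X : Fin 2 → ℝ → E} (hf : Measurable f)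
    (hf' : ∀ θ, f θ ∈ Icc (0 : ℝ) 1) (hX : ∀ k, StronglyMeasurable (X k))
    (hX𝒳 : ∀ k θ, X k θ ∈ 𝒳 k) (hg : Antitone g) (hg0 : ∀ θ ∈ Icc a 1, 0 ≤ g θ)
    (hXg : ∀ k, ∀ᵐ θ ∂μ, share f k θ ≠ 0 → ‖L (X k θ)‖ ^ 2 ≤ g θ) {e : Fin 2 → ℝ → ℝ}
    (he : ∀ k, Integrable (fun θ => share f k θ * e k θ) μ)
    (hle : ∀ k, ∀ᵐ θ ∂μ, share f k θ ≠ 0 →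
      ∃ ϑ ∈ Icc a 1, rent g ϑ + ϑ * ‖L (X k θ)‖ ^ 2 ≤ e k θ) {ε : ℝ} (hε : 0 < ε) :
    ∃ (g' f' : ℝ → ℝ) (X' : Fin 2 → ℝ → E), IsPlan μ L 𝒳 K g' f' X' ∧
      (∀ k, traded μ L f' X' k = traded μ L f X k) ∧
      cost μ g' ≤ ∑ k, ∫ θ, share f k θ * e k θ ∂μ + ε := by
  -- The mesh `K / B` is so fine that the error from level `0` is at most `ε`.
  obtain ⟨B, hB0, hBε⟩ : ∃ B : ℕ, 0 < B ∧ K / B * μ.real univ ≤ ε := by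
    obtain ⟨B, hB⟩ := exists_nat_gt (K * μ.real univ / ε)
    have hB0 : (0 : ℝ) < B := lt_of_le_of_lt
      (div_nonneg (mul_nonneg hK.le measureReal_nonneg) hε.le) hB
    refine ⟨B, by exact_mod_cast hB0, ?_⟩
    rw [div_lt_iff₀ hε] at hB
    rw [div_mul_eq_mul_div, div_le_iff₀ hB0]
    linarith
  have hB0' : (0 : ℝ) < B := by exact_mod_cast hB0
  set δ := K / B with hδ_def
  have hδ : 0 < δ := div_pos hK hB0'
  have hBδ : B * δ = K := by rw [hδ_def]; field_simp
  set ℓ : Fin 2 → ℝ → ℝ := fun k θ => ‖L (X k θ)‖ ^ 2 with hℓ_def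
  have hℓ : ∀ k, Measurable (ℓ k) := fun k =>
    ((L.continuous.comp_stronglyMeasurable (hX k)).norm.measurable.pow_const 2)
  have hℓ0 : ∀ k θ, 0 ≤ ℓ k θ := fun k θ => sq_nonneg _
  obtain ⟨τ, hτ, hτanti, hτn, hτcost⟩ :=
    exists_sorting_thresholds ha ha1 hμ hμΘ hf hf' hℓ hℓ0 hg hg0 hXg he hle hδ hB0
  set b : Fin 2 → ℝ → ℕ := fun k θ => ⌈ℓ k θ / δ⌉₊ with hb_def
  have hb : ∀ k (j : ℕ) θ, j < b k θ ↔ j * δ < ℓ k θ := fun k j θ => by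
    rw [hb_def, Nat.lt_ceil, lt_div_iff₀ hδ]
  have hℓK : ∀ k θ, ℓ k θ ≤ K := fun k θ => h𝒳.var_le k _ (hX𝒳 k θ)
  have hbB : ∀ k θ, b k θ ≤ B := fun k θ => by
    rw [hb_def, Nat.ceil_le, div_le_iff₀ hδ, hBδ]
    exact hℓK k θ
  -- The number of steps that cover `θ`; the new schedule is `β θ * δ`.
  set β : ℝ → ℕ := fun θ => ((Finset.range B).filter fun j => θ ≤ τ j).card with hβ_def
  have hβ : ∀ j θ, j < β θ ↔ j < B ∧ θ ≤ τ j := fun j θ =>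
    lt_card_filter_range_iff fun i j hij h => h.trans (hτanti hij)
  have hβB : ∀ θ, β θ ≤ B := fun θ => by
    simpa using Finset.card_filter_le (Finset.range B) fun j => θ ≤ τ j
  have hβm : Measurable β := by
    have : β = fun θ => ∑ j ∈ Finset.range B, if θ ≤ τ j then 1 else 0 := by
      funext θ
      exact Finset.card_filter _ _
    rw [this]
    exact Finset.measurable_fun_sum _ fun j _ =>
      Measurable.ite measurableSet_Iic measurable_const measurable_const
  have htail : ∀ j, ∑ k, ∫ θ in {θ | j ≤ b k θ}, share f k θ ∂μ = μ.real {θ | j ≤ β θ} := by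
    intro j
    rcases j with _ | j
    · simp only [Nat.zero_le, Set.ofPred_true, Measure.restrict_univ]
      rw [← integral_finsetSum _ fun k _ => integrable_share hf hf' k]
      simp only [sum_share]
      simp
    · by_cases hj : j < B
      · have h1 : {θ | j + 1 ≤ β θ} = Iic (τ j) := by
          ext θ
          simp only [Set.mem_ofPred, Nat.succ_le_iff, hβ, hj, true_and, mem_Iic]
        rw [h1, hτn]
        simp only [Nat.succ_le_iff, hb]
      · have h1 : {θ | j + 1 ≤ β θ} = ∅ := by
          ext θ
          have := hβB θ
          simp only [Set.mem_ofPred, mem_empty_iff_false, iff_false]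
          omega
        have h2 : ∀ k, {θ | j + 1 ≤ b k θ} = ∅ := by
          intro k
          ext θ
          have := hbB k θ
          simp only [Set.mem_ofPred, mem_empty_iff_false, iff_false]
          omega
        simp only [h1, h2]
        simp
  have hXint : ∀ k, Integrable (fun θ => share f k θ • X k θ) μ := fun k =>
    integrable_share_smul hf hf' k (h𝒳.integrable (hX k).aestronglyMeasurable
      (Eventually.of_forall (hX𝒳 k)))
  obtain ⟨f', X', hf'm, hf'mem, hX'm, hX'0, hX'C, hX'int⟩ :=
    exists_rearrangement hf hf' hXint
    (b := b) (β := β) (fun k => Nat.measurable_ceil.comp ((hℓ k).div_const δ)) hβm hbB hβB htail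
    (C := fun k c => 𝒳 k ∩ {x | ‖L x‖ ^ 2 ≤ c * δ})
    (fun k c => (h𝒳.convex k).inter (convex_norm_sq_le L _))
    (fun k c => (h𝒳.closed k).inter (isClosed_le (by fun_prop) continuous_const))
    (fun k θ => ⟨hX𝒳 k θ, by
      show ℓ k θ ≤ _
      rw [← div_le_iff₀ hδ]
      exact Nat.le_ceil _⟩)
  have hX'mem : ∀ k θ, X' k θ ∈ 𝒳 k := fun k θ => (hX'0 k θ).elim
    (fun h => h ▸ h𝒳.zero_mem k) fun h => h.1
  have hg' : ∀ θ, (∑ j ∈ Finset.range B, if θ ≤ τ j then δ else 0) = β θ * δ := fun θ => by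
    rw [← Finset.sum_filter, Finset.sum_const, nsmul_eq_mul]
  refine ⟨fun s => ∑ j ∈ Finset.range B, if s ≤ τ j then δ else 0, f', X', ⟨?_, ?_, ?_, hf'm,
    hf'mem, fun k => (hX'm k).aestronglyMeasurable, fun k => Eventually.of_forall (hX'mem k),
    fun k => ?_⟩, fun k => ?_, ?_⟩
  · intro s t hst
    refine Finset.sum_le_sum fun j _ => ?_
    split_ifs with h h'
    · exact le_rfl
    · exact absurd (hst.trans h) h'
    · exact hδ.le
    · exact le_rfl
  · exact fun θ => Finset.sum_nonneg fun j _ => by split_ifs <;> [exact hδ.le; exact le_rfl]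
  · intro θ
    rw [hg', ← hBδ]
    gcongr
    exact hβB θ
  · filter_upwards [hX'C k] with θ hθ h
    rw [hg']
    exact (hθ h).2
  · rw [traded_eq (hXint k), ← hX'int k, traded_eq]
    exact integrable_share_smul hf'm hf'mem k (h𝒳.integrable (hX'm k).aestronglyMeasurable
      (Eventually.of_forall (hX'mem k)))
  · have h1 : cost μ (fun s => ∑ j ∈ Finset.range B, if s ≤ τ j then δ else 0) =
        ∑ j ∈ Finset.range B, δ * τ j * μ.real (Iic (τ j)) := by
      unfold cost
      rw [integral_congr_ae (g := fun θ => ∑ j ∈ Finset.range B,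
        (Iic (τ j)).indicator (fun _ => δ * τ j) θ), integral_finsetSum]
      · refine Finset.sum_congr rfl fun j _ => ?_
        rw [integral_indicator measurableSet_Iic, setIntegral_const, smul_eq_mul]
        ring
      · exact fun j _ => (integrable_const _).indicator measurableSet_Iic
      · filter_upwards [ae_mem_types hμΘ] with θ hθ
        rw [outlay_step hτ B hθ]
        rfl
    rw [h1]
    linarith

/-- **Sorting.** If every buyer of a plan receives at least `rent g ϑ + ϑ ‖L X‖²` for some type `ϑ`,
the same aggregate claims can be sold by a plan whose cost does not exceed what the buyers
receive. -/
theorem exists_sorted_plan (ha : 0 < a) (ha1 : a < 1) (hμ : μ ≪ volume)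
    (hμΘ : μ (Icc a 1)ᶜ = 0) (hK : 0 < K) (h𝒳 : IsClaimFamily L 𝒳 K R) {g f : ℝ → ℝ}
    {X : Fin 2 → ℝ → E} (hf : Measurable f)
    (hf' : ∀ θ, f θ ∈ Icc (0 : ℝ) 1) (hX : ∀ k, AEStronglyMeasurable (X k) μ)
    (hX𝒳 : ∀ k, ∀ᵐ θ ∂μ, X k θ ∈ 𝒳 k) (hg : Antitone g) (hg0 : ∀ θ ∈ Icc a 1, 0 ≤ g θ)
    (hXg : ∀ k, ∀ᵐ θ ∂μ, share f k θ ≠ 0 → ‖L (X k θ)‖ ^ 2 ≤ g θ) {e : Fin 2 → ℝ → ℝ}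
    (he : ∀ k, Integrable (fun θ => share f k θ * e k θ) μ)
    (hle : ∀ k, ∀ᵐ θ ∂μ, share f k θ ≠ 0 →
      ∃ ϑ ∈ Icc a 1, rent g ϑ + ϑ * ‖L (X k θ)‖ ^ 2 ≤ e k θ) {ε : ℝ} (hε : 0 < ε) :
    ∃ (g' f' : ℝ → ℝ) (X' : Fin 2 → ℝ → E), IsPlan μ L 𝒳 K g' f' X' ∧
      (∀ k, traded μ L f' X' k = traded μ L f X k) ∧
      cost μ g' ≤ ∑ k, ∫ θ, share f k θ * e k θ ∂μ + ε := by
  -- On a null set the claims are replaced by `0`, to be feasible and measurable everywhere.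
  have hex : ∀ k, ∃ Y : ℝ → E, StronglyMeasurable Y ∧ (∀ θ, Y θ ∈ 𝒳 k) ∧ Y =ᵐ[μ] X k := by
    intro k
    have hs : MeasurableSet ((hX k).mk (X k) ⁻¹' 𝒳 k) := by
      let _ : MeasurableSpace E := borel E
      have : BorelSpace E := ⟨rfl⟩
      exact (hX k).stronglyMeasurable_mk.measurable (h𝒳.closed k).measurableSet
    refine ⟨((hX k).mk (X k) ⁻¹' 𝒳 k).indicator ((hX k).mk (X k)),
      (hX k).stronglyMeasurable_mk.indicator hs, fun θ => ?_, ?_⟩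
    · by_cases h : θ ∈ (hX k).mk (X k) ⁻¹' 𝒳 k
      · rw [indicator_of_mem h]; exact h
      · rw [indicator_of_notMem h]; exact h𝒳.zero_mem k
    · filter_upwards [(hX k).ae_eq_mk, hX𝒳 k] with θ h1 h2
      have h3 : (hX k).mk (X k) θ ∈ 𝒳 k := by rwa [← h1]
      rw [indicator_of_mem (show θ ∈ (hX k).mk (X k) ⁻¹' 𝒳 k from h3), h1]
  choose Y hYm hY𝒳 hYX using hex
  obtain ⟨g', f', X', hplan, htr, hcost⟩ := exists_sorted_plan_of_stronglyMeasurable ha ha1 hμ hμΘ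
    hK h𝒳 hf hf' hYm hY𝒳 hg hg0
    (fun k => by filter_upwards [hXg k, hYX k] with θ h1 h2 h3; rw [h2]; exact h1 h3) he
    (fun k => by filter_upwards [hle k, hYX k] with θ h1 h2 h3; rw [h2]; exact h1 h3) hε
  refine ⟨g', f', X', hplan, fun k => (htr k).trans ?_, hcost⟩
  refine integral_congr_ae ?_
  filter_upwards [hYX k] with θ h
  rw [h]

end sorting


/-! ### The risk functionals -/

/-- The standing assumptions on the risk of the two firms as a function of the claims sold. -/
structure IsRiskPair {E : Type*} [NormedAddCommGroup E] [NormedSpace ℝ E]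
    (φ : Fin 2 → E → EReal) : Prop where
  ne_bot : ∀ i x, φ i x ≠ ⊥
  lsc : ∀ i, LowerSemicontinuous (φ i)
  convex : ∀ i x y (t : ℝ), 0 ≤ t → t ≤ 1 →
    φ i (t • x + (1 - t) • y) ≤ (t : EReal) * φ i x + ((1 - t : ℝ) : EReal) * φ i y

theorem exists_coe_of_add_le_coe {x y : EReal} {r : ℝ} (hx : x ≠ ⊥) (hy : y ≠ ⊥)
    (h : x + y ≤ r) : ∃ a b : ℝ, x = a ∧ y = b ∧ a + b ≤ r := by
  induction x with
  | bot => exact absurd rfl hx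
  | top =>
    rw [EReal.top_add_of_ne_bot hy] at h
    exact absurd h (not_le.2 (EReal.coe_lt_top r))
  | coe a =>
    induction y with
    | bot => exact absurd rfl hy
    | top =>
      rw [EReal.coe_add_top] at h
      exact absurd h (not_le.2 (EReal.coe_lt_top r))
    | coe b => exact ⟨a, b, rfl, rfl, by exact_mod_cast h⟩

section

variable {E : Type*} [NormedAddCommGroup E] [NormedSpace ℝ E] {φ : Fin 2 → E → EReal}

theorem IsRiskPair.convex_setOf_sum_le (hφ : IsRiskPair φ) (s : EReal) :
    Convex ℝ {y : Fin 2 → E | ∑ i, φ i (y i) ≤ s} := by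
  intro y hy z hz t u ht hu htu
  simp only [Set.mem_ofPred, Fin.sum_univ_two] at hy hz ⊢
  induction s with
  | bot =>
    rw [le_bot_iff, EReal.add_eq_bot_iff] at hy
    rcases hy with h | h <;> exact absurd h (hφ.ne_bot _ _)
  | top => exact le_top
  | coe r =>
    obtain ⟨a, b, ha, hb, hab⟩ := exists_coe_of_add_le_coe (hφ.ne_bot _ _) (hφ.ne_bot _ _) hy
    obtain ⟨c, d, hc, hd, hcd⟩ := exists_coe_of_add_le_coe (hφ.ne_bot _ _) (hφ.ne_bot _ _) hz
    obtain rfl : u = 1 - t := by linarith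
    have h0 := hφ.convex 0 (y 0) (z 0) t ht (by linarith)
    have h1 := hφ.convex 1 (y 1) (z 1) t ht (by linarith)
    rw [ha, hc] at h0
    rw [hb, hd] at h1
    refine (add_le_add h0 h1).trans ?_
    norm_cast
    nlinarith

theorem IsRiskPair.lowerSemicontinuous_sum (hφ : IsRiskPair φ) :
    LowerSemicontinuous fun y : Fin 2 → E => ∑ i, φ i (y i) := by
  simp only [Fin.sum_univ_two]
  exact ((hφ.lsc 0).comp (continuous_apply 0)).add' ((hφ.lsc 1).comp (continuous_apply 1))
    fun y => EReal.continuousAt_add (Or.inr (hφ.ne_bot _ _)) (Or.inl (hφ.ne_bot _ _))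

end

/-! ### Existence of optimal plans -/

/-- Aggregate risk of a plan. -/
def total {E : Type*} [NormedAddCommGroup E] [NormedSpace ℝ E] (μ : Measure ℝ) (L : E →L[ℝ] E)
    (φ : Fin 2 → E → EReal) (g f : ℝ → ℝ) (X : Fin 2 → ℝ → E) : EReal :=
  ∑ i, φ i (traded μ L f X i) + (cost μ g : EReal)

theorem continuous_rent {g : ℝ → ℝ} (hg : Antitone g) : Continuous (rent g) := by
  have : rent g = fun θ => -∫ s in (1 : ℝ)..θ, g s := by
    funext θ
    exact intervalIntegral.integral_symm _ _
  rw [this]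
  exact (intervalIntegral.continuous_primitive (fun _ _ => hg.intervalIntegrable) 1).neg

theorem measurable_outlay {g : ℝ → ℝ} (hg : Antitone g) : Measurable (outlay g) :=
  (continuous_rent hg).measurable.add (measurable_id.mul hg.measurable)

theorem rent_mem {a K : ℝ} (ha : 0 < a) {g : ℝ → ℝ} (hg : Antitone g) (h0 : ∀ θ, 0 ≤ g θ)
    (hK : ∀ θ, g θ ≤ K) {θ : ℝ} (hθ : θ ∈ Icc a 1) : rent g θ ∈ Icc 0 K := by
  refine ⟨intervalIntegral.integral_nonneg hθ.2 fun s _ => h0 s, ?_⟩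
  have h1 : rent g θ ≤ ∫ _ in θ..1, K :=
    intervalIntegral.integral_mono_on hθ.2 hg.intervalIntegrable (by simp) fun s _ => hK s
  have hK0 : 0 ≤ K := (h0 0).trans (hK 0)
  have h2 : 0 < θ := ha.trans_le hθ.1
  rw [intervalIntegral.integral_const, smul_eq_mul] at h1
  nlinarith

theorem outlay_mem {a K : ℝ} (ha : 0 < a) {g : ℝ → ℝ} (hg : Antitone g) (h0 : ∀ θ, 0 ≤ g θ)
    (hK : ∀ θ, g θ ≤ K) {θ : ℝ} (hθ : θ ∈ Icc a 1) : outlay g θ ∈ Icc 0 (2 * K) := by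
  have h1 := rent_mem ha hg h0 hK hθ
  have h2 : 0 < θ := ha.trans_le hθ.1
  have h3 := h0 θ
  have h4 := hK θ
  have h5 := hθ.2
  exact ⟨add_nonneg h1.1 (mul_nonneg h2.le h3), by unfold outlay; nlinarith [h1.2]⟩

theorem integrable_outlay {μ : Measure ℝ} [IsFiniteMeasure μ] {a K : ℝ} (ha : 0 < a)
    (hμΘ : μ (Icc a 1)ᶜ = 0) {g : ℝ → ℝ} (hg : Antitone g) (h0 : ∀ θ, 0 ≤ g θ)
    (hK : ∀ θ, g θ ≤ K) : Integrable (outlay g) μ := by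
  refine Integrable.of_bound (measurable_outlay hg).aestronglyMeasurable (2 * K) ?_
  filter_upwards [ae_mem_types hμΘ] with θ hθ
  have := outlay_mem ha hg h0 hK hθ
  rw [Real.norm_eq_abs, abs_of_nonneg this.1]
  exact this.2

theorem tendsto_cost {μ : Measure ℝ} [IsFiniteMeasure μ] (hμ : μ ≪ volume) {a K : ℝ} (ha : 0 < a)
    (hμΘ : μ (Icc a 1)ᶜ = 0) {g : ℕ → ℝ → ℝ} {G : ℝ → ℝ} (hg : ∀ n, Antitone (g n))
    (h0 : ∀ n θ, 0 ≤ g n θ) (hK : ∀ n θ, g n θ ≤ K)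
    (hlim : ∀ᵐ θ, Tendsto (fun n => g n θ) atTop (𝓝 (G θ))) :
    Tendsto (fun n => cost μ (g n)) atTop (𝓝 (cost μ G)) := by
  refine tendsto_integral_of_dominated_convergence (fun _ => 2 * K)
    (fun n => (measurable_outlay (hg n)).aestronglyMeasurable) (integrable_const _) (fun n => ?_) ?_
  · filter_upwards [ae_mem_types hμΘ] with θ hθ
    have := outlay_mem ha (hg n) (h0 n) (hK n) hθ
    rw [Real.norm_eq_abs, abs_of_nonneg this.1]
    exact this.2
  · filter_upwards [hμ.ae_le hlim] with θ hθ
    refine Tendsto.add ?_ (hθ.const_mul θ)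
    refine intervalIntegral.tendsto_integral_filter_of_dominated_convergence (fun _ => K)
      (Eventually.of_forall fun n => (hg n).measurable.aestronglyMeasurable)
      (Eventually.of_forall fun n => Eventually.of_forall fun s _ => ?_) (by simp)
      (hlim.mono fun s hs _ => hs)
    rw [Real.norm_eq_abs, abs_of_nonneg (h0 n s)]
    exact hK n s

/-- The integral on `L²` of a finite measure. -/
def integralL2 {α F : Type*} [MeasurableSpace α] [NormedAddCommGroup F] [NormedSpace ℝ F]
    (μ : Measure α) [IsFiniteMeasure μ] : Lp F 2 μ →L[ℝ] F :=
  LinearMap.mkContinuous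
    { toFun := fun u => ∫ x, u x ∂μ
      map_add' := fun u v => by
        rw [← integral_add ((Lp.memLp u).integrable one_le_two)
          ((Lp.memLp v).integrable one_le_two)]
        exact integral_congr_ae (Lp.coeFn_add u v)
      map_smul' := fun c u => by
        rw [RingHom.id_apply, ← integral_smul]
        exact integral_congr_ae (Lp.coeFn_smul c u) }
    ((μ univ ^ ((1 : ENNReal).toReal⁻¹ - (2 : ENNReal).toReal⁻¹)).toReal) fun u => by
      have h1 : Integrable u μ := (Lp.memLp u).integrable one_le_two
      have h2 : ‖∫ x, u x ∂μ‖ ≤ (eLpNorm u 1 μ).toReal := by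
        refine (norm_integral_le_integral_norm _).trans (le_of_eq ?_)
        rw [eLpNorm_one_eq_lintegral_enorm, integral_norm_eq_lintegral_enorm h1.1]
      refine h2.trans ?_
      have h3 := eLpNorm_le_eLpNorm_mul_rpow_measure_univ (μ := μ) (p := 1) (q := 2) one_le_two h1.1
      rw [Lp.norm_def, mul_comm, ← ENNReal.toReal_mul]
      refine ENNReal.toReal_mono (ENNReal.mul_ne_top (Lp.eLpNorm_ne_top u)
        (ENNReal.rpow_ne_top_of_nonneg (by norm_num) (measure_ne_top _ _))) ?_
      simpa using h3

theorem integralL2_apply {α F : Type*} [MeasurableSpace α] [NormedAddCommGroup F]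
    [NormedSpace ℝ F] {μ : Measure α} [IsFiniteMeasure μ] (u : Lp F 2 μ) : integralL2 μ u = ∫ x, u x ∂μ := rfl

/-! ### Perspective sets of pairs of a weight and a weighted point. -/

section perspective

variable {E : Type*} [NormedAddCommGroup E] [NormedSpace ℝ E] {D : Set E}

/-- Combining `r • x` and `r' • x'` amounts to averaging `x` and `x'` with weights proportional to
`s * r` and `t * r'`. Passing to weighted claims thus makes the constraint convex although splits
multiply claims. -/
theorem convex_perspective (hD : Convex ℝ D) :
    Convex ℝ {z : ℝ × E | 0 ≤ z.1 ∧ ∃ x ∈ D, z.2 = z.1 • x} := by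
  rintro ⟨r, y⟩ ⟨hr, x, hx, hy⟩ ⟨r', y'⟩ ⟨hr', x', hx', hy'⟩ s t hs ht hst
  simp only at hr hy hr' hy'
  refine ⟨add_nonneg (mul_nonneg hs hr) (mul_nonneg ht hr'), ?_⟩
  simp only [Prod.smul_mk, Prod.mk_add_mk, smul_eq_mul]
  rcases (add_nonneg (mul_nonneg hs hr) (mul_nonneg ht hr')).eq_or_lt with h | h
  · have h1 : s * r = 0 := by nlinarith [mul_nonneg hs hr, mul_nonneg ht hr']
    have h2 : t * r' = 0 := by nlinarith [mul_nonneg hs hr, mul_nonneg ht hr']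
    exact ⟨x, hx, by rw [hy, hy', smul_smul, smul_smul, h1, h2]; simp⟩
  · refine ⟨(s * r / (s * r + t * r')) • x + (t * r' / (s * r + t * r')) • x', hD hx hx'
      (div_nonneg (mul_nonneg hs hr) h.le) (div_nonneg (mul_nonneg ht hr') h.le)
      (by rw [← add_div, div_self h.ne']), ?_⟩
    rw [hy, hy', smul_add, smul_smul, smul_smul, smul_smul, smul_smul, mul_div_cancel₀ _ h.ne',
      mul_div_cancel₀ _ h.ne']

theorem isClosed_perspective (hD : IsClosed D) {R : ℝ} (hR : ∀ x ∈ D, ‖x‖ ≤ R) :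
    IsClosed {z : ℝ × E | 0 ≤ z.1 ∧ ∃ x ∈ D, z.2 = z.1 • x} := by
  refine IsSeqClosed.isClosed fun z w hz hzw => ?_
  choose h0 x hx hzx using hz
  have h1 : Tendsto (fun n => (z n).1) atTop (𝓝 w.1) := (continuous_fst.tendsto w).comp hzw
  have h2 : Tendsto (fun n => (z n).2) atTop (𝓝 w.2) := (continuous_snd.tendsto w).comp hzw
  have hw0 : 0 ≤ w.1 := ge_of_tendsto' h1 h0
  refine ⟨hw0, ?_⟩
  -- At weight `0` the boundedness of `D` forces the limit to vanish; at positive weight one can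
  -- divide.
  rcases hw0.eq_or_lt with h | h
  · refine ⟨x 0, hx 0, ?_⟩
    rw [← h, zero_smul]
    refine tendsto_nhds_unique h2 ?_
    refine squeeze_zero_norm (a := fun n => (z n).1 * R) (fun n => ?_) ?_
    · rw [hzx, norm_smul, Real.norm_eq_abs, abs_of_nonneg (h0 n)]
      exact mul_le_mul_of_nonneg_left (hR _ (hx n)) (h0 n)
    · simpa [← h] using h1.mul_const R
  · refine ⟨w.1⁻¹ • w.2, hD.mem_of_tendsto ((h1.inv₀ h.ne').smul h2) ?_, ?_⟩
    · filter_upwards [h1.eventually (lt_mem_nhds h)] with n hn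
      rw [hzx, smul_smul, inv_mul_cancel₀ hn.ne', one_smul]
      exact hx n
    · rw [smul_smul, mul_inv_cancel₀ h.ne', one_smul]

end perspective


section existence

variable {E : Type*} [NormedAddCommGroup E] {μ : Measure ℝ} [IsFiniteMeasure μ]
  {a K R : ℝ} {𝒳 : Fin 2 → Set E} {φ : Fin 2 → E → EReal}

omit [IsFiniteMeasure μ] in
theorem aestronglyMeasurable_pi_of_fintype {ι : Type*} [Fintype ι] {u : ℝ → ι → E}
    (hu : ∀ i, AEStronglyMeasurable (fun θ => u θ i) μ) : AEStronglyMeasurable u μ := by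
  classical
  have : u = fun θ => ∑ i, Pi.single i (u θ i) := by
    funext θ
    exact (Finset.univ_sum_single (u θ)).symm
  rw [this]
  exact Finset.aestronglyMeasurable_fun_sum _ fun i _ =>
    (continuous_single i).comp_aestronglyMeasurable (hu i)

theorem continuous_share_const (i : Fin 2) : Continuous fun w : ℝ => share (fun _ => w) i 0 := by
  unfold share
  split_ifs <;> fun_prop

/-- Splits `w` and weighted claims `w_i • X_i` with feasible `X_i` of variance at most `h`. -/
def weightedClaims [NormedSpace ℝ E] (L : E →L[ℝ] E) (𝒳 : Fin 2 → Set E) (h : ℝ) :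
    Set (ℝ × (Fin 2 → E)) :=
  {z | ∀ i, (share (fun _ => z.1) i 0, z.2 i) ∈
    {p : ℝ × E | 0 ≤ p.1 ∧ ∃ x ∈ 𝒳 i ∩ {x | ‖L x‖ ^ 2 ≤ h}, p.2 = p.1 • x}}

theorem isClosed_weightedClaims [NormedSpace ℝ E] {L : E →L[ℝ] E} (h𝒳 : IsClaimFamily L 𝒳 K R)
    (h : ℝ) : IsClosed (weightedClaims L 𝒳 h) := by
  simp only [weightedClaims, Set.ofPred_forall]
  refine isClosed_iInter fun i => IsClosed.preimage
    (((continuous_share_const i).comp continuous_fst).prodMk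
      ((continuous_apply i).comp continuous_snd)) (isClosed_perspective
        ((h𝒳.closed i).inter (isClosed_le (by fun_prop) continuous_const))
        fun x hx => h𝒳.norm_le i x hx.1)

theorem convex_weightedClaims [NormedSpace ℝ E] {L : E →L[ℝ] E} (h𝒳 : IsClaimFamily L 𝒳 K R)
    (h : ℝ) : Convex ℝ (weightedClaims L 𝒳 h) := by
  intro y hy z hz s t hs ht hst i
  have := convex_perspective ((h𝒳.convex i).inter (convex_norm_sq_le L h)) (hy i) (hz i) hs ht hst
  convert this using 1
  simp only [Prod.smul_mk, Prod.mk_add_mk, Prod.mk.injEq]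
  refine ⟨?_, rfl⟩
  unfold share
  simp only [Prod.fst_add, Prod.smul_fst, smul_eq_mul]
  split_ifs
  · rfl
  · linear_combination -hst

theorem weightedClaims_mono [NormedSpace ℝ E] {L : E →L[ℝ] E} {h h' : ℝ} (hh : h ≤ h') :
    weightedClaims L 𝒳 h ⊆ weightedClaims L 𝒳 h' := fun _ hz i =>
  ⟨(hz i).1, (hz i).2.imp fun _ hx => ⟨⟨hx.1.1, hx.1.2.trans hh⟩, hx.2⟩⟩

theorem fst_mem_of_mem_weightedClaims [NormedSpace ℝ E] {L : E →L[ℝ] E} {h : ℝ}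
    {z : ℝ × (Fin 2 → E)} (hz : z ∈ weightedClaims L 𝒳 h) : z.1 ∈ Icc (0 : ℝ) 1 := by
  have h0 := (hz 0).1
  have h1 := (hz 1).1
  simp [share] at h0 h1
  exact ⟨h0, h1⟩

theorem norm_le_of_mem_weightedClaims [NormedSpace ℝ E] {L : E →L[ℝ] E}
    (h𝒳 : IsClaimFamily L 𝒳 K R) {h : ℝ}
    {z : ℝ × (Fin 2 → E)} (hz : z ∈ weightedClaims L 𝒳 h) : ‖z‖ ≤ max 1 R := by
  have h1 := fst_mem_of_mem_weightedClaims hz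
  have hR : 0 ≤ R := by simpa using h𝒳.norm_le 0 0 (h𝒳.zero_mem 0)
  refine norm_prod_le_iff.2 ⟨?_, ?_⟩
  · rw [Real.norm_eq_abs, abs_of_nonneg h1.1]
    exact h1.2.trans (le_max_left _ _)
  · refine (pi_norm_le_iff_of_nonneg (hR.trans (le_max_right _ _))).2 fun i => ?_
    obtain ⟨h2, x, hx, h3⟩ := hz i
    simp only at h2 h3
    have h4 := (share_mem (f := fun _ => z.1) (fun _ => h1) i 0).2
    rw [h3, norm_smul, Real.norm_eq_abs, abs_of_nonneg h2]
    calc _ ≤ 1 * R := mul_le_mul h4 (h𝒳.norm_le i x hx.1) (norm_nonneg _) zero_le_one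
      _ ≤ _ := by rw [one_mul]; exact le_max_right _ _

/-- The limit of a minimizing sequence: plans whose schedules converge yield a plan for the limiting
schedule whose risk does not exceed the upper limit of the risks. -/
theorem exists_limit_plan [InnerProductSpace ℝ E] [CompleteSpace E] {L : E →L[ℝ] E}
    (hμ : μ ≪ volume) (h𝒳 : IsClaimFamily L 𝒳 K R) (hφ : IsRiskPair φ) {g f : ℕ → ℝ → ℝ}
    {X : ℕ → Fin 2 → ℝ → E} (hplan : ∀ n, IsPlan μ L 𝒳 K (g n) (f n) (X n)) {G : ℝ → ℝ}
    (hG : Antitone G) (hG0 : ∀ θ, 0 ≤ G θ) (hGK : ∀ θ, G θ ≤ K)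
    (hlim : ∀ᵐ θ, Tendsto (fun n => g n θ) atTop (𝓝 (G θ))) :
    ∃ (F : ℝ → ℝ) (Y : Fin 2 → ℝ → E), IsPlan μ L 𝒳 K G F Y ∧
      ∑ i, φ i (traded μ L F Y i) ≤
        limsup (fun n => ∑ i, φ i (traded μ L (f n) (X n) i)) atTop := by
  -- The Euclidean product norm makes the values, and with them their `L²` space, a Hilbert space,
  -- as the nested intersection requires.
  let e : WithLp 2 (ℝ × PiLp 2 (fun _ : Fin 2 => E)) ≃L[ℝ] ℝ × (Fin 2 → E) :=
    (WithLp.prodContinuousLinearEquiv 2 ℝ ℝ (PiLp 2 (fun _ : Fin 2 => E))).trans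
      ((ContinuousLinearEquiv.refl ℝ ℝ).prodCongr
        (PiLp.continuousLinearEquiv 2 ℝ (fun _ : Fin 2 => E)))
  let e' := (e.symm : (ℝ × (Fin 2 → E)) →L[ℝ] WithLp 2 (ℝ × PiLp 2 (fun _ : Fin 2 => E)))
  have hR : 0 ≤ R := by simpa using h𝒳.norm_le 0 0 (h𝒳.zero_mem 0)
  -- The limiting variance bound is approached through tail suprema: they decrease in `N`, tend to
  -- `G` almost everywhere, and each of them gives a closed convex constraint satisfied by plan `N`.
  set h : ℕ → ℝ → ℝ := fun N θ => ⨆ k, g (N + k) θ with hh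
  have hbdd : ∀ N θ, BddAbove (range fun k => g (N + k) θ) := fun N θ =>
    ⟨K, by rintro _ ⟨k, rfl⟩; exact (hplan _).le θ⟩
  have hanti : ∀ θ, Antitone fun N => h N θ := by
    intro θ N M hNM
    refine ciSup_le fun k => ?_
    have := le_ciSup (hbdd N θ) (M - N + k)
    rwa [← add_assoc, Nat.add_sub_cancel' hNM] at this
  set Γ : ℕ → ℝ → Set (WithLp 2 (ℝ × PiLp 2 (fun _ : Fin 2 => E))) := fun N θ =>
    e ⁻¹' weightedClaims L 𝒳 (h N θ) with hΓ
  set T : Lp (WithLp 2 (ℝ × PiLp 2 (fun _ : Fin 2 => E))) 2 μ → Fin 2 → E := fun u i =>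
    L ((e (integralL2 μ u)).2 i) with hT
  set s : ℕ → EReal := fun N => ⨆ k, ∑ i, φ i (traded μ L (f (N + k)) (X (N + k)) i) with hs
  have hsanti : Antitone s := by
    intro N M hNM
    refine iSup_le fun k => ?_
    refine le_iSup_of_le (M - N + k) ?_
    rw [← add_assoc, Nat.add_sub_cancel' hNM]
  set S : ℕ → Set (Lp (WithLp 2 (ℝ × PiLp 2 (fun _ : Fin 2 => E))) 2 μ) := fun N =>
    {u | ∀ᵐ θ ∂μ, u θ ∈ Γ N θ} ∩ T ⁻¹' {y | ∑ i, φ i (y i) ≤ s N} with hS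
  have hTc : Continuous T := continuous_pi fun i =>
    L.continuous.comp ((continuous_apply i).comp (continuous_snd.comp
      (e.continuous.comp (integralL2 μ).continuous)))
  have hbound : ∀ N θ x, x ∈ Γ N θ → ‖x‖ ≤ ‖e'‖ * max 1 R := by
    intro N θ x hx
    have h1 : x = e' (e x) := (e.symm_apply_apply x).symm
    rw [h1]
    exact (ContinuousLinearMap.le_opNorm _ _).trans
      (mul_le_mul_of_nonneg_left (norm_le_of_mem_weightedClaims h𝒳 hx) (norm_nonneg _))
  have hC0 : 0 ≤ ‖e'‖ * max 1 R :=
    mul_nonneg e'.opNorm_nonneg (hR.trans (le_max_right _ _))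
  obtain ⟨u, hu⟩ : ∃ u, ∀ N, u ∈ S N := by
    refine nonempty_iInter_of_antitone_convex S ?_ (fun N => ?_) (fun N => ?_) (fun N => ?_) ?_
    · intro N M hNM u hu
      exact ⟨Eventually.mono (show ∀ᵐ θ ∂μ, u θ ∈ Γ M θ from hu.1) fun θ h => weightedClaims_mono (hanti θ hNM) h, le_trans hu.2 (hsanti hNM)⟩
    · exact (isClosed_Lp_ae_mem fun θ => (isClosed_weightedClaims h𝒳 _).preimage e.continuous).inter
        ((hφ.lowerSemicontinuous_sum.isClosed_preimage (s N)).preimage hTc)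
    · refine (convex_Lp_ae_mem fun θ => (convex_weightedClaims h𝒳 _).linear_preimage
        e.toLinearMap).inter ?_
      have h1 : IsLinearMap ℝ T := by
        constructor
        · intro u v; funext i; simp [hT]
        · intro c u; funext i; simp [hT]
      exact (hφ.convex_setOf_sum_le (s N)).is_linear_preimage h1
    · have hp := hplan N
      have hΓN : ∀ᵐ θ ∂μ, e.symm (f N θ, fun i => share (f N) i θ • X N i θ) ∈ Γ N θ := by
        filter_upwards [ae_all_iff.2 hp.mem, ae_all_iff.2 hp.var_le] with θ h1 h2
        simp only [hΓ, mem_preimage, ContinuousLinearEquiv.apply_symm_apply]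
        have hgh : g N θ ≤ h N θ := le_ciSup (hbdd N θ) 0
        intro i
        refine ⟨(share_mem hp.f_mem i θ).1, ?_⟩
        by_cases h3 : share (f N) i θ = 0
        · refine ⟨0, ⟨h𝒳.zero_mem i, ?_⟩, by simp [h3]⟩
          simpa using (hp.nonneg θ).trans hgh
        · exact ⟨X N i θ, ⟨h1 i, (h2 i h3).trans hgh⟩, rfl⟩
      have hmeas : AEStronglyMeasurable
          (fun θ => (f N θ, fun i => share (f N) i θ • X N i θ)) μ :=
        hp.f_meas.aestronglyMeasurable.prodMk (aestronglyMeasurable_pi_of_fintype fun i =>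
          (measurable_share hp.f_meas i).aestronglyMeasurable.smul (hp.meas i))
      have hmem : MemLp (fun θ => e.symm (f N θ, fun i => share (f N) i θ • X N i θ)) 2 μ :=
        MemLp.of_bound (e.symm.continuous.comp_aestronglyMeasurable hmeas) _
          (hΓN.mono fun θ h => hbound N θ _ h)
      refine ⟨hmem.toLp, ?_, ?_⟩
      · filter_upwards [hmem.coeFn_toLp, hΓN] with θ h1 h2
        rwa [h1]
      · have hT' : T hmem.toLp = fun i => traded μ L (f N) (X N) i := by
          funext i
          have hi := hmem.integrable one_le_two
          have h1 : ∀ i, Integrable (fun θ => share (f N) i θ • X N i θ) μ := fun i =>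
            integrable_share_smul hp.f_meas hp.f_mem i (h𝒳.integrable (hp.meas i) (hp.mem i))
          rw [traded_eq (h1 i)]
          simp only [hT, integralL2_apply]
          congr 1
          rw [integral_congr_ae hmem.coeFn_toLp]
          have h2 := ((ContinuousLinearMap.proj (R := ℝ) (φ := fun _ : Fin 2 => E) i).comp
            ((ContinuousLinearMap.snd ℝ ℝ (Fin 2 → E)).comp
              (e : WithLp 2 (ℝ × PiLp 2 (fun _ : Fin 2 => E)) →L[ℝ] ℝ × (Fin 2 → E)))).integral_comp_comm hi
          simp only [ContinuousLinearMap.comp_apply, ContinuousLinearMap.proj_apply,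
            ContinuousLinearMap.coe_snd', ContinuousLinearEquiv.coe_coe,
            ContinuousLinearEquiv.apply_symm_apply] at h2
          exact h2.symm
        show ∑ i, φ i (T hmem.toLp i) ≤ s N
        rw [hT']
        exact le_iSup (fun k => ∑ i, φ i (traded μ L (f (N + k)) (X (N + k)) i)) 0
    · refine (Metric.isBounded_iff_subset_closedBall 0).2
        ⟨measureUnivNNReal μ ^ (2 : ENNReal).toReal⁻¹ * (‖e'‖ * max 1 R), fun u hu => ?_⟩
      rw [mem_closedBall_zero_iff]
      exact Lp.norm_le_of_ae_bound hC0 (Eventually.mono (show ∀ᵐ θ ∂μ, u θ ∈ Γ 0 θ from hu.1)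
        fun θ h => hbound 0 θ _ h)
  have humeas : StronglyMeasurable fun θ => e (u θ) :=
    e.continuous.comp_stronglyMeasurable (Lp.stronglyMeasurable u)
  -- Clamping changes the split on a null set only. In `Y`, a zero share yields the claim `0`, which
  -- is feasible and not sold.
  set F : ℝ → ℝ := fun θ => max 0 (min 1 (e (u θ)).1) with hF
  set Y : Fin 2 → ℝ → E := fun i θ => (share F i θ)⁻¹ • (e (u θ)).2 i with hY
  have hFm : Measurable F :=
    measurable_const.max (measurable_const.min (continuous_fst.comp_stronglyMeasurable
      humeas).measurable)
  have hF01 : ∀ θ, F θ ∈ Icc (0 : ℝ) 1 := fun θ =>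
    ⟨le_max_left _ _, max_le zero_le_one (min_le_left _ _)⟩
  have hmem : ∀ᵐ θ ∂μ, ∀ N, e (u θ) ∈ weightedClaims L 𝒳 (h N θ) :=
    ae_all_iff.2 fun N => (hu N).1
  have hFeq : ∀ᵐ θ ∂μ, F θ = (e (u θ)).1 := by
    filter_upwards [hmem] with θ h1
    have := fst_mem_of_mem_weightedClaims (h1 0)
    rw [hF]
    simp only [min_eq_right this.2, max_eq_right this.1]
  have hkey : ∀ᵐ θ ∂μ, ∀ N i, ∃ x ∈ 𝒳 i ∩ {x | ‖L x‖ ^ 2 ≤ h N θ},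
      (e (u θ)).2 i = share F i θ • x := by
    filter_upwards [hmem, hFeq] with θ h1 h2 N i
    obtain ⟨-, x, hx, hxe⟩ := h1 N i
    refine ⟨x, hx, hxe.trans ?_⟩
    simp only [share, h2]
  have hYx : ∀ {i θ x}, share F i θ ≠ 0 → (e (u θ)).2 i = share F i θ • x → Y i θ = x := by
    intro i θ x h1 h2
    rw [hY]
    simp only [h2, smul_smul, inv_mul_cancel₀ h1, one_smul]
  refine ⟨F, Y, ⟨hG, hG0, hGK, hFm, hF01, fun i => ?_, fun i => ?_, fun i => ?_⟩, ?_⟩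
  · exact ((measurable_share hFm i).inv.aestronglyMeasurable).smul
      (((continuous_apply i).comp continuous_snd).comp_stronglyMeasurable
        humeas).aestronglyMeasurable
  · filter_upwards [hkey] with θ h1
    by_cases h2 : share F i θ = 0
    · rw [hY]
      simp only [h2, inv_zero, zero_smul]
      exact h𝒳.zero_mem i
    · obtain ⟨x, hx, hxe⟩ := h1 0 i
      rw [hYx h2 hxe]
      exact hx.1
  · filter_upwards [hkey, hμ.ae_le hlim] with θ h1 h2 h3
    refine le_of_forall_pos_le_add fun ε hε => ?_
    obtain ⟨N, hN⟩ := (h2.eventually (gt_mem_nhds (lt_add_of_pos_right (G θ) hε))).exists_forall_of_atTop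
    obtain ⟨x, hx, hxe⟩ := h1 N i
    rw [hYx h3 hxe]
    exact hx.2.trans (ciSup_le fun k => (hN _ (Nat.le_add_right _ _)).le)
  · have hT' : (fun i => traded μ L F Y i) = T u := by
      funext i
      have h3 := (L.comp ((ContinuousLinearMap.proj (R := ℝ) (φ := fun _ : Fin 2 => E) i).comp
        ((ContinuousLinearMap.snd ℝ ℝ (Fin 2 → E)).comp
          (e : WithLp 2 (ℝ × PiLp 2 (fun _ : Fin 2 => E)) →L[ℝ] ℝ × (Fin 2 → E))))).integral_comp_comm ((Lp.memLp u).integrable one_le_two)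
      simp only [hT, integralL2_apply]
      refine Eq.trans (integral_congr_ae ?_) h3
      filter_upwards [hkey] with θ h1
      obtain ⟨x, hx, hxe⟩ := h1 0 i
      simp only [ContinuousLinearMap.comp_apply, ContinuousLinearMap.proj_apply,
            ContinuousLinearMap.coe_snd', ContinuousLinearEquiv.coe_coe, hxe, map_smul]
      by_cases h4 : share F i θ = 0
      · simp [h4]
      · rw [hYx h4 hxe]
    have h5 : ∀ N, ∑ i, φ i (traded μ L F Y i) ≤ s N := fun N => by
      have := (hu N).2
      rw [mem_preimage, ← hT'] at this
      exact this
    rw [limsup_eq_iInf_iSup_of_nat']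
    refine le_iInf fun N => (h5 N).trans (le_of_eq ?_)
    simp only [hs, add_comm N]

omit [IsFiniteMeasure μ] in
theorem isPlan_zero [NormedSpace ℝ E] {L : E →L[ℝ] E} (hK : 0 < K) (h𝒳 : IsClaimFamily L 𝒳 K R) :
    IsPlan μ L 𝒳 K 0 0 0 where
  anti := fun _ _ _ => le_rfl
  nonneg := fun _ => le_rfl
  le := fun _ => hK.le
  f_meas := measurable_const
  f_mem := fun _ => ⟨le_rfl, zero_le_one⟩
  meas := fun _ => aestronglyMeasurable_zero
  mem := fun i => Eventually.of_forall fun _ => h𝒳.zero_mem i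
  var_le := fun i => Eventually.of_forall fun _ _ => by simp

theorem exists_optimal_plan [InnerProductSpace ℝ E] [CompleteSpace E] {L : E →L[ℝ] E}
    (ha : 0 < a) (hμ : μ ≪ volume) (hμΘ : μ (Icc a 1)ᶜ = 0) (hK : 0 < K)
    (h𝒳 : IsClaimFamily L 𝒳 K R) (hφ : IsRiskPair φ) :
    ∃ (g f : ℝ → ℝ) (X : Fin 2 → ℝ → E), IsPlan μ L 𝒳 K g f X ∧
      ∀ g' f' X', IsPlan μ L 𝒳 K g' f' X' → total μ L φ g f X ≤ total μ L φ g' f' X' := by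
  set V : Set EReal := {t | ∃ g f X, IsPlan μ L 𝒳 K g f X ∧ total μ L φ g f X = t}
  obtain ⟨t, -, htlim, ht⟩ := exists_seq_tendsto_sInf (S := V)
    ⟨_, _, _, _, isPlan_zero hK h𝒳, rfl⟩ (OrderBot.bddBelow V)
  choose g f X hplan hval using ht
  obtain ⟨ψ, G, hψ, hG, hG0, hGK, hlim⟩ := exists_subseq_tendsto_ae_of_antitone g
    (fun n => (hplan n).anti) (fun n => (hplan n).nonneg) (fun n => (hplan n).le)
  obtain ⟨F, Y, hFY, hle⟩ := exists_limit_plan hμ h𝒳 hφ (fun n => hplan (ψ n)) hG hG0 hGK hlim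
  have hc := tendsto_cost hμ ha hμΘ (fun n => (hplan (ψ n)).anti) (fun n => (hplan (ψ n)).nonneg)
    (fun n => (hplan (ψ n)).le) hlim
  have hc' : Tendsto (fun n => ((-cost μ (g (ψ n)) : ℝ) : EReal)) atTop
      (𝓝 ((-cost μ G : ℝ) : EReal)) := EReal.tendsto_coe.2 hc.neg
  -- The costs are real and converge, so they can be subtracted from the possibly infinite totals;
  -- what remains is the limit of the risks.
  have hsum : Tendsto (fun n => t (ψ n) + ((-cost μ (g (ψ n)) : ℝ) : EReal)) atTop
      (𝓝 (sInf V + ((-cost μ G : ℝ) : EReal))) :=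
    (EReal.continuousAt_add (p := (sInf V, ((-cost μ G : ℝ) : EReal)))
      (Or.inr (EReal.coe_ne_bot _)) (Or.inr (EReal.coe_ne_top _))).tendsto.comp
      ((htlim.comp hψ.tendsto_atTop).prodMk_nhds hc')
  have hcancel : ∀ (x : EReal) (r : ℝ), x + (r : EReal) + ((-r : ℝ) : EReal) = x := fun x r => by
    rw [add_assoc, ← EReal.coe_add, add_neg_cancel, EReal.coe_zero, add_zero]
  have hΦ : ∀ n, t (ψ n) + ((-cost μ (g (ψ n)) : ℝ) : EReal) =
      ∑ i, φ i (traded μ L (f (ψ n)) (X (ψ n)) i) := fun n => by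
    rw [← hval, total, hcancel]
  simp only [hΦ] at hsum
  rw [hsum.limsup_eq] at hle
  refine ⟨G, F, Y, hFY, fun g' f' X' h' => ?_⟩
  refine le_trans ?_ (sInf_le (show total μ L φ g' f' X' ∈ V from ⟨_, _, _, h', rfl⟩))
  refine (add_le_add_left hle (cost μ G : EReal)).trans (le_of_eq ?_)
  have := hcancel (sInf V) (-cost μ G)
  rwa [neg_neg] at this

end existence


/-! ### Properties of optimal plans -/

/-- The standing assumptions on types, feasible claims and risk. -/
structure IsMarket {E : Type*} [NormedAddCommGroup E] [NormedSpace ℝ E] (a K R : ℝ)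
    (μ : Measure ℝ) (L : E →L[ℝ] E) (𝒳 : Fin 2 → Set E) (φ : Fin 2 → E → EReal) : Prop where
  pos : 0 < a
  lt_one : a < 1
  ac : μ ≪ volume
  null : μ (Icc a 1)ᶜ = 0
  K_pos : 0 < K
  claims : IsClaimFamily L 𝒳 K R
  risk : IsRiskPair φ

/-- A plan of least aggregate risk. -/
structure IsOptimalPlan {E : Type*} [NormedAddCommGroup E] [NormedSpace ℝ E] (μ : Measure ℝ)
    (L : E →L[ℝ] E) (𝒳 : Fin 2 → Set E) (φ : Fin 2 → E → EReal) (K : ℝ) (g f : ℝ → ℝ)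
    (X : Fin 2 → ℝ → E) : Prop extends IsPlan μ L 𝒳 K g f X where
  total_le : ∀ g' f' X', IsPlan μ L 𝒳 K g' f' X' → total μ L φ g f X ≤ total μ L φ g' f' X'

section optimal

variable {E : Type*} [NormedAddCommGroup E] {μ : Measure ℝ} [IsFiniteMeasure μ]
  {a K R : ℝ} {𝒳 : Fin 2 → Set E} {φ : Fin 2 → E → EReal} {g f : ℝ → ℝ} {X : Fin 2 → ℝ → E}

omit [IsFiniteMeasure μ] in
theorem exists_coe_of_total_ne_top [NormedSpace ℝ E] {L : E →L[ℝ] E} (hφ : IsRiskPair φ)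
    (hfin : total μ L φ g f X ≠ ⊤) : ∃ r : Fin 2 → ℝ, ∀ i, φ i (traded μ L f X i) = r i := by
  have h : ∀ i, φ i (traded μ L f X i) ≠ ⊤ := by
    intro i h
    refine hfin ?_
    rw [total, Fin.sum_univ_two]
    fin_cases i
    · simp only [Fin.zero_eta] at h
      rw [h, EReal.top_add_of_ne_bot (hφ.ne_bot _ _), EReal.top_add_coe]
    · simp only [Fin.mk_one] at h
      rw [h, EReal.add_top_of_ne_bot (hφ.ne_bot _ _), EReal.top_add_coe]
  exact ⟨fun i => (φ i (traded μ L f X i)).toReal, fun i =>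
    (EReal.coe_toReal (h i) (hφ.ne_bot _ _)).symm⟩

theorem IsOptimalPlan.total_le_of_sorted [NormedSpace ℝ E] [CompleteSpace E] {L : E →L[ℝ] E}
    (h : IsMarket a K R μ L 𝒳 φ) (hopt : IsOptimalPlan μ L 𝒳 φ K g f X)
    {g₀ f₀ : ℝ → ℝ} {X₀ : Fin 2 → ℝ → E} (hf : Measurable f₀)
    (hf' : ∀ θ, f₀ θ ∈ Icc (0 : ℝ) 1) (hX : ∀ k, AEStronglyMeasurable (X₀ k) μ)
    (hX𝒳 : ∀ k, ∀ᵐ θ ∂μ, X₀ k θ ∈ 𝒳 k) (hg : Antitone g₀) (hg0 : ∀ θ ∈ Icc a 1, 0 ≤ g₀ θ)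
    (hXg : ∀ k, ∀ᵐ θ ∂μ, share f₀ k θ ≠ 0 → ‖L (X₀ k θ)‖ ^ 2 ≤ g₀ θ) {e : Fin 2 → ℝ → ℝ}
    (he : ∀ k, Integrable (fun θ => share f₀ k θ * e k θ) μ)
    (hle : ∀ k, ∀ᵐ θ ∂μ, share f₀ k θ ≠ 0 →
      ∃ ϑ ∈ Icc a 1, rent g₀ ϑ + ϑ * ‖L (X₀ k θ)‖ ^ 2 ≤ e k θ) :
    total μ L φ g f X ≤ ∑ i, φ i (traded μ L f₀ X₀ i) +
      ((∑ k, ∫ θ, share f₀ k θ * e k θ ∂μ : ℝ) : EReal) := by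
  set c := ∑ k, ∫ θ, share f₀ k θ * e k θ ∂μ
  have key : ∀ ε : ℝ, 0 < ε → total μ L φ g f X ≤ ∑ i, φ i (traded μ L f₀ X₀ i) +
      ((c + ε : ℝ) : EReal) := by
    intro ε hε
    obtain ⟨g', f', X', hplan, htr, hcost⟩ := exists_sorted_plan h.pos h.lt_one h.ac h.null h.K_pos
      h.claims hf hf' hX hX𝒳 hg hg0 hXg he hle hε
    refine (hopt.total_le _ _ _ hplan).trans ?_
    rw [total]
    simp only [htr]
    exact add_le_add_right (EReal.coe_le_coe_iff.2 hcost) _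
  have hbot : ∑ i, φ i (traded μ L f₀ X₀ i) ≠ ⊥ := by
    rw [Fin.sum_univ_two, Ne, EReal.add_eq_bot_iff, not_or]
    exact ⟨h.risk.ne_bot _ _, h.risk.ne_bot _ _⟩
  generalize ∑ i, φ i (traded μ L f₀ X₀ i) = s at key hbot
  generalize total μ L φ g f X = t at key
  induction s with
  | bot => exact absurd rfl hbot
  | top => rw [EReal.top_add_coe]; exact le_top
  | coe s =>
    induction t with
    | bot => exact bot_le
    | top =>
      have := key 1 one_pos
      rw [← EReal.coe_add, top_le_iff] at this
      exact absurd this (EReal.coe_ne_top _)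
    | coe t =>
      norm_cast at key ⊢
      exact le_of_forall_pos_le_add fun ε hε => by linarith [key ε hε]

/-- In an optimal plan the variances coincide with the schedule, and so they do for every other
choice of claims with the same aggregates. -/
theorem IsOptimalPlan.norm_sq_eq [NormedSpace ℝ E] [CompleteSpace E] {L : E →L[ℝ] E}
    (h : IsMarket a K R μ L 𝒳 φ) (hopt : IsOptimalPlan μ L 𝒳 φ K g f X)
    (hfin : total μ L φ g f X ≠ ⊤) {X' : Fin 2 → ℝ → E}
    (hX : ∀ k, AEStronglyMeasurable (X' k) μ) (hX𝒳 : ∀ k, ∀ᵐ θ ∂μ, X' k θ ∈ 𝒳 k)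
    (hXg : ∀ k, ∀ᵐ θ ∂μ, share f k θ ≠ 0 → ‖L (X' k θ)‖ ^ 2 ≤ g θ)
    (htr : ∀ k, traded μ L f X' k = traded μ L f X k) (i : Fin 2) :
    ∀ᵐ θ ∂μ, share f i θ ≠ 0 → ‖L (X' i θ)‖ ^ 2 = g θ := by
  have hrent : Integrable (rent g) μ := by
    refine Integrable.of_bound (continuous_rent hopt.anti).aestronglyMeasurable K ?_
    filter_upwards [ae_mem_types h.null] with θ hθ
    have := rent_mem h.pos hopt.anti hopt.nonneg hopt.le hθ
    rw [Real.norm_eq_abs, abs_of_nonneg this.1]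
    exact this.2
  have hlev : ∀ k, Integrable (fun θ => θ * ‖L (X' k θ)‖ ^ 2) μ := by
    intro k
    refine Integrable.of_bound (aestronglyMeasurable_id.mul
      ((L.continuous.comp_aestronglyMeasurable (hX k)).norm.pow 2)) (1 * K) ?_
    filter_upwards [ae_mem_types h.null, hX𝒳 k] with θ hθ hx
    have h1 : 0 ≤ θ := h.pos.le.trans hθ.1
    rw [norm_mul, Real.norm_eq_abs, Real.norm_eq_abs, abs_of_nonneg h1, abs_of_nonneg (sq_nonneg _)]
    exact mul_le_mul hθ.2 (h.claims.var_le k _ hx) (sq_nonneg _) zero_le_one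
  have he : ∀ k, Integrable (fun θ => share f k θ * (rent g θ + θ * ‖L (X' k θ)‖ ^ 2)) μ :=
    fun k => integrable_share_mul hopt.f_meas hopt.f_mem k (hrent.add (hlev k))
  have h1 := hopt.total_le_of_sorted h hopt.f_meas hopt.f_mem hX hX𝒳 hopt.anti
    (fun θ _ => hopt.nonneg θ) hXg he (fun k => by
      filter_upwards [ae_mem_types h.null] with θ hθ _
      exact ⟨θ, hθ, le_rfl⟩)
  obtain ⟨r, hr⟩ := exists_coe_of_total_ne_top h.risk hfin
  simp only [total, htr, hr, Fin.sum_univ_two] at h1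
  norm_cast at h1
  have hout := integrable_outlay h.pos h.null hopt.anti hopt.nonneg hopt.le
  rw [cost, ← sum_integral_share_mul hopt.f_meas hopt.f_mem hout, Fin.sum_univ_two] at h1
  have hge : ∀ k, 0 ≤ᵐ[μ] fun θ =>
      share f k θ * outlay g θ - share f k θ * (rent g θ + θ * ‖L (X' k θ)‖ ^ 2) := by
    intro k
    filter_upwards [hXg k, ae_mem_types h.null] with θ h2 hθ
    have h3 : 0 < θ := h.pos.trans_le hθ.1
    by_cases h4 : share f k θ = 0
    · simp [h4]
    · have h5 := mul_nonneg (share_mem hopt.f_mem k θ).1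
        (mul_nonneg h3.le (sub_nonneg.2 (h2 h4)))
      simp only [Pi.zero_apply, outlay]
      linarith
  have hint : ∀ k, Integrable (fun θ => share f k θ * outlay g θ -
      share f k θ * (rent g θ + θ * ‖L (X' k θ)‖ ^ 2)) μ := fun k =>
    (integrable_share_mul hopt.f_meas hopt.f_mem k hout).sub (he k)
  have hsub : ∀ k, ∫ θ, (share f k θ * outlay g θ -
      share f k θ * (rent g θ + θ * ‖L (X' k θ)‖ ^ 2)) ∂μ =
      ∫ θ, share f k θ * outlay g θ ∂μ -
        ∫ θ, share f k θ * (rent g θ + θ * ‖L (X' k θ)‖ ^ 2) ∂μ := fun k =>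
    integral_sub (integrable_share_mul hopt.f_meas hopt.f_mem k hout) (he k)
  have hzero : ∫ θ, (share f i θ * outlay g θ -
      share f i θ * (rent g θ + θ * ‖L (X' i θ)‖ ^ 2)) ∂μ = 0 := by
    have h2 := integral_nonneg_of_ae (hge 0)
    have h3 := integral_nonneg_of_ae (hge 1)
    rw [hsub] at h2 h3
    rw [hsub]
    fin_cases i
    · simp only [Fin.zero_eta]
      linarith
    · simp only [Fin.mk_one]
      linarith
  filter_upwards [(integral_eq_zero_iff_of_nonneg_ae (hge i) (hint i)).1 hzero,
    ae_mem_types h.null] with θ h2 hθ h3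
  have h4 : 0 < θ := h.pos.trans_le hθ.1
  simp only [Pi.zero_apply, outlay] at h2
  have h5 : share f i θ * (θ * (g θ - ‖L (X' i θ)‖ ^ 2)) = 0 := by linarith
  rcases mul_eq_zero.1 h5 with h6 | h6
  · exact absurd h6 h3
  · rcases mul_eq_zero.1 h6 with h7 | h7
    · exact absurd h7 h4.ne'
    · linarith

/-- In an optimal plan no firm gains from serving its buyers with nothing. -/
theorem IsOptimalPlan.risk_add_le [NormedSpace ℝ E] [CompleteSpace E] {L : E →L[ℝ] E}
    (h : IsMarket a K R μ L 𝒳 φ) (hopt : IsOptimalPlan μ L 𝒳 φ K g f X)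
    (hfin : total μ L φ g f X ≠ ⊤) (i : Fin 2) :
    φ i (traded μ L f X i) + ((∫ θ, share f i θ * outlay g θ ∂μ : ℝ) : EReal) ≤ φ i 0 := by
  have hout := integrable_outlay h.pos h.null hopt.anti hopt.nonneg hopt.le
  -- The buyers of firm `i` get the null claim and nothing else, which sorting allows through the
  -- reference type `ϑ = 1`, where the rent vanishes; the other firm's buyers keep their outlay.
  have h1 := hopt.total_le_of_sorted h (g₀ := g) (f₀ := f) (X₀ := Function.update X i 0)
    (e := Function.update (fun _ => outlay g) i 0) hopt.f_meas hopt.f_mem ?_ ?_ hopt.anti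
    (fun θ _ => hopt.nonneg θ) ?_ ?_ ?_
  · have h3 : traded μ L f (Function.update X i 0) i = 0 := by
      simp [traded]
    have h4 : ∀ j, j ≠ i → traded μ L f (Function.update X i 0) j = traded μ L f X j := by
      intro j hj
      simp [traded, Function.update_of_ne hj]
    obtain ⟨r, hr⟩ := exists_coe_of_total_ne_top h.risk hfin
    have h5 := sum_integral_share_mul hopt.f_meas hopt.f_mem hout
    rw [total, cost, ← h5] at h1
    simp only [Fin.sum_univ_two] at h1
    have h6 := h.risk.ne_bot i 0
    have h01 : (1 : Fin 2) ≠ 0 := by decide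
    have h10 : (0 : Fin 2) ≠ 1 := by decide
    fin_cases i
    · simp only [Fin.zero_eta] at h3 h4 h1 h6 ⊢
      rw [h3, h4 1 h01, hr, hr, Function.update_self, Function.update_of_ne h01] at h1
      rw [hr]
      generalize φ 0 0 = s at h1 h6 ⊢
      induction s with
      | bot => exact absurd rfl h6
      | top => exact le_top
      | coe s =>
        simp only [Pi.zero_apply, mul_zero, integral_zero, zero_add] at h1
        norm_cast at h1 ⊢
        linarith
    · simp only [Fin.mk_one] at h3 h4 h1 h6 ⊢
      rw [h3, h4 0 h10, hr, hr, Function.update_self, Function.update_of_ne h10] at h1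
      rw [hr]
      generalize φ 1 0 = s at h1 h6 ⊢
      induction s with
      | bot => exact absurd rfl h6
      | top => exact le_top
      | coe s =>
        simp only [Pi.zero_apply, mul_zero, integral_zero, add_zero] at h1
        norm_cast at h1 ⊢
        linarith
  · intro k
    rcases eq_or_ne k i with rfl | hk
    · rw [Function.update_self]; exact aestronglyMeasurable_zero
    · rw [Function.update_of_ne hk]; exact hopt.meas k
  · intro k
    rcases eq_or_ne k i with rfl | hk
    · rw [Function.update_self]; exact Eventually.of_forall fun _ => h.claims.zero_mem k
    · rw [Function.update_of_ne hk]; exact hopt.mem k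
  · intro k
    rcases eq_or_ne k i with rfl | hk
    · rw [Function.update_self]
      exact Eventually.of_forall fun θ _ => by simpa using hopt.nonneg θ
    · rw [Function.update_of_ne hk]; exact hopt.var_le k
  · intro k
    rcases eq_or_ne k i with rfl | hk
    · rw [Function.update_self]; simp
    · rw [Function.update_of_ne hk]; exact integrable_share_mul hopt.f_meas hopt.f_mem k hout
  · intro k
    rcases eq_or_ne k i with rfl | hk
    · rw [Function.update_self, Function.update_self]
      exact Eventually.of_forall fun θ _ => ⟨1, ⟨h.lt_one.le, le_rfl⟩, by simp [rent]⟩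
    · rw [Function.update_of_ne hk, Function.update_of_ne hk]
      filter_upwards [hopt.var_le k, ae_mem_types h.null] with θ h2 hθ h3
      have : 0 ≤ θ := h.pos.le.trans hθ.1
      exact ⟨θ, hθ, add_le_add_right (mul_le_mul_of_nonneg_left (h2 h3) this) _⟩

/-- Averages of the claims sold by a firm, taken over types at which the schedule exceeds `ℓ`. -/
def upperAverages [NormedSpace ℝ E] (μ : Measure ℝ) (g w : ℝ → ℝ) (X : ℝ → E) (ℓ : ℝ) : Set E :=
  {y | ∃ r : ℝ → ℝ, Measurable r ∧ (∃ C, ∀ θ, r θ ∈ Icc 0 C) ∧ (∀ θ, r θ ≠ 0 → ℓ < g θ) ∧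
    ∫ θ, r θ * w θ ∂μ = 1 ∧ y = ∫ θ, (r θ * w θ) • X θ ∂μ}

omit [IsFiniteMeasure μ] in
theorem upperAverages_anti [NormedSpace ℝ E] {w : ℝ → ℝ} {Y : ℝ → E} {ℓ ℓ' : ℝ} (hℓ : ℓ ≤ ℓ') :
    upperAverages μ g w Y ℓ' ⊆ upperAverages μ g w Y ℓ := fun _ ⟨r, h1, h2, h3, h4⟩ =>
  ⟨r, h1, h2, fun θ hθ => hℓ.trans_lt (h3 θ hθ), h4⟩

omit [IsFiniteMeasure μ] in
theorem integrable_mul_of_mem_Icc {r u : ℝ → ℝ} (hr : Measurable r) {C : ℝ}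
    (hC : ∀ θ, r θ ∈ Icc 0 C) (hu : Integrable u μ) : Integrable (fun θ => r θ * u θ) μ :=
  hu.bdd_mul hr.aestronglyMeasurable (c := C) (Eventually.of_forall fun θ => by
    rw [Real.norm_eq_abs, abs_of_nonneg (hC θ).1]; exact (hC θ).2)

omit [IsFiniteMeasure μ] in
theorem integrable_smul_of_mem_Icc [NormedSpace ℝ E] {r : ℝ → ℝ} {u : ℝ → E} (hr : Measurable r)
    {C : ℝ} (hC : ∀ θ, r θ ∈ Icc 0 C) (hu : Integrable u μ) : Integrable (fun θ => r θ • u θ) μ :=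
  hu.bdd_smul C hr.aestronglyMeasurable (Eventually.of_forall fun θ => by
    rw [Real.norm_eq_abs, abs_of_nonneg (hC θ).1]; exact (hC θ).2)

omit [IsFiniteMeasure μ] in
theorem convex_upperAverages [NormedSpace ℝ E] {w : ℝ → ℝ} {Y : ℝ → E} {ℓ : ℝ}
    (hw : Integrable w μ) (hwY : Integrable (fun θ => w θ • Y θ) μ) :
    Convex ℝ (upperAverages μ g w Y ℓ) := by
  rintro _ ⟨r, hr, ⟨C, hC⟩, hrg, hr1, rfl⟩ _ ⟨r', hr', ⟨C', hC'⟩, hrg', hr1', rfl⟩ s t hs ht hst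
  have hi := integrable_mul_of_mem_Icc hr hC hw
  have hi' := integrable_mul_of_mem_Icc hr' hC' hw
  have hj := integrable_smul_of_mem_Icc hr hC hwY
  have hj' := integrable_smul_of_mem_Icc hr' hC' hwY
  simp only [smul_smul] at hj hj'
  have hjs : Integrable (fun θ => s • (r θ * w θ) • Y θ) μ := hj.smul s
  have hjt : Integrable (fun θ => t • (r' θ * w θ) • Y θ) μ := hj'.smul t
  refine ⟨fun θ => s * r θ + t * r' θ, (hr.const_mul s).add (hr'.const_mul t),
    ⟨s * C + t * C', fun θ => ⟨add_nonneg (mul_nonneg hs (hC θ).1) (mul_nonneg ht (hC' θ).1),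
      add_le_add (mul_le_mul_of_nonneg_left (hC θ).2 hs)
        (mul_le_mul_of_nonneg_left (hC' θ).2 ht)⟩⟩, fun θ h => ?_, ?_, ?_⟩
  · by_cases h1 : r θ = 0
    · refine hrg' θ fun h2 => h (by simp only [h1, h2]; ring)
    · exact hrg θ h1
  · simp only [add_mul, mul_assoc]
    rw [integral_add (hi.const_mul s) (hi'.const_mul t), integral_const_mul, integral_const_mul,
      hr1, hr1']
    linarith
  · simp only [add_mul, add_smul, mul_assoc s, mul_assoc t, mul_smul s, mul_smul t]
    rw [integral_add hjs hjt, integral_smul, integral_smul]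

/-- If an average had variance below `ℓ`, mixing it into the very claims it averages would preserve
the aggregate and push the variance strictly below the schedule on a set of positive mass of buyers,
against `IsOptimalPlan.norm_sq_eq`. -/
theorem IsOptimalPlan.norm_sq_ge_of_mem_upperAverages [NormedSpace ℝ E] [CompleteSpace E]
    {L : E →L[ℝ] E} (h : IsMarket a K R μ L 𝒳 φ) (hopt : IsOptimalPlan μ L 𝒳 φ K g f X)
    (hfin : total μ L φ g f X ≠ ⊤) {i : Fin 2} {ℓ : ℝ} {y : E}
    (hy : y ∈ upperAverages μ g (share f i) (X i) ℓ) : y ∈ 𝒳 i ∧ ℓ ≤ ‖L y‖ ^ 2 := by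
  obtain ⟨r, hr, ⟨C, hC⟩, hrg, hr1, hyX⟩ := hy
  have hsh := integrable_share hopt.f_meas hopt.f_mem i (μ := μ)
  have hXi := h.claims.integrable (hopt.meas i) (hopt.mem i)
  have hshX := integrable_share_smul hopt.f_meas hopt.f_mem i hXi
  have hi := integrable_mul_of_mem_Icc hr hC hsh
  have hj := integrable_smul_of_mem_Icc hr hC hshX
  simp only [smul_smul] at hj
  have hmem : y ∈ 𝒳 i := by
    have h1 := weighted_average_mem (h.claims.convex i) (h.claims.closed i)
      (fun θ => mul_nonneg (hC θ).1 (share_mem hopt.f_mem i θ).1) hi hj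
      ((hopt.mem i).mono fun θ hθ _ => hθ) (by rw [hr1]; exact one_pos)
    rwa [hr1, inv_one, one_smul, ← hyX] at h1
  refine ⟨hmem, ?_⟩
  by_contra hlt
  push Not at hlt
  -- Scales the bounded density `r` so that `t * r θ` is a convex weight.
  set t := (max C 1)⁻¹
  have ht0 : 0 < t := inv_pos.2 (lt_of_lt_of_le one_pos (le_max_right _ _))
  have htr0 : ∀ θ, 0 ≤ t * r θ := fun θ => mul_nonneg ht0.le (hC θ).1
  have htr1 : ∀ θ, t * r θ ≤ 1 := fun θ => by
    rw [inv_mul_le_iff₀ (lt_of_lt_of_le one_pos (le_max_right _ _)), mul_one]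
    exact (hC θ).2.trans (le_max_left _ _)
  set Y : ℝ → E := fun θ => (1 - t * r θ) • X i θ + (t * r θ) • y with hY
  have hYm : AEStronglyMeasurable Y μ :=
    (((hr.const_mul t).const_sub 1).aestronglyMeasurable.smul (hopt.meas i)).add
      ((hr.const_mul t).aestronglyMeasurable.smul aestronglyMeasurable_const)
  have hYmem : ∀ᵐ θ ∂μ, Y θ ∈ 𝒳 i := (hopt.mem i).mono fun θ hθ =>
    h.claims.convex i hθ hmem (by linarith [htr1 θ]) (htr0 θ) (by ring)
  have hsq : ∀ᵐ θ ∂μ, share f i θ ≠ 0 → ‖L (Y θ)‖ ^ 2 ≤ g θ ∧ (r θ ≠ 0 → ‖L (Y θ)‖ ^ 2 < g θ) := by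
    filter_upwards [hopt.var_le i] with θ h1 h2
    have h3 := h1 h2
    by_cases h4 : r θ = 0
    · simp only [hY, h4, mul_zero, sub_zero, one_smul, zero_smul, add_zero]
      exact ⟨h3, fun h => absurd rfl h⟩
    · have h5 := hrg θ h4
      have h6 : 0 < t * r θ := mul_pos ht0 (lt_of_le_of_ne (hC θ).1 (Ne.symm h4))
      have h7 : ‖L y‖ < √(g θ) := Real.lt_sqrt_of_sq_lt (hlt.trans h5)
      have h8 : ‖L (X i θ)‖ ≤ √(g θ) := Real.le_sqrt_of_sq_le h3
      have h9 : ‖L (Y θ)‖ < √(g θ) := by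
        have h10 : ‖L (Y θ)‖ ≤ (1 - t * r θ) * ‖L (X i θ)‖ + t * r θ * ‖L y‖ := by
          simp only [hY, map_add, map_smul]
          refine (norm_add_le _ _).trans (le_of_eq ?_)
          rw [norm_smul, norm_smul, Real.norm_eq_abs, Real.norm_eq_abs, abs_of_nonneg (htr0 θ),
            abs_of_nonneg (by linarith [htr1 θ])]
        have h11 := mul_lt_mul_of_pos_left h7 h6
        have h12 := mul_le_mul_of_nonneg_left h8 (show 0 ≤ 1 - t * r θ by linarith [htr1 θ])
        linarith
      have h10 : ‖L (Y θ)‖ ^ 2 < g θ := by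
        have := pow_lt_pow_left₀ h9 (norm_nonneg _) two_ne_zero
        rwa [Real.sq_sqrt (hopt.nonneg θ)] at this
      exact ⟨h10.le, fun _ => h10⟩
  have hYtr : traded μ L f (Function.update X i Y) i = traded μ L f X i := by
    have h1 : Integrable (fun θ => share f i θ • Function.update X i Y i θ) μ := by
      rw [Function.update_self]
      exact integrable_share_smul hopt.f_meas hopt.f_mem i (h.claims.integrable hYm hYmem)
    rw [traded_eq h1, traded_eq hshX, Function.update_self]
    congr 1
    have h2 : ∀ θ, share f i θ • Y θ = share f i θ • X i θ - t • ((r θ * share f i θ) • X i θ)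
        + (t * (r θ * share f i θ)) • y := by
      intro θ
      simp only [hY]
      module
    simp only [h2]
    have hjt : Integrable (fun θ => t • (r θ * share f i θ) • X i θ) μ := hj.smul t
    have hsubt : Integrable (fun θ => share f i θ • X i θ - t • (r θ * share f i θ) • X i θ) μ :=
      hshX.sub hjt
    rw [integral_add hsubt ((hi.const_mul t).smul_const y), integral_sub hshX hjt, integral_smul, ← hyX, integral_smul_const,
      integral_const_mul, hr1]
    module
  have hev := hopt.norm_sq_eq h hfin (X' := Function.update X i Y) ?_ ?_ ?_ ?_ i
  · have h1 : ∀ᵐ θ ∂μ, r θ * share f i θ = 0 := by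
      filter_upwards [hev, hsq] with θ h1 h2
      by_contra h3
      have h4 : r θ ≠ 0 := fun h => h3 (by rw [h, zero_mul])
      have h5 : share f i θ ≠ 0 := fun h => h3 (by rw [h, mul_zero])
      have h6 := h1 h5
      rw [Function.update_self] at h6
      exact ((h2 h5).2 h4).ne h6
    rw [integral_congr_ae (g := fun _ => 0) h1, integral_zero] at hr1
    exact zero_ne_one hr1
  · intro k
    rcases eq_or_ne k i with rfl | hk
    · rw [Function.update_self]; exact hYm
    · rw [Function.update_of_ne hk]; exact hopt.meas k
  · intro k
    rcases eq_or_ne k i with rfl | hk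
    · rw [Function.update_self]; exact hYmem
    · rw [Function.update_of_ne hk]; exact hopt.mem k
  · intro k
    rcases eq_or_ne k i with rfl | hk
    · rw [Function.update_self]; exact hsq.mono fun θ h1 h2 => (h1 h2).1
    · rw [Function.update_of_ne hk]; exact hopt.var_le k
  · intro k
    rcases eq_or_ne k i with rfl | hk
    · exact hYtr
    · simp only [traded, Function.update_of_ne hk]

/-- The schedule of an optimal plan does not exceed, on the buyers of a firm, the variance of some
feasible claim of that firm. -/
theorem IsOptimalPlan.exists_norm_sq_ge [InnerProductSpace ℝ E] [CompleteSpace E]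
    {L : E →L[ℝ] E} (h : IsMarket a K R μ L 𝒳 φ) (hopt : IsOptimalPlan μ L 𝒳 φ K g f X)
    (hfin : total μ L φ g f X ≠ ⊤) (i : Fin 2) :
    ∃ Z ∈ 𝒳 i, ∀ᵐ θ ∂μ, share f i θ ≠ 0 → g θ ≤ ‖L Z‖ ^ 2 := by
  have hsh := integrable_share hopt.f_meas hopt.f_mem i (μ := μ)
  have hshX := integrable_share_smul hopt.f_meas hopt.f_mem i
    (h.claims.integrable (hopt.meas i) (hopt.mem i))
  set V : Set ℝ := (fun x => ‖L x‖ ^ 2) '' 𝒳 i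
  have hVb : BddAbove V := ⟨K, by rintro _ ⟨x, hx, rfl⟩; exact h.claims.var_le i x hx⟩
  have hVne : V.Nonempty := ⟨_, 0, h.claims.zero_mem i, rfl⟩
  have hgV : ∀ᵐ θ ∂μ, share f i θ ≠ 0 → g θ ≤ sSup V := by
    filter_upwards [hopt.norm_sq_eq h hfin hopt.meas hopt.mem hopt.var_le (fun _ => rfl) i,
      hopt.mem i] with θ h1 h2 h3
    rw [← h1 h3]
    exact le_csSup hVb ⟨_, h2, rfl⟩
  -- The supremum of the variance over `𝒳 i` need not be attained. If the schedule comes arbitrarily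
  -- close to it on buyers of positive mass, the closures of the upper averages at levels tending to
  -- it have a common point, which attains it. Otherwise the schedule stays below some smaller
  -- level, which some feasible claim exceeds.
  by_cases hpos : ∀ ℓ < sSup V, 0 < ∫ θ in {θ | ℓ < g θ}, share f i θ ∂μ
  · set ℓ : ℕ → ℝ := fun n => sSup V - 1 / ((n : ℝ) + 1)
    have hℓlim : Tendsto ℓ atTop (𝓝 (sSup V)) := by
      have := (tendsto_one_div_add_atTop_nhds_zero_nat (𝕜 := ℝ)).const_sub (sSup V)
      rwa [sub_zero] at this
    have hℓmono : Monotone ℓ := fun m n hmn => by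
      have : (1 : ℝ) / ((n : ℝ) + 1) ≤ 1 / ((m : ℝ) + 1) :=
        Nat.one_div_le_one_div hmn
      simp only [ℓ]
      linarith
    have hsub : ∀ n, closure (upperAverages μ g (share f i) (X i) (ℓ n)) ⊆
        𝒳 i ∩ {x | ℓ n ≤ ‖L x‖ ^ 2} := fun n =>
      closure_minimal (fun y hy => hopt.norm_sq_ge_of_mem_upperAverages h hfin hy)
        ((h.claims.closed i).inter (isClosed_le continuous_const (by fun_prop)))
    obtain ⟨Z, hZ⟩ := nonempty_iInter_of_antitone_convex
      (fun n => closure (upperAverages μ g (share f i) (X i) (ℓ n)))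
      (fun m n hmn => closure_mono (upperAverages_anti (hℓmono hmn))) (fun n => isClosed_closure)
      (fun n => (convex_upperAverages hsh hshX).closure) (fun n => by
        refine Nonempty.closure ?_
        have hn : ℓ n < sSup V := sub_lt_self _ (by positivity)
        have hc := hpos _ hn
        set c := ∫ θ in {θ | ℓ n < g θ}, share f i θ ∂μ
        have hms : MeasurableSet {θ | ℓ n < g θ} :=
          measurableSet_lt measurable_const hopt.anti.measurable
        refine ⟨_, {θ | ℓ n < g θ}.indicator fun _ => c⁻¹, measurable_const.indicator hms,
          ⟨c⁻¹, fun θ => ⟨indicator_nonneg (fun _ _ => inv_nonneg.2 hc.le) _,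
            indicator_le_self' (fun _ _ => inv_nonneg.2 hc.le) _⟩⟩, fun θ hθ => ?_, ?_, rfl⟩
        · by_contra h'
          exact hθ (indicator_of_notMem (s := {θ | ℓ n < g θ}) h' _)
        · have : (fun θ => {θ | ℓ n < g θ}.indicator (fun _ => c⁻¹) θ * share f i θ) =
              {θ | ℓ n < g θ}.indicator fun θ => c⁻¹ * share f i θ := by
            funext θ
            by_cases h' : θ ∈ {θ | ℓ n < g θ} <;> simp [Set.indicator]
          rw [this, integral_indicator hms, integral_const_mul, inv_mul_cancel₀ hc.ne'])
      ((Metric.isBounded_iff_subset_closedBall 0).2 ⟨R, fun y hy => by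
        rw [mem_closedBall_zero_iff]
        exact h.claims.norm_le i y (hsub 0 hy).1⟩)
    refine ⟨Z, (hsub 0 (hZ 0)).1, hgV.mono fun θ h1 h2 => (h1 h2).trans ?_⟩
    exact le_of_tendsto' hℓlim fun n => (hsub n (hZ n)).2
  · push Not at hpos
    obtain ⟨ℓ, hℓ, hle⟩ := hpos
    obtain ⟨_, ⟨Z, hZ, rfl⟩, hZℓ⟩ := exists_lt_of_lt_csSup hVne hℓ
    refine ⟨Z, hZ, ?_⟩
    have hms : MeasurableSet {θ | ℓ < g θ} :=
      measurableSet_lt measurable_const hopt.anti.measurable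
    have h0 : ∀ θ, 0 ≤ share f i θ := fun θ => (share_mem hopt.f_mem i θ).1
    have h1 := (integral_eq_zero_iff_of_nonneg h0 hsh.integrableOn).1
      (le_antisymm hle (integral_nonneg h0))
    filter_upwards [(ae_restrict_iff' hms).1 h1] with θ h2 h3
    by_contra h4
    exact h3 (h2 (hZℓ.trans (not_le.1 h4)))

end optimal


/-! ### Centred claims -/

section centring

variable {Ω : Type*} [MeasurableSpace Ω] (P : Measure Ω) [IsProbabilityMeasure P]

/-- The continuous linear map `X ↦ X - E[X]`. -/
def centring : Claim P →L[ℝ] Claim P :=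
  ContinuousLinearMap.id ℝ (Claim P) - (Lp.constL 2 P ℝ (E := ℝ)).comp (integralL2 P)

variable {P}

theorem centred_eq (X : Claim P) : centred X = centring P X := rfl

theorem var_eq (X : Claim P) : var X = ‖centring P X‖ ^ 2 := by
  have h1 : (fun ω => (centring P X : Claim P) ω) =ᵐ[P] fun ω => X ω - mean X := by
    filter_upwards [Lp.coeFn_sub X (Lp.const 2 P (mean X)), Lp.coeFn_const (μ := P) (p := 2)
      (mean X)] with ω h2 h3
    rw [← centred_eq, centred, h2, Pi.sub_apply, h3]
    rfl
  rw [var, variance_eq_integral (Lp.aestronglyMeasurable X).aemeasurable,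
    ← real_inner_self_eq_norm_sq, L2.inner_def]
  refine integral_congr_ae ?_
  filter_upwards [h1] with ω h2
  rw [h2, real_inner_self_eq_norm_sq, Real.norm_eq_abs, sq_abs]
  rfl

theorem var_nonneg (X : Claim P) : 0 ≤ var X := by
  rw [var_eq]
  positivity

end centring

/-! ### Admissible catalogues -/

section catalogue

variable {Ω : Type*} [MeasurableSpace Ω] {P : Measure Ω} {a : ℝ}
  {μ : Measure ℝ} {𝒳 : Set (Claim P)} {C : Catalogue P}

theorem indirectUtility_eq
    (hC : ∀ θ ∈ types a, ∀ τ ∈ types a,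
      utility θ (C.product τ) - C.price τ ≤ utility θ (C.product θ) - C.price θ) {θ : ℝ}
    (hθ : θ ∈ types a) : indirectUtility a C θ = utility θ (C.product θ) - C.price θ :=
  IsGreatest.csSup_eq ⟨⟨θ, hθ, rfl⟩, by rintro _ ⟨τ, hτ, rfl⟩; exact hC θ hθ τ hτ⟩

theorem IsAdmissible.sub_le (hC : IsAdmissible a μ 𝒳 C) {θ τ : ℝ} (hθ : θ ∈ types a)
    (hτ : τ ∈ types a) :
    indirectUtility a C τ - (θ - τ) * var (C.product τ) ≤ indirectUtility a C θ := by
  rw [indirectUtility_eq hC.incentive_compatible hθ, indirectUtility_eq hC.incentive_compatible hτ]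
  have := hC.incentive_compatible θ hθ τ hτ
  simp only [utility] at this ⊢
  linarith

variable [IsProbabilityMeasure P]

/-- Adding the subgradient inequalities at two points gives `(θ - τ) * (γ θ - γ τ) ≤ 0`. -/
theorem antitoneOn_of_subgradient {v γ : ℝ → ℝ} {s : Set ℝ}
    (h : ∀ θ ∈ s, ∀ τ ∈ s, v τ - (θ - τ) * γ τ ≤ v θ) : AntitoneOn γ s := by
  intro τ hτ θ hθ hle
  rcases hle.eq_or_lt with rfl | hlt
  · exact le_rfl
  · have h1 := h θ hθ τ hτ
    have h2 := h τ hτ θ hθ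
    by_contra h3
    push Not at h3
    nlinarith [mul_pos (sub_pos.2 hlt) (sub_pos.2 h3)]

omit [IsProbabilityMeasure P] in
theorem IsAdmissible.antitoneOn_var (hC : IsAdmissible a μ 𝒳 C) :
    AntitoneOn (fun θ => var (C.product θ)) (types a) :=
  antitoneOn_of_subgradient fun _ hθ _ hτ => hC.sub_le hθ hτ

theorem IsAdmissible.antitoneOn_indirectUtility (hC : IsAdmissible a μ 𝒳 C) :
    AntitoneOn (indirectUtility a C) (types a) := by
  intro τ hτ θ hθ hle
  have := hC.sub_le hτ hθ
  nlinarith [mul_nonneg (sub_nonneg.2 hle) (var_nonneg (C.product θ))]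

end catalogue

/-! ### The effective split -/

section split

variable {Ω : Type*} [MeasurableSpace Ω] {P : Measure Ω} {a : ℝ} {μ : Measure ℝ}
  {C : Fin 2 → Catalogue P} {f : ℝ → ℝ}

/-- The proportion of agents of each type who contract with the first firm. -/
def effectiveSplit (a : ℝ) (C : Fin 2 → Catalogue P) (f : ℝ → ℝ) (θ : ℝ) : ℝ :=
  (segment a C 0).indicator 1 θ + (ties a C).indicator f θ

theorem mem_segment {i : Fin 2} {θ : ℝ} : θ ∈ segment a C i ↔
    θ ∈ types a ∧ indirectUtility a (C (i + 1)) θ < indirectUtility a (C i) θ := Iff.rfl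

theorem mem_ties {θ : ℝ} : θ ∈ ties a C ↔
    θ ∈ types a ∧ indirectUtility a (C 0) θ = indirectUtility a (C 1) θ := Iff.rfl

theorem disjoint_segment_ties (i : Fin 2) : Disjoint (segment a C i) (ties a C) := by
  rw [Set.disjoint_left]
  intro θ h1 h2
  rw [mem_segment] at h1
  rw [mem_ties] at h2
  have h3 := h1.2
  fin_cases i
  · exact absurd h2.2 h3.ne'
  · exact absurd h2.2 h3.ne

theorem share_effectiveSplit_of_mem_segment {i : Fin 2} {θ : ℝ} (h : θ ∈ segment a C i) :
    share (effectiveSplit a C f) i θ = 1 := by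
  have h1 : θ ∉ ties a C := Set.disjoint_left.1 (disjoint_segment_ties i) h
  fin_cases i
  · have h : θ ∈ segment a C 0 := h
    simp [share, effectiveSplit, h, h1]
  · have h2 : θ ∉ segment a C 0 := fun h' => lt_asymm h.2 h'.2
    simp [share, effectiveSplit, h2, h1]

theorem share_effectiveSplit_of_mem_ties {i : Fin 2} {θ : ℝ} (h : θ ∈ ties a C) :
    share (effectiveSplit a C f) i θ = share f i θ := by
  have h1 : θ ∉ segment a C 0 := fun h' => Set.disjoint_left.1 (disjoint_segment_ties 0) h' h
  simp [share, effectiveSplit, h, h1]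

theorem share_effectiveSplit_of_notMem {i : Fin 2} {θ : ℝ} (hθ : θ ∈ types a)
    (h : θ ∉ segment a C i) (h' : θ ∉ ties a C) : share (effectiveSplit a C f) i θ = 0 := by
  fin_cases i
  · have h : θ ∉ segment a C 0 := h
    simp [share, effectiveSplit, h, h']
  · have h2 : θ ∈ segment a C 0 := by
      refine ⟨hθ, lt_of_le_of_ne (not_lt.1 fun h2 => h ⟨hθ, h2⟩) fun h2 => h' ⟨hθ, h2.symm⟩⟩
    simp [share, effectiveSplit, h2, h']

theorem effectiveSplit_mem (hf : IsTieBreakingRule a f) (θ : ℝ) :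
    effectiveSplit a C f θ ∈ Icc (0 : ℝ) 1 := by
  unfold effectiveSplit
  by_cases h : θ ∈ segment a C 0
  · have h1 : θ ∉ ties a C := Set.disjoint_left.1 (disjoint_segment_ties 0) h
    simp [h, h1]
  · by_cases h1 : θ ∈ ties a C
    · simpa [h, h1] using hf.2 θ h1.1
    · simp [h, h1]

theorem antitone_comp_projIcc (ha1 : a ≤ 1) {u : ℝ → ℝ} (hu : AntitoneOn u (types a)) :
    Antitone fun θ => u (projIcc a 1 ha1 θ) := fun _ _ h =>
  hu (projIcc a 1 ha1 _).2 (projIcc a 1 ha1 _).2 (monotone_projIcc ha1 h)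

theorem measurableSet_types : MeasurableSet (types a) := measurableSet_Icc

theorem measurableSet_segment (ha1 : a ≤ 1)
    (hC : ∀ i, AntitoneOn (indirectUtility a (C i)) (types a)) (i : Fin 2) :
    MeasurableSet (segment a C i) := by
  have : segment a C i = types a ∩ {θ | indirectUtility a (C (i + 1)) (projIcc a 1 ha1 θ) <
      indirectUtility a (C i) (projIcc a 1 ha1 θ)} := by
    ext θ
    rw [mem_segment, mem_inter_iff]
    refine and_congr_right fun hθ => ?_
    rw [Set.mem_ofPred, projIcc_of_mem ha1 hθ]
  rw [this]
  exact measurableSet_types.inter (measurableSet_lt (antitone_comp_projIcc ha1 (hC _)).measurable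
    (antitone_comp_projIcc ha1 (hC _)).measurable)

theorem measurableSet_ties (ha1 : a ≤ 1)
    (hC : ∀ i, AntitoneOn (indirectUtility a (C i)) (types a)) : MeasurableSet (ties a C) := by
  have : ties a C = types a ∩ {θ | indirectUtility a (C 0) (projIcc a 1 ha1 θ) =
      indirectUtility a (C 1) (projIcc a 1 ha1 θ)} := by
    ext θ
    rw [mem_ties, mem_inter_iff]
    refine and_congr_right fun hθ => ?_
    rw [Set.mem_ofPred, projIcc_of_mem ha1 hθ]
  rw [this]
  exact measurableSet_types.inter (measurableSet_eq_fun
    (antitone_comp_projIcc ha1 (hC _)).measurable (antitone_comp_projIcc ha1 (hC _)).measurable)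

theorem measurable_effectiveSplit (ha1 : a ≤ 1)
    (hC : ∀ i, AntitoneOn (indirectUtility a (C i)) (types a)) (hf : IsTieBreakingRule a f) :
    Measurable (effectiveSplit a C f) :=
  (measurable_one.indicator (measurableSet_segment ha1 hC 0)).add
    (hf.1.indicator (measurableSet_ties ha1 hC))

theorem integral_share_effectiveSplit {F : Type*} [NormedAddCommGroup F] [NormedSpace ℝ F]
    [IsFiniteMeasure μ] (hμΘ : μ (types a)ᶜ = 0) (ha1 : a ≤ 1)
    (hC : ∀ i, AntitoneOn (indirectUtility a (C i)) (types a)) (hf : IsTieBreakingRule a f)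
    (i : Fin 2) {h : ℝ → F} (hh : Integrable h μ) :
    ∫ θ, share (effectiveSplit a C f) i θ • h θ ∂μ =
      ∫ θ in segment a C i, h θ ∂μ + ∫ θ in ties a C, share f i θ • h θ ∂μ := by
  have hs := measurableSet_segment ha1 hC i
  have ht := measurableSet_ties ha1 hC
  have hint := integrable_share_smul (measurable_effectiveSplit ha1 hC hf) (effectiveSplit_mem hf)
    i hh
  rw [← setIntegral_eq_integral_of_ae_compl_eq_zero (s := segment a C i ∪ ties a C),
    setIntegral_union (disjoint_segment_ties i) ht hint.integrableOn hint.integrableOn]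
  · congr 1
    · refine setIntegral_congr_fun hs fun θ hθ => ?_
      simp only [share_effectiveSplit_of_mem_segment hθ, one_smul]
    · refine setIntegral_congr_fun ht fun θ hθ => ?_
      simp only [share_effectiveSplit_of_mem_ties hθ]
  · filter_upwards [ae_mem_types hμΘ] with θ hθ h1
    rw [mem_union, not_or] at h1
    rw [share_effectiveSplit_of_notMem hθ h1.1 h1.2, zero_smul]

end split

/-! ### Risk assessments in terms of plans -/

section assessment

variable {Ω : Type*} [MeasurableSpace Ω] {P : Measure Ω} [IsProbabilityMeasure P] {a K R : ℝ}
  {μ : Measure ℝ} [IsFiniteMeasure μ] {𝒳 : Fin 2 → Set (Claim P)} {ρ : Fin 2 → Claim P → EReal}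
  {W : Fin 2 → Claim P} {C : Fin 2 → Catalogue P} {f : ℝ → ℝ}

omit [IsFiniteMeasure μ] in
theorem restrict_types (hμΘ : μ (types a)ᶜ = 0) : μ.restrict (types a) = μ :=
  Measure.restrict_eq_self_of_ae_mem (ae_mem_types hμΘ)

theorem integrable_of_antitoneOn (hμΘ : μ (types a)ᶜ = 0) {u : ℝ → ℝ}
    (hu : AntitoneOn u (types a)) : Integrable u μ := by
  have : IntegrableOn u (types a) μ := hu.integrableOn_isCompact isCompact_Icc
  rwa [IntegrableOn, restrict_types hμΘ] at this

omit [IsFiniteMeasure μ] in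
theorem integrable_id_mul (ha : 0 < a) (hμΘ : μ (types a)ᶜ = 0) {u : ℝ → ℝ} (hu : Integrable u μ) :
    Integrable (fun θ => θ * u θ) μ := by
  refine hu.bdd_mul aestronglyMeasurable_id (c := 1) ?_
  filter_upwards [ae_mem_types hμΘ] with θ hθ
  rw [Real.norm_eq_abs, abs_of_nonneg (show 0 ≤ θ from ha.le.trans hθ.1)]
  exact hθ.2

/-- What the buyers of firm `i` receive. -/
def receipt (a : ℝ) (C : Fin 2 → Catalogue P) (i : Fin 2) (θ : ℝ) : ℝ :=
  indirectUtility a (C i) θ + θ * var ((C i).product θ)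

theorem integrable_receipt (ha : 0 < a) (hμΘ : μ (types a)ᶜ = 0)
    (hC : ∀ i, IsAdmissible a μ (𝒳 i) (C i)) (i : Fin 2) : Integrable (receipt a C i) μ :=
  (integrable_of_antitoneOn hμΘ (hC i).antitoneOn_indirectUtility).add
    (integrable_id_mul ha hμΘ (integrable_of_antitoneOn hμΘ (hC i).antitoneOn_var))

omit [IsProbabilityMeasure P] [IsFiniteMeasure μ] in
theorem aestronglyMeasurable_product (hμΘ : μ (types a)ᶜ = 0)
    (hC : ∀ i, IsAdmissible a μ (𝒳 i) (C i)) (i : Fin 2) :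
    AEStronglyMeasurable (C i).product μ := by
  have := (hC i).measurable
  rwa [restrict_types hμΘ] at this

/-- The effective split merges segments and ties into one integral. The variance constraint turns `θ
v' - v` into minus the receipt for Lebesgue almost every type, hence `μ`-almost everywhere. -/
theorem assessment_eq (ha : 0 < a) (ha1 : a ≤ 1) (hμ : μ ≪ volume) (hμΘ : μ (types a)ᶜ = 0)
    (h𝒳 : IsClaimFamily (centring P) 𝒳 K R)
    (hC : ∀ i, IsAdmissible a μ (𝒳 i) (C i)) (hf : IsTieBreakingRule a f) (i : Fin 2) :
    assessment a μ ρ W C f i =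
      ρ i (W i - traded μ (centring P) (effectiveSplit a C f) (fun i => (C i).product) i) +
        ((∫ θ, share (effectiveSplit a C f) i θ * receipt a C i θ ∂μ : ℝ) : EReal) := by
  have hanti : ∀ i, AntitoneOn (indirectUtility a (C i)) (types a) := fun i =>
    (hC i).antitoneOn_indirectUtility
  have hmem : ∀ᵐ θ ∂μ, (C i).product θ ∈ 𝒳 i := (ae_mem_types hμΘ).mono fun θ hθ => (hC i).mem θ hθ
  have hprod := h𝒳.integrable (aestronglyMeasurable_product hμΘ hC i) hmem
  have h1 : traded μ (centring P) (effectiveSplit a C f) (fun i => (C i).product) i =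
      (∫ θ in segment a C i, centred ((C i).product θ) ∂μ) +
        ∫ θ in ties a C, share f i θ • centred ((C i).product θ) ∂μ := by
    simp only [traded, centred_eq]
    exact integral_share_effectiveSplit hμΘ ha1 hanti hf i ((centring P).integrable_comp hprod)
  have hderiv : ∀ᵐ θ ∂μ, θ * deriv (indirectUtility a (C i)) θ - indirectUtility a (C i) θ =
      -receipt a C i θ := by
    have h2 := (ae_restrict_iff' measurableSet_types).1 (hC i).variance_constraint
    filter_upwards [hμ.ae_le h2, ae_mem_types hμΘ] with θ h3 hθ
    rw [(h3 hθ).deriv, receipt]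
    ring
  have h2 : income a μ C f i =
      -∫ θ, share (effectiveSplit a C f) i θ * receipt a C i θ ∂μ := by
    have h3 := integral_share_effectiveSplit hμΘ ha1 hanti hf i
      (integrable_receipt ha hμΘ hC i).neg
    simp only [smul_eq_mul, Pi.neg_apply, mul_neg, integral_neg] at h3
    simp only [h3, income]
    rw [← integral_neg, ← integral_neg]
    congr 1
    · exact integral_congr_ae (ae_restrict_of_ae hderiv)
    · refine integral_congr_ae (ae_restrict_of_ae ?_)
      filter_upwards [hderiv] with θ hθ
      rw [hθ]
      ring
  rw [assessment, risk, h2, h1, sub_eq_add_neg, ← EReal.coe_neg, neg_neg, sub_sub]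

end assessment


/-! ### The market of centred claims -/

section market

variable {Ω : Type*} [MeasurableSpace Ω] {P : Measure Ω} [IsProbabilityMeasure P]

omit [IsProbabilityMeasure P] in
theorem lowerSemicontinuous_of_fatou {ρ : Claim P → EReal} (hρ : FatouProperty P ρ) :
    LowerSemicontinuous ρ := by
  rw [lowerSemicontinuous_iff_isClosed_preimage]
  intro s
  refine IsSeqClosed.isClosed fun x y hx hxy => (hρ x y hxy).trans ?_
  refine (liminf_le_liminf (Eventually.of_forall fun n => show ρ (x n) ≤ s from hx n)).trans ?_
  simp

theorem isRiskPair {ρ : Fin 2 → Claim P → EReal} (hρ : ∀ i, IsConvexRiskMeasure P (ρ i))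
    (hρF : ∀ i, FatouProperty P (ρ i)) (W : Fin 2 → Claim P) :
    IsRiskPair fun i y => ρ i (W i - y) where
  ne_bot := fun i x => (hρ i).ne_bot _
  lsc := fun i => (lowerSemicontinuous_of_fatou (hρF i)).comp
    (continuous_const.sub continuous_id)
  convex := fun i x y t h0 h1 => by
    have := (hρ i).convex (W i - x) (W i - y) t h0 h1
    convert this using 2
    module

theorem exists_isClaimFamily {𝒳 : Fin 2 → Set (Claim P)} (h𝒳closed : ∀ i, IsClosed (𝒳 i))
    (h𝒳convex : ∀ i, Convex ℝ (𝒳 i)) (h𝒳bdd : ∀ i, Bornology.IsBounded (𝒳 i))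
    (h𝒳zero : ∀ i, 0 ∈ 𝒳 i) : ∃ K R, 0 < K ∧ IsClaimFamily (centring P) 𝒳 K R := by
  choose r hr using fun i => (h𝒳bdd i).exists_norm_le
  have hR : ∀ i, ∀ x ∈ 𝒳 i, ‖x‖ ≤ max (r 0) (r 1) := by
    intro i x hx
    refine (hr i x hx).trans ?_
    fin_cases i
    · exact le_max_left _ _
    · exact le_max_right _ _
  refine ⟨(‖centring P‖ * max (r 0) (r 1)) ^ 2 + 1, max (r 0) (r 1), by positivity, h𝒳closed,
    h𝒳convex, h𝒳zero, hR, fun i x hx => ?_⟩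
  have h1 : ‖centring P x‖ ≤ ‖centring P‖ * max (r 0) (r 1) :=
    ((centring P).le_opNorm x).trans
      (mul_le_mul_of_nonneg_left (hR i x hx) (centring P).opNorm_nonneg)
  have h2 := pow_le_pow_left₀ (norm_nonneg _) h1 2
  linarith

end market

/-! ### Lower bound for the aggregate risk -/

section lower

variable {Ω : Type*} [MeasurableSpace Ω] {P : Measure Ω} [IsProbabilityMeasure P] {a K R : ℝ}
  {μ : Measure ℝ} [IsFiniteMeasure μ] {𝒳 : Fin 2 → Set (Claim P)} {ρ : Fin 2 → Claim P → EReal}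
  {W : Fin 2 → Claim P} {C : Fin 2 → Catalogue P} {f : ℝ → ℝ}

/-- The larger of the two indirect utilities. -/
def bestUtility (a : ℝ) (C : Fin 2 → Catalogue P) (θ : ℝ) : ℝ :=
  max (indirectUtility a (C 0) θ) (indirectUtility a (C 1) θ)

/-- The variance bought from the preferred firm, the larger one in case of indifference. -/
def bestVariance (a : ℝ) (C : Fin 2 → Catalogue P) (θ : ℝ) : ℝ :=
  if indirectUtility a (C 1) θ < indirectUtility a (C 0) θ then var ((C 0).product θ)
  else if indirectUtility a (C 0) θ < indirectUtility a (C 1) θ then var ((C 1).product θ)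
  else max (var ((C 0).product θ)) (var ((C 1).product θ))

omit [IsProbabilityMeasure P] in
theorem exists_bestVariance_eq (a : ℝ) (C : Fin 2 → Catalogue P) (θ : ℝ) : ∃ i,
    bestUtility a C θ = indirectUtility a (C i) θ ∧
      bestVariance a C θ = var ((C i).product θ) := by
  unfold bestUtility bestVariance
  rcases lt_trichotomy (indirectUtility a (C 0) θ) (indirectUtility a (C 1) θ) with h | h | h
  · exact ⟨1, max_eq_right h.le, by rw [if_neg h.not_gt, if_pos h]⟩
  · rw [if_neg h.not_gt, if_neg h.not_lt]
    rcases le_total (var ((C 0).product θ)) (var ((C 1).product θ)) with h' | h'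
    · exact ⟨1, max_eq_right h.le, max_eq_right h'⟩
    · exact ⟨0, max_eq_left h.ge, max_eq_left h'⟩
  · exact ⟨0, max_eq_left h.le, by rw [if_pos h]⟩

omit [IsProbabilityMeasure P] in
theorem le_bestUtility (i : Fin 2) (θ : ℝ) : indirectUtility a (C i) θ ≤ bestUtility a C θ := by
  fin_cases i
  · exact le_max_left _ _
  · exact le_max_right _ _

omit [IsProbabilityMeasure P] in
theorem of_share_effectiveSplit_ne_zero {i : Fin 2} {θ : ℝ} (hθ : θ ∈ types a)
    (h : share (effectiveSplit a C f) i θ ≠ 0) :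
    bestUtility a C θ = indirectUtility a (C i) θ ∧
      var ((C i).product θ) ≤ bestVariance a C θ := by
  unfold bestUtility bestVariance
  by_cases h1 : θ ∈ segment a C i
  · have h2 := h1.2
    fin_cases i
    · have h2 : indirectUtility a (C 1) θ < indirectUtility a (C 0) θ := h2
      exact ⟨max_eq_left h2.le, by rw [if_pos h2]; exact le_rfl⟩
    · have h2 : indirectUtility a (C 0) θ < indirectUtility a (C 1) θ := h2
      exact ⟨max_eq_right h2.le, by rw [if_neg h2.not_gt, if_pos h2]; exact le_rfl⟩
  · by_cases h2 : θ ∈ ties a C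
    · have h3 := h2.2
      rw [if_neg h3.not_gt, if_neg h3.not_lt]
      fin_cases i
      · exact ⟨max_eq_left h3.ge, le_max_left _ _⟩
      · exact ⟨max_eq_right h3.le, le_max_right _ _⟩
    · exact absurd (share_effectiveSplit_of_notMem hθ h1 h2) h

omit [IsProbabilityMeasure P] [IsFiniteMeasure μ] in
theorem bestUtility_sub_le (hC : ∀ i, IsAdmissible a μ (𝒳 i) (C i)) {θ τ : ℝ}
    (hθ : θ ∈ types a) (hτ : τ ∈ types a) :
    bestUtility a C τ - (θ - τ) * bestVariance a C τ ≤ bestUtility a C θ := by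
  obtain ⟨i, h1, h2⟩ := exists_bestVariance_eq a C τ
  rw [h1, h2]
  exact ((hC i).sub_le hθ hτ).trans (le_bestUtility i θ)

/-- The larger indirect utility has minus `bestVariance` as a subgradient selection, and every sold
claim has at most that variance. It dominates the rent of this schedule, so the receipts are high
enough for sorting. -/
theorem IsOptimalPlan.total_le_aggregateRisk
    (h : IsMarket a K R μ (centring P) 𝒳 fun i y => ρ i (W i - y)) {g f₀ : ℝ → ℝ}
    {X : Fin 2 → ℝ → Claim P}
    (hopt : IsOptimalPlan μ (centring P) 𝒳 (fun i y => ρ i (W i - y)) K g f₀ X)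
    (hC : ∀ i, IsAdmissible a μ (𝒳 i) (C i)) (hf : IsTieBreakingRule a f) :
    total μ (centring P) (fun i y => ρ i (W i - y)) g f₀ X ≤ aggregateRisk a μ ρ W C f := by
  have ha1 := h.lt_one.le
  have hanti : ∀ i, AntitoneOn (indirectUtility a (C i)) (types a) := fun i =>
    (hC i).antitoneOn_indirectUtility
  have hbest : AntitoneOn (bestVariance a C) (types a) :=
    antitoneOn_of_subgradient fun _ hθ _ hτ => bestUtility_sub_le hC hθ hτ
  set G : ℝ → ℝ := fun θ => bestVariance a C (projIcc a 1 ha1 θ) with hG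
  have hGanti : Antitone G := antitone_comp_projIcc ha1 hbest
  have hGeq : ∀ θ ∈ types a, G θ = bestVariance a C θ := fun θ hθ => by
    simp only [hG, projIcc_of_mem ha1 hθ]
  -- The rent accounts for the drop of the best utility between `θ` and `1`, and individual
  -- rationality at type `1` supplies the rest.
  have hrent : ∀ θ ∈ types a, rent G θ ≤ bestUtility a C θ := by
    intro θ hθ
    have h1 : (1 : ℝ) ∈ types a := ⟨ha1, le_rfl⟩
    have h2 : rent G θ ≤ bestUtility a C θ - bestUtility a C 1 := by
      refine intervalIntegral_le_sub_of_antitone hGanti hθ.2 fun s hs t ht _ => ?_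
      have hs' : s ∈ types a := ⟨hθ.1.trans hs.1, hs.2⟩
      have ht' : t ∈ types a := ⟨hθ.1.trans ht.1, ht.2⟩
      have := bestUtility_sub_le hC hs' ht'
      rw [hGeq t ht']
      linarith
    have h3 : 0 ≤ bestUtility a C 1 :=
      ((hC 0).individually_rational 1 h1).trans (le_bestUtility 0 1)
    linarith
  have h1 := hopt.total_le_of_sorted h (g₀ := G) (f₀ := effectiveSplit a C f)
    (X₀ := fun i => (C i).product) (e := receipt a C)
    (measurable_effectiveSplit ha1 hanti hf) (effectiveSplit_mem hf)
    (aestronglyMeasurable_product h.null hC)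
    (fun k => (ae_mem_types h.null).mono fun θ hθ => (hC k).mem θ hθ) hGanti
    (fun θ hθ => by
      obtain ⟨i, -, h2⟩ := exists_bestVariance_eq a C θ
      rw [hGeq θ hθ, h2]
      exact var_nonneg _)
    (fun k => by
      filter_upwards [ae_mem_types h.null] with θ hθ h2
      rw [hGeq θ hθ, ← var_eq]
      exact (of_share_effectiveSplit_ne_zero hθ h2).2)
    (fun k => integrable_share_mul (measurable_effectiveSplit ha1 hanti hf)
      (effectiveSplit_mem hf) k (integrable_receipt h.pos h.null hC k))
    (fun k => by
      filter_upwards [ae_mem_types h.null] with θ hθ h2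
      refine ⟨θ, hθ, ?_⟩
      rw [← var_eq, receipt, ← (of_share_effectiveSplit_ne_zero hθ h2).1]
      exact add_le_add_left (hrent θ hθ) _)
  refine h1.trans (le_of_eq ?_)
  simp only [aggregateRisk, Fin.sum_univ_two,
    assessment_eq h.pos ha1 h.ac h.null h.claims hC hf, EReal.coe_add]
  exact add_add_add_comm _ _ _ _

end lower


/-! ### Catalogues that implement a plan -/

theorem rent_sub_le {g : ℝ → ℝ} (hg : Antitone g) (θ t : ℝ) :
    rent g t + (t - θ) * g t ≤ rent g θ := by
  have h1 : rent g θ = (∫ s in θ..t, g s) + rent g t :=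
    (intervalIntegral.integral_add_adjacent_intervals hg.intervalIntegrable
      hg.intervalIntegrable).symm
  have h2 : (t - θ) * g t ≤ ∫ s in θ..t, g s := by
    rcases le_total θ t with h | h
    · have := intervalIntegral.integral_mono_on h (intervalIntegrable_const (μ := volume) (c := g t))
        hg.intervalIntegrable fun s hs => hg hs.2
      simpa using this
    · have := intervalIntegral.integral_mono_on h hg.intervalIntegrable
        (intervalIntegrable_const (μ := volume) (c := g t)) fun s hs => hg hs.1
      rw [intervalIntegral.integral_symm]
      simp only [intervalIntegral.integral_const, smul_eq_mul] at this
      linarith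
  linarith

/-- Best responses to the closed menu spanned by the contracts meant for the types in `E` and by
the null contract. -/
theorem exists_best_responses {a K : ℝ} (ha : 0 < a) {g : ℝ → ℝ} (hg : Antitone g)
    (h0 : ∀ θ, 0 ≤ g θ) (hK : ∀ θ, g θ ≤ K) {E : Set ℝ} (hE : E ⊆ Icc a 1) :
    ∃ ℓ π : ℝ → ℝ, ∀ θ ∈ Icc a 1, 0 ≤ ℓ θ ∧ (∀ s, 0 ≤ s → (∀ t ∈ E, g t ≤ s) → ℓ θ ≤ s) ∧
      0 ≤ π θ - θ * ℓ θ ∧ π θ - θ * ℓ θ ≤ rent g θ ∧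
      (∀ τ ∈ Icc a 1, π τ - θ * ℓ τ ≤ π θ - θ * ℓ θ) ∧
      (θ ∈ E → ℓ θ = g θ ∧ π θ = outlay g θ) := by
  -- A contract is recorded as (variance, mean minus price), so type `θ` values `m` at `m.2 - θ *
  -- m.1`. The null contract keeps utilities nonnegative, and the closure is compact, so best
  -- responses exist.
  set M₀ : Set (ℝ × ℝ) := insert (0, 0) ((fun t => (g t, outlay g t)) '' E) with hM₀
  set M := closure M₀
  have hK0 : 0 ≤ K := (h0 0).trans (hK 0)
  have hMsub : M₀ ⊆ Icc 0 K ×ˢ Icc 0 (2 * K) := by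
    rintro m (rfl | ⟨t, ht, rfl⟩)
    · exact ⟨⟨le_rfl, hK0⟩, ⟨le_rfl, by positivity⟩⟩
    · exact ⟨⟨h0 t, hK t⟩, outlay_mem ha hg h0 hK (hE ht)⟩
  have hMc : IsCompact M := (isCompact_Icc.prod isCompact_Icc).closure_of_subset hMsub
  have hMrent : ∀ θ ∈ Icc a 1, ∀ m ∈ M, m.2 - θ * m.1 ≤ rent g θ := by
    intro θ hθ
    refine closure_minimal (t := {m : ℝ × ℝ | m.2 - θ * m.1 ≤ rent g θ}) ?_
      (isClosed_le (by fun_prop) continuous_const)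
    rintro m (rfl | ⟨t, ht, rfl⟩)
    · simpa using (rent_mem ha hg h0 hK hθ).1
    · have := rent_sub_le hg θ t
      simp only [Set.mem_ofPred, outlay]
      linarith
  have hMs : ∀ s, 0 ≤ s → (∀ t ∈ E, g t ≤ s) → ∀ m ∈ M, m.1 ≤ s := by
    intro s hs hgs
    refine closure_minimal (t := {m : ℝ × ℝ | m.1 ≤ s}) ?_
      (isClosed_le (by fun_prop) continuous_const)
    rintro m (rfl | ⟨t, ht, rfl⟩)
    · exact hs
    · exact hgs t ht
  have hM0 : ∀ m ∈ M, 0 ≤ m.1 := by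
    refine closure_minimal (t := {m : ℝ × ℝ | 0 ≤ m.1}) (fun m hm => (hMsub hm).1.1)
      (isClosed_le continuous_const (by fun_prop))
  have hzero : ((0, 0) : ℝ × ℝ) ∈ M := subset_closure (mem_insert _ _)
  have hex : ∀ θ, ∃ m : ℝ × ℝ, θ ∈ Icc a 1 → m ∈ M ∧
      (∀ m' ∈ M, m'.2 - θ * m'.1 ≤ m.2 - θ * m.1) ∧ (θ ∈ E → m = (g θ, outlay g θ)) := by
    intro θ
    -- A type of `E` keeps its own contract, which is optimal because it yields `rent g θ`, the
    -- upper bound over the whole menu.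
    by_cases hθE : θ ∈ E
    · refine ⟨(g θ, outlay g θ), fun hθ => ⟨subset_closure (mem_insert_of_mem _ ⟨θ, hθE, rfl⟩),
        fun m' hm' => ?_, fun _ => rfl⟩⟩
      have := hMrent θ hθ m' hm'
      simp only [outlay]
      linarith
    · obtain ⟨m, hm, hmax⟩ := hMc.exists_isMaxOn ⟨_, hzero⟩
        (f := fun m : ℝ × ℝ => m.2 - θ * m.1) (by fun_prop)
      exact ⟨m, fun _ => ⟨hm, fun m' hm' => hmax hm', fun h => absurd h hθE⟩⟩
  choose m hm using hex
  refine ⟨fun θ => (m θ).1, fun θ => (m θ).2, fun θ hθ => ?_⟩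
  obtain ⟨h1, h2, h3⟩ := hm θ hθ
  exact ⟨hM0 _ h1, fun s hs hgs => hMs s hs hgs _ h1, by simpa using h2 _ hzero, hMrent θ hθ _ h1,
    fun τ hτ => h2 _ (hm τ hτ).1, fun h => ⟨congrArg Prod.fst (h3 h), congrArg Prod.snd (h3 h)⟩⟩

section implementation

variable {Ω : Type*} [MeasurableSpace Ω] {P : Measure Ω} [IsProbabilityMeasure P] {a K : ℝ}
  {μ : Measure ℝ}

/-- A claim whose variance is a prescribed number below that of a given feasible claim. -/
theorem smul_sqrt_mem {𝒳 : Set (Claim P)} (h𝒳 : Convex ℝ 𝒳) (h0 : 0 ∈ 𝒳) {Z : Claim P}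
    (hZ : Z ∈ 𝒳) {ℓ : ℝ} (hℓ0 : 0 ≤ ℓ) (hℓ : ℓ ≤ var Z) :
    √(ℓ / var Z) • Z ∈ 𝒳 ∧ var (√(ℓ / var Z) • Z) = ℓ := by
  have h1 : √(ℓ / var Z) ≤ 1 := Real.sqrt_le_one.2 (div_le_one_of_le₀ hℓ (var_nonneg Z))
  refine ⟨h𝒳.smul_mem_of_zero_mem h0 hZ ⟨Real.sqrt_nonneg _, h1⟩, ?_⟩
  rw [var_eq, map_smul, norm_smul, mul_pow, ← var_eq, Real.norm_eq_abs, sq_abs,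
    Real.sq_sqrt (div_nonneg hℓ0 (var_nonneg Z))]
  rcases (var_nonneg Z).eq_or_lt with h | h
  · rw [← h, mul_zero]
    linarith
  · exact div_mul_cancel₀ _ h.ne'

/-- A schedule and claims of matching variances are implemented by an admissible catalogue. -/
theorem exists_catalogue (ha : 0 < a) (ha1 : a < 1) {𝒳 : Set (Claim P)} (h𝒳 : Convex ℝ 𝒳)
    (h𝒳0 : 0 ∈ 𝒳) (hμΘ : μ (types a)ᶜ = 0) {g w : ℝ → ℝ} (hg : Antitone g) (h0 : ∀ θ, 0 ≤ g θ)
    (hK : ∀ θ, g θ ≤ K) (hw : Measurable w) {X : ℝ → Claim P} (hX : AEStronglyMeasurable X μ)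
    {Z : Claim P} (hZ : Z ∈ 𝒳)
    (hXZ : ∀ᵐ θ ∂μ, w θ ≠ 0 → X θ ∈ 𝒳 ∧ var (X θ) = g θ ∧ g θ ≤ var Z) :
    ∃ C : Catalogue P, IsAdmissible a μ 𝒳 C ∧
      (∀ θ ∈ types a, indirectUtility a C θ ≤ rent g θ) ∧
      ∀ᵐ θ ∂μ, w θ ≠ 0 → C.product θ = X θ ∧ indirectUtility a C θ = rent g θ := by
  classical
  obtain ⟨N, hN, hNm, hNμ⟩ := exists_measurable_superset_of_null (ae_iff.1 hXZ)
  set E : Set ℝ := types a ∩ {θ | w θ ≠ 0} ∩ Nᶜ with hE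
  have hEm : MeasurableSet E :=
    (measurableSet_types.inter (measurableSet_eq_fun hw measurable_const).compl).inter hNm.compl
  have hEg : ∀ θ ∈ E, X θ ∈ 𝒳 ∧ var (X θ) = g θ ∧ g θ ≤ var Z := by
    intro θ hθ
    by_contra h
    exact hθ.2 (hN fun h' => h (h' hθ.1.2))
  have hEae : ∀ᵐ θ ∂μ, w θ ≠ 0 → θ ∈ E := by
    filter_upwards [ae_mem_types hμΘ, measure_eq_zero_iff_ae_notMem.1 hNμ] with θ h1 h2 h3
    exact ⟨⟨h1, h3⟩, h2⟩
  obtain ⟨ℓ, π, hℓπ⟩ := exists_best_responses ha hg h0 hK (E := E) fun θ hθ => hθ.1.1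
  have hℓ0 : ∀ θ ∈ types a, 0 ≤ ℓ θ := fun θ hθ => (hℓπ θ hθ).1
  have hℓZ : ∀ θ ∈ types a, ℓ θ ≤ var Z := fun θ hθ =>
    (hℓπ θ hθ).2.1 _ (var_nonneg Z) fun t ht => (hEg t ht).2.2
  -- Buyers keep their claims. Other types need only some feasible claim of variance `ℓ θ`, and `ℓ θ
  -- ≤ var Z` lets a multiple of `Z` serve.
  set Y : ℝ → Claim P := E.piecewise X fun θ => √(ℓ θ / var Z) • Z with hY
  have hYmem : ∀ θ ∈ types a, Y θ ∈ 𝒳 ∧ var (Y θ) = ℓ θ := by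
    intro θ hθ
    by_cases h : θ ∈ E
    · rw [hY, piecewise_eq_of_mem _ _ _ h]
      exact ⟨(hEg θ h).1, (hEg θ h).2.1.trans ((hℓπ θ hθ).2.2.2.2.2 h).1.symm⟩
    · rw [hY, piecewise_eq_of_notMem _ _ _ h]
      exact smul_sqrt_mem h𝒳 h𝒳0 hZ (hℓ0 θ hθ) (hℓZ θ hθ)
  -- The price makes mean minus price equal to `π`, so utilities depend on `π` and `ℓ` only.
  set C : Catalogue P := ⟨Y, fun θ => mean (Y θ) - π θ⟩ with hC
  have hutil : ∀ θ, ∀ τ ∈ types a, utility θ (C.product τ) - C.price τ = π τ - θ * ℓ τ := by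
    intro θ τ hτ
    simp only [hC, utility, (hYmem τ hτ).2]
    ring
  have hIC : ∀ θ ∈ types a, ∀ τ ∈ types a,
      utility θ (C.product τ) - C.price τ ≤ utility θ (C.product θ) - C.price θ := by
    intro θ hθ τ hτ
    rw [hutil θ τ hτ, hutil θ θ hθ]
    exact (hℓπ θ hθ).2.2.2.2.1 τ hτ
  have hv : ∀ θ ∈ types a, indirectUtility a C θ = π θ - θ * ℓ θ := fun θ hθ => by
    rw [indirectUtility_eq hIC hθ, hutil θ θ hθ]
  have hsub : ∀ θ ∈ types a, ∀ τ ∈ types a,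
      indirectUtility a C τ - (θ - τ) * ℓ τ ≤ indirectUtility a C θ := by
    intro θ hθ τ hτ
    rw [hv θ hθ, hv τ hτ]
    have := (hℓπ θ hθ).2.2.2.2.1 τ hτ
    linarith
  have hℓanti : AntitoneOn ℓ (types a) := antitoneOn_of_subgradient hsub
  set ℓ' : ℝ → ℝ := fun θ => ℓ (projIcc a 1 ha1.le θ) with hℓ'
  have hℓ'anti : Antitone ℓ' := antitone_comp_projIcc ha1.le hℓanti
  have hℓ'eq : ∀ θ ∈ types a, ℓ' θ = ℓ θ := fun θ hθ => by
    simp only [hℓ', projIcc_of_mem ha1.le hθ]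
  refine ⟨C, ⟨?_, fun θ hθ => (hYmem θ hθ).1, hIC, fun θ hθ => ?_, ?_⟩, fun θ hθ => ?_, ?_⟩
  · have h1 : AEStronglyMeasurable (E.piecewise X fun θ => √(ℓ' θ / var Z) • Z) μ := by
      refine AEStronglyMeasurable.piecewise hEm hX.restrict ?_
      exact ((hℓ'anti.measurable.div_const _).sqrt.aestronglyMeasurable.smul_const Z).restrict
    rw [restrict_types hμΘ]
    refine h1.congr ?_
    filter_upwards [ae_mem_types hμΘ] with θ hθ
    simp only [hC, hY, Set.piecewise, hℓ'eq θ hθ]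
  · rw [hv θ hθ]
    exact (hℓπ θ hθ).2.2.1
  · rw [ae_restrict_iff' measurableSet_types]
    have hc : ∀ᵐ θ : ℝ, ContinuousAt ℓ' θ := by
      have := (hℓ'anti.countable_not_continuousAt).measure_zero (volume : Measure ℝ)
      exact ae_iff.2 this
    filter_upwards [hc, Measure.ae_ne volume a, Measure.ae_ne volume 1] with θ h1 h2 h3 hθ
    have h4 : types a ∈ 𝓝 θ :=
      Icc_mem_nhds (lt_of_le_of_ne hθ.1 h2.symm) (lt_of_le_of_ne hθ.2 h3)
    have h5 := hasDerivAt_of_subgradient h4 (v := indirectUtility a C) (γ := ℓ')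
      (fun y hy z hz => by rw [hℓ'eq z hz]; exact hsub y hy z hz) h1
    rwa [hℓ'eq θ hθ, ← (hYmem θ hθ).2] at h5
  · rw [hv θ hθ]
    exact (hℓπ θ hθ).2.2.2.1
  · filter_upwards [hEae] with θ hθ hwθ
    have h1 := hθ hwθ
    have h2 := (hℓπ θ h1.1.1).2.2.2.2.2 h1
    refine ⟨piecewise_eq_of_mem E X (fun θ => √(ℓ θ / var Z) • Z) h1, ?_⟩
    rw [hv θ h1.1.1, h2.1, h2.2, outlay]
    ring

end implementation

/-! ### Implementation of an optimal plan and conclusion. -/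

section main

variable {Ω : Type*} [MeasurableSpace Ω] {P : Measure Ω} [IsProbabilityMeasure P] {a K R : ℝ}
  {μ : Measure ℝ} [IsFiniteMeasure μ] {𝒳 : Fin 2 → Set (Claim P)} {ρ : Fin 2 → Claim P → EReal}
  {W : Fin 2 → Claim P} {g f : ℝ → ℝ} {X : Fin 2 → ℝ → Claim P}

/-- Schedules with claims of matching variances are implemented by admissible catalogues, the split
serving as tie-breaking rule. -/
theorem exists_catalogues_assessment_eq
    (h : IsMarket a K R μ (centring P) 𝒳 fun i y => ρ i (W i - y))
    (hplan : IsPlan μ (centring P) 𝒳 K g f X)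
    (hvar : ∀ i, ∀ᵐ θ ∂μ, share f i θ ≠ 0 → ‖centring P (X i θ)‖ ^ 2 = g θ)
    (hZ : ∀ i, ∃ Z ∈ 𝒳 i, ∀ᵐ θ ∂μ, share f i θ ≠ 0 → g θ ≤ ‖centring P Z‖ ^ 2) :
    ∃ C : Fin 2 → Catalogue P, (∀ i, IsAdmissible a μ (𝒳 i) (C i)) ∧ IsTieBreakingRule a f ∧
      ∀ i, assessment a μ ρ W C f i = ρ i (W i - traded μ (centring P) f X i) +
        ((∫ θ, share f i θ * outlay g θ ∂μ : ℝ) : EReal) := by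
  have hex : ∀ i, ∃ C : Catalogue P, IsAdmissible a μ (𝒳 i) C ∧
      (∀ θ ∈ types a, indirectUtility a C θ ≤ rent g θ) ∧
      ∀ᵐ θ ∂μ, share f i θ ≠ 0 → C.product θ = X i θ ∧ indirectUtility a C θ = rent g θ := by
    intro i
    obtain ⟨Z, hZ𝒳, hgZ⟩ := hZ i
    refine exists_catalogue h.pos h.lt_one (h.claims.convex i) (h.claims.zero_mem i) h.null
      hplan.anti hplan.nonneg hplan.le (measurable_share hplan.f_meas i) (hplan.meas i) hZ𝒳 ?_
    filter_upwards [hplan.mem i, hvar i, hgZ] with θ h1 h2 h3 h4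
    simp only [var_eq]
    exact ⟨h1, h2 h4, h3 h4⟩
  choose C hC hle heq using hex
  have hf : IsTieBreakingRule a f := ⟨hplan.f_meas, fun θ _ => hplan.f_mem θ⟩
  -- Both indirect utilities are at most `rent g`, and a firm with a positive share attains it. A
  -- strict preference for one firm therefore means that the other has share zero, and at ties `f`
  -- itself decides.
  have hsplit : ∀ᵐ θ ∂μ, effectiveSplit a C f θ = f θ := by
    filter_upwards [ae_mem_types h.null, heq 0, heq 1] with θ hθ h0 h1
    have hs0 : share f 0 θ = f θ := by simp [share]
    have hs1 : share f 1 θ = 1 - f θ := by simp [share]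
    have hse : share (effectiveSplit a C f) 0 θ = effectiveSplit a C f θ := by simp [share]
    by_cases h2 : θ ∈ ties a C
    · rw [← hse, share_effectiveSplit_of_mem_ties h2, hs0]
    · by_cases h3 : θ ∈ segment a C 0
      · rw [← hse, share_effectiveSplit_of_mem_segment h3]
        by_contra h4
        have h5 := (h1 (by rw [hs1]; intro h5; exact h4 (by linarith))).2
        have h6 : indirectUtility a (C 1) θ < indirectUtility a (C 0) θ := h3.2
        exact absurd (hle 0 θ hθ) (not_le.2 (h5 ▸ h6))
      · rw [← hse, share_effectiveSplit_of_notMem hθ h3 h2]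
        by_contra h4
        have h5 := (h0 (by rw [hs0]; exact Ne.symm h4)).2
        refine h3 ⟨hθ, lt_of_le_of_ne ?_ fun h6 => h2 ⟨hθ, h6.symm⟩⟩
        rw [h5]
        exact hle 1 θ hθ
  have hshare : ∀ i, ∀ᵐ θ ∂μ, share (effectiveSplit a C f) i θ = share f i θ := fun i =>
    hsplit.mono fun θ hθ => by simp only [share, hθ]
  refine ⟨C, hC, hf, fun i => ?_⟩
  rw [assessment_eq h.pos h.lt_one.le h.ac h.null h.claims hC hf]
  have h1 : traded μ (centring P) (effectiveSplit a C f) (fun i => (C i).product) i =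
      traded μ (centring P) f X i := by
    refine integral_congr_ae ?_
    filter_upwards [hshare i, heq i] with θ h1 h2
    rw [h1]
    by_cases h3 : share f i θ = 0
    · rw [h3, zero_smul, zero_smul]
    · rw [(h2 h3).1]
  have h2 : ∫ θ, share (effectiveSplit a C f) i θ * receipt a C i θ ∂μ =
      ∫ θ, share f i θ * outlay g θ ∂μ := by
    refine integral_congr_ae ?_
    filter_upwards [hshare i, heq i, hvar i] with θ h1 h2 h4
    rw [h1]
    by_cases h3 : share f i θ = 0
    · rw [h3, zero_mul, zero_mul]
    · rw [receipt, (h2 h3).1, (h2 h3).2, var_eq, h4 h3, outlay]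
  rw [h1, h2]

theorem exists_isSociallyEfficient
    (h : IsMarket a K R μ (centring P) 𝒳 fun i y => ρ i (W i - y)) :
    ∃ (C : Fin 2 → Catalogue P) (f : ℝ → ℝ), IsSociallyEfficient a μ 𝒳 ρ W C f := by
  obtain ⟨g, f, X, hplan, hmin⟩ := exists_optimal_plan h.pos h.ac h.null h.K_pos h.claims h.risk
  have hopt : IsOptimalPlan μ (centring P) 𝒳 (fun i y => ρ i (W i - y)) K g f X := ⟨hplan, hmin⟩
  -- With infinite least total every competitor has infinite aggregate risk, so the null plan
  -- suffices; it leaves each firm at its initial risk.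
  by_cases hfin : total μ (centring P) (fun i y => ρ i (W i - y)) g f X = ⊤
  · obtain ⟨C, hC, hf, hA⟩ := exists_catalogues_assessment_eq h (isPlan_zero h.K_pos h.claims)
      (fun i => by simp) fun i => ⟨0, h.claims.zero_mem i, by simp⟩
    refine ⟨C, 0, ⟨hC, hf, fun i => (hA i).trans_le ?_⟩, fun C' f' h' => ?_⟩
    · simp [traded, outlay, rent]
    · have := hopt.total_le_aggregateRisk h h'.admissible h'.tie_breaking
      rw [hfin, top_le_iff] at this
      rw [this]
      exact le_top
  · obtain ⟨C, hC, hf, hA⟩ := exists_catalogues_assessment_eq h hplan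
      (hopt.norm_sq_eq h hfin hplan.meas hplan.mem hplan.var_le fun _ => rfl)
      (hopt.exists_norm_sq_ge h hfin)
    refine ⟨C, f, ⟨hC, hf, fun i => (hA i).trans_le ?_⟩, fun C' f' h' => ?_⟩
    · simpa using hopt.risk_add_le h hfin i
    · refine le_trans (le_of_eq ?_)
        (hopt.total_le_aggregateRisk h h'.admissible h'.tie_breaking)
      simp only [aggregateRisk, hA, total, cost, Finset.sum_add_distrib]
      rw [← sum_integral_share_mul hplan.f_meas hplan.f_mem
        (integrable_outlay h.pos h.null hplan.anti hplan.nonneg hplan.le)]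
      simp only [Fin.sum_univ_two, EReal.coe_add]

end main

end OTC
end

theorem mainTheorem2 {Ω : Type*} [MeasurableSpace Ω] (P : Measure Ω) [IsProbabilityMeasure P]
    (a : ℝ) (ha : 0 < a) (ha1 : a < 1)
    (μ : Measure ℝ) [IsFiniteMeasure μ] (hμ : μ ≪ volume) (hμΘ : μ (OTC.types a)ᶜ = 0)
    (𝒳 : Fin 2 → Set (OTC.Claim P))
    (h𝒳closed : ∀ i, IsClosed (𝒳 i)) (h𝒳convex : ∀ i, Convex ℝ (𝒳 i))
    (h𝒳bdd : ∀ i, Bornology.IsBounded (𝒳 i)) (h𝒳zero : ∀ i, 0 ∈ 𝒳 i)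
    (W : Fin 2 → OTC.Claim P)
    (ρ : Fin 2 → OTC.Claim P → EReal)
    (hρ : ∀ i, OTC.IsConvexRiskMeasure P (ρ i))
    (hρlaw : ∀ i, OTC.LawInvariant P (ρ i))
    (hρFatou : ∀ i, OTC.FatouProperty P (ρ i)) :
    ∃ (C : Fin 2 → OTC.Catalogue P) (f : ℝ → ℝ), OTC.IsSociallyEfficient a μ 𝒳 ρ W C f := by
  obtain ⟨K, R, hK, h𝒳⟩ := OTC.exists_isClaimFamily h𝒳closed h𝒳convex h𝒳bdd h𝒳zero
  exact OTC.exists_isSociallyEfficient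
    ⟨ha, ha1, hμ, hμΘ, hK, h𝒳, OTC.isRiskPair hρ hρFatou W⟩
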